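/- **Proposition.** Let $n_1>n_2\ge 0$ be integers. *Model.* Let $z,\alpha>0$ and $t>0$, $t\neq1$, and let $x_{i,j}$ ($1\le i\le n_1$, $1\le j\le n_2+1$) be independent non-negative integer random variables with geometric laws $$\Pr(x_{i,j}=k)=(1-z^2t^{i+j-2})(z^2t^{i+j-2})^k\quad (j\ne n_2+1),\qquad \Pr(x_{i,n_2+1}=k)=(1-\alpha z t^{i-1})(\alpha z t^{i-1})^k,$$ where all parameters $z^2t^{i+j-2}$ ($j\le n_2$) and $\alpha z t^{i-1}$ are less than $1$ (e.g. $0<t<1$, $z<1$, $\alpha z<1$). For partitions $\mu,\kappa$ let $\Pr(\mu,\kappa)$ be the joint probability that, under the Robinson–Schensted–Knuth correspondence, the matrix $[x_{i,j}]$ gives a pair of semi-standard tableaux of shape $\mu$ (one of content $n_1$, the other of content $n_2+1$) and the submatrix of its first $n_2$ columns gives a pair of tableaux of shape $\kappa$ (one of content $n_1$, the other of content $n_2$). Put $h_j=\mu_j+n_2+1-j$ ($1\le j\le n_2+1$) and $r_j=\kappa_j+n_2+1-j$ ($1\le j\le n_2$). **(i)** $\Pr(\mu,\kappa)\neq0$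 if and only if $\mu$ has at most $n_2+1$ and $\kappa$ at most $n_2$ non-zero parts and $$h_1\ge r_1>h_2\ge r_2>\cdots>h_{n_2}\ge r_{n_2}>h_{n_2+1}\ge0 .$$ **(ii)** In that case, with $(t;t)_l=(1-t)(1-t^2)\cdots(1-t^l)$ and empty products equal to $1$, $\Pr(\mu,\kappa)$ equals $$K_{n_1,n_2}(\alpha,z,t)\,z^{\sum_{j=1}^{n_2}(h_j+r_j)}\alpha^{\sum_{j=1}^{n_2}(h_j-r_j)}(z\alpha)^{h_{n_2+1}}\prod_{i=1}^{n_2+1}\frac{(t;t)_{h_i+n_1-(n_2+1)}}{(t;t)_{h_i}}\prod_{1\le i<j\le n_2+1}(t^{h_j}-t^{h_i})\prod_{1\le i<j\le n_2}(t^{r_j}-t^{r_i}),$$ $$\begin{aligned}K_{n_1,n_2}(\alpha,z,t)={}&z^{-2\sum_{j=1}^{n_2}(n_2+1-j)}\,\frac{t^{-\sum_{j=1}^{n_2}(j-1)(n_2+1-j)}}{\prod_{l=1}^{n_2-1}(t;t)_l}\;t^{-\sum_{j=1}^{n_1-n_2-1}j(j-1)}\,t^{-(n_2+1)\sum_{j=1}^{n_1-n_2-1}j}\\&\times\frac{t^{-\sum_{j=1}^{n_1}(j-1)(n_2+1-j)}}{\prod_{l=1}^{n_1-1}(t;t)_l}\prod_{l=1}^{n_1-n_2-2}(t;t)_l\prod_{i=1}^{n_1}\prod_{j=1}^{n_2}(1-z^2t^{i+j-2})\prod_{i=1}^{n_1}(1-\alpha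 zt^{i-1}).\end{aligned}$$ **(iii)** (Jacobi limit.) Let $a>0$ and $a+a_1>0$. Put $t=e^{-1/L}$, $z=e^{-a/L}$, $\alpha=e^{-a_1/L}$, and let the non-negative integers $h_j,r_j$ depend on $L$ so that $h_j/L\to x_j$ and $r_j/L\to y_j$ as $L\to\infty$, where $$x_1>y_1>x_2>y_2>\cdots>x_{n_2}>y_{n_2}>x_{n_2+1}>0. \qquad (*)$$ Then the expression in (ii) multiplied by $L^{2n_2+1}$ tends to $$\begin{aligned}f_{a,a_1}(x,y)={}&\tilde K_{n_1,n_2}(a,a_1)\prod_{i=1}^{n_2+1}(1-e^{-x_i})^{n_1-(n_2+1)}\prod_{1\le i<j\le n_2+1}(e^{-x_j}-e^{-x_i})\prod_{1\le i<j\le n_2}(e^{-y_j}-e^{-y_i})\\&\times e^{-a\sum_{j=1}^{n_2}(x_j+y_j)}e^{-a_1\sum_{j=1}^{n_2}(x_j-y_j)}e^{-(a+a_1)x_{n_2+1}},\end{aligned}$$ $$\tilde K_{n_1,n_2}(a,a_1)=\frac{\prod_{l=1}^{n_1-n_2-2}l!}{(\prod_{l=1}^{n_1-1}l!)(\prod_{l=1}^{n_2-1}l!)}\,\frac{\Gamma(a+a_1+n_1)}{\Gamma(a+a_1)}\prod_{i=1}^{n_1}\frac{\Gamma(2a+i+n_2-1)}{\Gamma(2a+i-1)},$$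 and $f_{a,a_1}$ is a probability density on the region $(*)$: it is non-negative there and its integral over that region is $1$. **(iv)** Let $n_1=n_2+1$, $n:=n_2$, $-1<a$ and $A<a+1$. For $1>X_1>X_2>\cdots>X_{2n+1}>0$ put $x_j=-\log X_{2n+3-2j}$ ($1\le j\le n+1$) and $y_j=-\log X_{2n+2-2j}$ ($1\le j\le n$). Then $(x,y)$ satisfies $(*)$, and $$f_{(a+1)/2,\,-A/2}(x,y)\prod_{j=1}^{2n+1}\frac1{X_j}=\tilde K_{n_1,n_2}\!\left(\tfrac{a+1}2,-\tfrac A2\right)\prod_{j=1}^{2n+1}X_j^{(a-1)/2}\;X_1^{-A/2}\prod_{l=1}^{n}\Big(\frac{X_{2l+1}}{X_{2l}}\Big)^{-A/2}\prod_{1\le j<k\le n+1}(X_{2j-1}-X_{2k-1})\prod_{1\le j<k\le n}(X_{2j}-X_{2k}).$$ That is (the product of the $1/X_j$ being the Jacobian), in the variables $X$ the density is the analogue, for an odd number of coordinates, of $$\frac1C\prod_{j=1}^{2n}X_j^{(a-1)/2}\prod_{l=1}^n\Big(\frac{X_{2l}}{X_{2l-1}}\Big)^{-A/2}\prod_{1\le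 j<k\le n}(X_{2j-1}-X_{2k-1})(X_{2j}-X_{2k}).$$ -/

import Mathlib

open MeasureTheory ProbabilityTheory Filter Topology

noncomputable section

namespace RSKJacobi

/-! ### The Robinson-Schensted-Knuth correspondence -/

/-- Schensted row insertion of the letter `x` into a weakly increasing row: `x` replaces the first
entry `> x`, which is returned as the bumped letter; if there is none, `x` is appended. -/
def rowInsert (x : ℕ) : List ℕ → List ℕ × Option ℕ
  | [] => ([x], none)
  | y :: ys =>
    if x < y then (x :: ys, some y)
    else (y :: (rowInsert x ys).1, (rowInsert x ys).2)

/-- One step of the correspondence. A pair of tableaux `(P, Q)` of the same shape is stored as the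
list of its pairs of rows, from the top. The letter `x` is inserted into `P` by repeated row
insertion, and the new box is labelled `k` in `Q`. -/
def rskInsert (k : ℕ) : ℕ → List (List ℕ × List ℕ) → List (List ℕ × List ℕ)
  | x, [] => [([x], [k])]
  | x, (p, q) :: T =>
    match rowInsert x p with
    | (p', none) => (p', q ++ [k]) :: T
    | (p', some y) => (p', q) :: rskInsert k y T

/-- The biword (generalized permutation) of a non-negative integer matrix: the pair
`(row label, column label)` occurs as often as the entry says, and the pairs are listed in
lexicographic order. Labels start from `1`. -/
def biword {m n : ℕ} (A : Matrix (Fin m) (Fin n) ℕ) : List (ℕ × ℕ) :=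
  (List.finRange m).flatMap fun i =>
    (List.finRange n).flatMap fun j => List.replicate (A i j) ((i : ℕ) + 1, (j : ℕ) + 1)

/-- The RSK correspondence: `(P, Q)` is obtained by inserting the column labels of the biword into
`P` and recording the row labels in `Q`; so for an `m × n` matrix `P` has content `n`
(entries in `1, …, n`) and `Q` has content `m` (entries in `1, …, m`). -/
def rsk {m n : ℕ} (A : Matrix (Fin m) (Fin n) ℕ) : List (List ℕ) × List (List ℕ) :=
  let T := (biword A).foldl (fun T w => rskInsert w.1 w.2 T) []
  (T.map Prod.fst, T.map Prod.snd)

/-- Under the RSK correspondence `A` gives a pair of tableaux both of shape `μ`. -/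
def GivesShape {m n : ℕ} (A : Matrix (Fin m) (Fin n) ℕ) (μ : YoungDiagram) : Prop :=
  (rsk A).1.map List.length = μ.rowLens ∧ (rsk A).2.map List.length = μ.rowLens

/-! ### The percolation model -/

/-- The parameter of the geometric law at site `(i, j)` of the `n₁ × (n₂ + 1)` lattice; with indices
counted from `1` it is `z ^ 2 * t ^ (i + j - 2)` for `j ≠ n₂ + 1`, and `α * z * t ^ (i - 1)` in
column `n₂ + 1`. -/
def siteParam {n₁ n₂ : ℕ} (z α t : ℝ) (i : Fin n₁) (j : Fin (n₂ + 1)) : ℝ :=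
  if j = Fin.last n₂ then α * z * t ^ (i : ℕ) else z ^ 2 * t ^ ((i : ℕ) + (j : ℕ))

/-- The random variables `X i j` are independent and geometric, with
`Pr (X i j = k) = (1 - q) * q ^ k` where `q = siteParam z α t i j`. -/
def HasSiteLaw {n₁ n₂ : ℕ} {Ω : Type*} [MeasurableSpace Ω] (P : Measure Ω)
    (X : Fin n₁ → Fin (n₂ + 1) → Ω → ℕ) (z α t : ℝ) : Prop :=
  (∀ i j, Measurable (X i j)) ∧
  iIndepFun (fun p : Fin n₁ × Fin (n₂ + 1) => X p.1 p.2) P ∧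
  ∀ i j (k : ℕ), P.real {ω | X i j ω = k} = (1 - siteParam z α t i j) * siteParam z α t i j ^ k

/-- The configuration as a matrix. -/
def config {n₁ n₂ : ℕ} {Ω : Type*} (X : Fin n₁ → Fin (n₂ + 1) → Ω → ℕ) (ω : Ω) :
    Matrix (Fin n₁) (Fin (n₂ + 1)) ℕ :=
  Matrix.of fun i j => X i j ω

/-- The subconfiguration formed by the first `n₂` columns. -/
def subconfig {n₁ n₂ : ℕ} {Ω : Type*} (X : Fin n₁ → Fin (n₂ + 1) → Ω → ℕ) (ω : Ω) :
    Matrix (Fin n₁) (Fin n₂) ℕ :=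
  Matrix.of fun i j => X i j.castSucc ω

/-- The joint probability that the configuration gives a pair of tableaux of shape `μ` and that the
subconfiguration gives a pair of tableaux of shape `κ`. -/
def jointProb {n₁ n₂ : ℕ} {Ω : Type*} [MeasurableSpace Ω] (P : Measure Ω)
    (X : Fin n₁ → Fin (n₂ + 1) → Ω → ℕ) (μ κ : YoungDiagram) : ℝ :=
  P.real {ω | GivesShape (config X ω) μ ∧ GivesShape (subconfig X ω) κ}

/-- With `j` counted from `1`: `h_j = μ_j + n₂ + 1 - j` for `1 ≤ j ≤ n₂ + 1`. -/
def shiftMu (n₂ : ℕ) (μ : YoungDiagram) (j : Fin (n₂ + 1)) : ℕ := μ.rowLen j + (n₂ - (j : ℕ))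

/-- With `j` counted from `1`: `r_j = κ_j + n₂ + 1 - j` for `1 ≤ j ≤ n₂`. -/
def shiftKappa (n₂ : ℕ) (κ : YoungDiagram) (j : Fin n₂) : ℕ := κ.rowLen j + (n₂ - (j : ℕ))

/-- `h_1 ≥ r_1 > h_2 ≥ r_2 > ⋯ > h_{n₂} ≥ r_{n₂} > h_{n₂ + 1} (≥ 0)`. -/
def Interlaced {n₂ : ℕ} (h : Fin (n₂ + 1) → ℕ) (r : Fin n₂ → ℕ) : Prop :=
  ∀ j : Fin n₂, r j ≤ h j.castSucc ∧ h j.succ < r j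

/-! ### The explicit joint probability -/

/-- `(t; t)_l = (1 - t) (1 - t ^ 2) ⋯ (1 - t ^ l)`. -/
def qPoch (t : ℝ) (l : ℕ) : ℝ := ∏ m ∈ Finset.Icc 1 l, (1 - t ^ m)

/-- The constant `K_{n₁, n₂} (α, z, t)`, for `n₁ > n₂`. -/
def K (n₁ n₂ : ℕ) (α z t : ℝ) : ℝ :=
  z ^ (-2 * ∑ j ∈ Finset.Icc 1 n₂, ((n₂ : ℤ) + 1 - (j : ℤ)))
  * (t ^ (-∑ j ∈ Finset.Icc 1 n₂, ((j : ℤ) - 1) * ((n₂ : ℤ) + 1 - (j : ℤ)))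
      / ∏ l ∈ Finset.Icc 1 (n₂ - 1), qPoch t l)
  * t ^ (-∑ j ∈ Finset.Icc 1 (n₁ - n₂ - 1), (j : ℤ) * ((j : ℤ) - 1))
  * t ^ (-((n₂ : ℤ) + 1) * ∑ j ∈ Finset.Icc 1 (n₁ - n₂ - 1), (j : ℤ))
  * (t ^ (-∑ j ∈ Finset.Icc 1 n₁, ((j : ℤ) - 1) * ((n₂ : ℤ) + 1 - (j : ℤ)))
      / ∏ l ∈ Finset.Icc 1 (n₁ - 1), qPoch t l)
  * (∏ l ∈ Finset.Icc 1 (n₁ - n₂ - 2), qPoch t l)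
  * (∏ i ∈ Finset.Icc 1 n₁, ∏ j ∈ Finset.Icc 1 n₂, (1 - z ^ 2 * t ^ (i + j - 2)))
  * ∏ i ∈ Finset.Icc 1 n₁, (1 - α * z * t ^ (i - 1))

/-- The explicit form of the joint probability, as a function of `h_1, …, h_{n₂ + 1}` and
`r_1, …, r_{n₂}`. -/
def probFormula (n₁ n₂ : ℕ) (α z t : ℝ) (h : Fin (n₂ + 1) → ℕ) (r : Fin n₂ → ℕ) : ℝ :=
  K n₁ n₂ α z t
  * z ^ (∑ j : Fin n₂, (h j.castSucc + r j))
  * α ^ (∑ j : Fin n₂, ((h j.castSucc : ℤ) - (r j : ℤ)))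
  * (z * α) ^ h (Fin.last n₂)
  * (∏ i, qPoch t (h i + (n₁ - (n₂ + 1))) / qPoch t (h i))
  * (∏ i, ∏ j ∈ Finset.Ioi i, (t ^ h j - t ^ h i))
  * ∏ i, ∏ j ∈ Finset.Ioi i, (t ^ r j - t ^ r i)

/-! ### The Jacobi limit -/

/-- The constant `K̃_{n₁, n₂} (a, a₁)`, for `n₁ > n₂`. -/
def Ktilde (n₁ n₂ : ℕ) (a a₁ : ℝ) : ℝ :=
  ((∏ l ∈ Finset.Icc 1 (n₁ - n₂ - 2), (l.factorial : ℝ))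
      / ((∏ l ∈ Finset.Icc 1 (n₁ - 1), (l.factorial : ℝ))
        * ∏ l ∈ Finset.Icc 1 (n₂ - 1), (l.factorial : ℝ)))
  * (Real.Gamma (a + a₁ + n₁) / Real.Gamma (a + a₁))
  * ∏ i ∈ Finset.Icc 1 n₁,
      Real.Gamma (2 * a + (i : ℝ) + (n₂ : ℝ) - 1) / Real.Gamma (2 * a + (i : ℝ) - 1)

/-- The limiting density, as a function of `x_1, …, x_{n₂ + 1}` and `y_1, …, y_{n₂}`. -/
def jacobiDensity (n₁ n₂ : ℕ) (a a₁ : ℝ) (x : Fin (n₂ + 1) → ℝ) (y : Fin n₂ → ℝ) : ℝ :=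
  Ktilde n₁ n₂ a a₁
  * (∏ i, (1 - Real.exp (-x i)) ^ (n₁ - (n₂ + 1)))
  * (∏ i, ∏ j ∈ Finset.Ioi i, (Real.exp (-x j) - Real.exp (-x i)))
  * (∏ i, ∏ j ∈ Finset.Ioi i, (Real.exp (-y j) - Real.exp (-y i)))
  * Real.exp (-a * ∑ j : Fin n₂, (x j.castSucc + y j))
  * Real.exp (-a₁ * ∑ j : Fin n₂, (x j.castSucc - y j))
  * Real.exp (-(a + a₁) * x (Fin.last n₂))

/-- `x_1 > y_1 > x_2 > y_2 > ⋯ > x_{n₂} > y_{n₂} > x_{n₂ + 1} > 0`. -/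
def region (n₂ : ℕ) : Set ((Fin (n₂ + 1) → ℝ) × (Fin n₂ → ℝ)) :=
  {p | (∀ j : Fin n₂, p.2 j < p.1 j.castSucc ∧ p.1 j.succ < p.2 j) ∧ 0 < p.1 (Fin.last n₂)}

/-! ### The analogue for an odd number of coordinates in `(0, 1)`

Coordinates `X_1, …, X_{2n+1}` are indexed from `0` in the code: `X_k` is `X (k - 1)`. -/

/-- `∏_{j ≤ 2n+1} X_j ^ ((a-1)/2) * X_1 ^ (-A/2) * ∏_{l ≤ n} (X_{2l+1} / X_{2l}) ^ (-A/2)`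
`* ∏_{j < k ≤ n+1} (X_{2j-1} - X_{2k-1}) * ∏_{j < k ≤ n} (X_{2j} - X_{2k})`. -/
def oddWeight (n : ℕ) (a A : ℝ) (X : Fin (2 * n + 1) → ℝ) : ℝ :=
  (∏ j, X j ^ ((a - 1) / 2))
  * X 0 ^ (-A / 2)
  * (∏ l : Fin n, (X ⟨2 * l + 2, by omega⟩ / X ⟨2 * l + 1, by omega⟩) ^ (-A / 2))
  * (∏ j : Fin (n + 1), ∏ k ∈ Finset.Ioi j, (X ⟨2 * j, by omega⟩ - X ⟨2 * k, by omega⟩))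
  * ∏ j : Fin n, ∏ k ∈ Finset.Ioi j, (X ⟨2 * j + 1, by omega⟩ - X ⟨2 * k + 1, by omega⟩)

/-- `x_j = - log X_{2n+3-2j}` for `1 ≤ j ≤ n + 1`. -/
def xOfOdd (n : ℕ) (X : Fin (2 * n + 1) → ℝ) (j : Fin (n + 1)) : ℝ :=
  -Real.log (X ⟨2 * n - 2 * j, by omega⟩)

/-- `y_j = - log X_{2n+2-2j}` for `1 ≤ j ≤ n`. -/
def yOfOdd (n : ℕ) (X : Fin (2 * n + 1) → ℝ) (j : Fin n) : ℝ :=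
  -Real.log (X ⟨2 * n - 1 - 2 * j, by omega⟩)

end RSKJacobi

end

/-! Each site parameter is a row factor times a column factor, so the probability of a matrix is a
constant times a monomial in row variables `t ^ i` and column variables `z ^ 2 * t ^ j`, `α * z`.
The joint law of the two shapes is therefore a weighted count of matrices.

The count uses Fomin's growth diagrams. Record a tableau by the shapes formed by its letters `≤ k`,
for each `k`. Inserting one row of the matrix changes these shapes cell by cell: around a cell,
three partitions `α`, `β`, `γ` and the entry `c` determine the fourth
(`levelShape_insertWord_succ`). This local rule is invertible on horizontal strips and conserves the
number of boxes (`localRule_iff`, `skewSize_localRule`). Summing over matrices row by row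
(`tsum_step`, `tsum_growth`) gives the weight of the chain of shapes in the column variables times a
Schur function in the row variables. The last two shapes of the chain are `κ` and `μ`; summing over
the others leaves `(α z)^|μ/κ| s_μ s_κ` when `μ/κ` is a horizontal strip, and zero otherwise
(`tsum_shapes`, `measure_shapes`). This is the support statement.

For geometric variables the branching rule sums a Vandermonde determinant over interlacing integers.
The sum goes into the rows, becomes geometric, and gives back a larger Vandermonde determinant
(`prod_pow_vd_sum`), whence `schur_eq`. Padding `μ` with zero parts up to `n₁` produces the ratios
of q-Pochhammer symbols (`vd_ratio`), and matching the powers of `z`, `α`, `t` gives the explicit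
formula.

The Jacobi limit is taken factor by factor; `degree_identity` is the power count in `L`. For the
total mass, fix `y`: the coordinates of `x` vary in independent intervals, so the integral of a
determinant is a determinant of integrals, and row and column operations reduce it to a weighted
Vandermonde product in `y` (`integral_fiber`). What remains is a Selberg integral with squared
Vandermonde product, found by evaluating one interlacing integral in both orders
(`lintegral_expVd_sq`). The odd-coordinate form is a comparison of exponents in the variables `log
X_j`. -/

namespace RSKJacobi

/-! ### Row insertion and counting functions -/

/-- The number of letters `≤ k` in a word. -/
def cnt (p : List ℕ) (k : ℕ) : ℕ := p.countP (· ≤ k)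

@[simp] lemma cnt_nil (k : ℕ) : cnt [] k = 0 := rfl

lemma cnt_cons (x : ℕ) (p : List ℕ) (k : ℕ) :
    cnt (x :: p) k = cnt p k + if x ≤ k then 1 else 0 := by
  simp [cnt, List.countP_cons]

lemma cnt_append (p q : List ℕ) (k : ℕ) : cnt (p ++ q) k = cnt p k + cnt q k := by
  simp [cnt]

lemma cnt_mono (p : List ℕ) {j k : ℕ} (h : j ≤ k) : cnt p j ≤ cnt p k := by
  unfold cnt
  exact List.countP_mono_left fun x _ hx => by simp at hx ⊢; omega

lemma cnt_eq_zero {p : List ℕ} {k : ℕ} (h : ∀ x ∈ p, k < x) : cnt p k = 0 := by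
  unfold cnt
  rw [List.countP_eq_zero]
  intro x hx
  have := h x hx
  simp only [decide_eq_true_eq]; omega

lemma cnt_eq_length {p : List ℕ} {k : ℕ} (h : ∀ x ∈ p, x ≤ k) : cnt p k = p.length := by
  unfold cnt
  rw [List.countP_eq_length]
  intro x hx
  simpa using h x hx

lemma rowInsert_cons_of_lt {x y : ℕ} (h : x < y) (ys : List ℕ) :
    rowInsert x (y :: ys) = (x :: ys, some y) := by
  rw [rowInsert, if_pos h]

lemma rowInsert_cons_of_le {x y : ℕ} (h : y ≤ x) (ys : List ℕ) :
    rowInsert x (y :: ys) = (y :: (rowInsert x ys).1, (rowInsert x ys).2) := by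
  rw [rowInsert, if_neg (by omega)]

lemma rowInsert_ne_nil (x : ℕ) (p : List ℕ) : (rowInsert x p).1 ≠ [] := by
  cases p with
  | nil => simp [rowInsert]
  | cons y ys => rw [rowInsert]; split <;> simp

lemma mem_rowInsert {x z : ℕ} {p : List ℕ} (h : z ∈ (rowInsert x p).1) : z = x ∨ z ∈ p := by
  induction p with
  | nil => simpa [rowInsert] using h
  | cons y ys ih =>
    rcases lt_or_ge x y with hxy | hxy
    · rw [rowInsert_cons_of_lt hxy] at h
      simp only [List.mem_cons] at h ⊢; tauto
    · rw [rowInsert_cons_of_le hxy] at h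
      simp only [List.mem_cons] at h ⊢; tauto

/-- The minimality of the bumped letter among the entries above `x` is what later keeps the word of
bumped letters weakly increasing. -/
lemma rowInsert_bumped {x y : ℕ} {p : List ℕ} (hp : p.Pairwise (· ≤ ·))
    (h : (rowInsert x p).2 = some y) : x < y ∧ y ∈ p ∧ ∀ z ∈ p, x < z → y ≤ z := by
  induction p with
  | nil => simp [rowInsert] at h
  | cons a p ih =>
    rw [List.pairwise_cons] at hp
    rcases lt_or_ge x a with hxa | hxa
    · rw [rowInsert_cons_of_lt hxa] at h
      simp only [Option.some.injEq] at h
      subst h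
      refine ⟨hxa, by simp, fun z hz _ => ?_⟩
      rcases List.mem_cons.1 hz with rfl | hz
      · rfl
      · exact hp.1 z hz
    · rw [rowInsert_cons_of_le hxa] at h
      obtain ⟨h1, h2, h3⟩ := ih hp.2 h
      refine ⟨h1, List.mem_cons_of_mem _ h2, fun z hz hxz => ?_⟩
      rcases List.mem_cons.1 hz with rfl | hz
      · omega
      · exact h3 z hz hxz

lemma rowInsert_sorted (x : ℕ) {p : List ℕ} (hp : p.Pairwise (· ≤ ·)) :
    (rowInsert x p).1.Pairwise (· ≤ ·) := by
  induction p with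
  | nil => simp [rowInsert]
  | cons a p ih =>
    rw [List.pairwise_cons] at hp
    rcases lt_or_ge x a with hxa | hxa
    · rw [rowInsert_cons_of_lt hxa, List.pairwise_cons]
      exact ⟨fun z hz => hxa.le.trans (hp.1 z hz), hp.2⟩
    · rw [rowInsert_cons_of_le hxa, List.pairwise_cons]
      refine ⟨fun z hz => ?_, ih hp.2⟩
      rcases mem_rowInsert hz with rfl | hz
      · exact hxa
      · exact hp.1 z hz

/-- Only the first entry above `x` is lowered, to `x`. For `j ≥ x` the count grows by one unless
that entry was already `≤ j`, that is, unless `cnt p j` already exceeds `cnt p x`; the maximum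
encodes both cases, and also the case of appending. -/
lemma cnt_rowInsert (x : ℕ) {p : List ℕ} (hp : p.Pairwise (· ≤ ·)) (j : ℕ) :
    cnt (rowInsert x p).1 j = if j < x then cnt p j else max (cnt p x + 1) (cnt p j) := by
  induction p with
  | nil =>
    rw [rowInsert, cnt_cons]
    split_ifs <;> simp <;> omega
  | cons a p ih =>
    rw [List.pairwise_cons] at hp
    rcases lt_or_ge x a with hxa | hxa
    · rw [rowInsert_cons_of_lt hxa]
      have h0 : cnt p x = 0 := cnt_eq_zero fun z hz => hxa.trans_le (hp.1 z hz)
      have h1 : j < a → cnt p j = 0 := fun h => cnt_eq_zero fun z hz => h.trans_le (hp.1 z hz)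
      simp only [cnt_cons, h0]
      split_ifs <;> omega
    · rw [rowInsert_cons_of_le hxa]
      have := cnt_mono p (j := j) (k := x)
      simp only [cnt_cons, ih hp.2]
      split_ifs <;> omega

/-- Conservation of letters: the new row and the bumped letter together hold exactly the old row and
`x`. -/
lemma cnt_rowInsert_add (x : ℕ) (p : List ℕ) (j : ℕ) :
    cnt (rowInsert x p).1 j + cnt (rowInsert x p).2.toList j
      = cnt p j + if x ≤ j then 1 else 0 := by
  induction p with
  | nil => simp [rowInsert, cnt_cons]
  | cons a p ih =>
    rcases lt_or_ge x a with hxa | hxa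
    · rw [rowInsert_cons_of_lt hxa]
      simp only [Option.toList_some, cnt_cons, cnt_nil]
      omega
    · rw [rowInsert_cons_of_le hxa]
      simp only [cnt_cons]
      omega

/-- Insertion of a word into a row: the new row and the word of bumped letters. -/
def rowWord (p : List ℕ) : List ℕ → List ℕ × List ℕ
  | [] => (p, [])
  | x :: w =>
    ((rowWord (rowInsert x p).1 w).1,
      (rowInsert x p).2.toList ++ (rowWord (rowInsert x p).1 w).2)

lemma cnt_rowWord_add (p w : List ℕ) (j : ℕ) :
    cnt (rowWord p w).1 j + cnt (rowWord p w).2 j = cnt p j + cnt w j := by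
  induction w generalizing p with
  | nil => simp [rowWord]
  | cons x w ih =>
    have h1 := cnt_rowInsert_add x p j
    have h2 := ih (rowInsert x p).1
    simp only [rowWord, cnt_append, cnt_cons]
    omega

/-- Here `x` stands for the letter inserted just before and `y` for what it bumped. The row has no
entry strictly between them, and inserting `u ≥ x` preserves this with `u` in place of `x`, since
the only new entry is `u` itself. -/
lemma le_of_mem_bumped {x y : ℕ} {p w : List ℕ} (hp : p.Pairwise (· ≤ ·))
    (hw : (x :: w).Pairwise (· ≤ ·)) (hy : ∀ z ∈ p, x < z → y ≤ z) :
    ∀ d ∈ (rowWord p w).2, y ≤ d := by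
  induction w generalizing p x with
  | nil => simp [rowWord]
  | cons u w ih =>
    rw [List.pairwise_cons] at hw
    have hxu : x ≤ u := hw.1 u (by simp)
    intro d hd
    simp only [rowWord, List.mem_append, Option.mem_toList] at hd
    rcases hd with hd | hd
    · obtain ⟨h1, h2, -⟩ := rowInsert_bumped hp hd
      exact hy d h2 (by omega)
    · refine ih (rowInsert_sorted u hp) hw.2 (fun z hz huz => ?_) d hd
      rcases mem_rowInsert hz with rfl | hz
      · omega
      · exact hy z hz (by omega)

lemma bumped_sorted {p w : List ℕ} (hp : p.Pairwise (· ≤ ·)) (hw : w.Pairwise (· ≤ ·)) :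
    (rowWord p w).2.Pairwise (· ≤ ·) := by
  induction w generalizing p with
  | nil => simp [rowWord]
  | cons x w ih =>
    simp only [rowWord, List.pairwise_append]
    refine ⟨?_, ih (rowInsert_sorted x hp) (List.pairwise_cons.1 hw).2, fun y hy d hd => ?_⟩
    · cases (rowInsert x p).2 <;> simp
    · rw [Option.mem_toList] at hy
      refine le_of_mem_bumped (rowInsert_sorted x hp) hw (fun z hz hxz => ?_) d hd
      rcases mem_rowInsert hz with rfl | hz
      · omega
      · exact (rowInsert_bumped hp hy).2.2 z hz hxz

lemma cnt_rowWord_of_lt {p w : List ℕ} (hp : p.Pairwise (· ≤ ·)) {j : ℕ}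
    (h : ∀ x ∈ w, j < x) : cnt (rowWord p w).1 j = cnt p j := by
  induction w generalizing p with
  | nil => rfl
  | cons x w ih =>
    rw [rowWord, ih (rowInsert_sorted x hp) fun y hy => h y (by simp [hy]),
      cnt_rowInsert x hp, if_pos (h x (by simp))]

lemma le_cnt_rowWord {p : List ℕ} (hp : p.Pairwise (· ≤ ·)) (w : List ℕ) (j : ℕ) :
    cnt p j ≤ cnt (rowWord p w).1 j := by
  induction w generalizing p with
  | nil => rfl
  | cons x w ih =>
    refine le_trans ?_ (ih (rowInsert_sorted x hp))
    rw [cnt_rowInsert x hp]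
    split_ifs <;> omega

/-- The recursion for the counting function of a row after insertion of a weakly increasing
word. -/
lemma cnt_rowWord_succ {p w : List ℕ} (hp : p.Pairwise (· ≤ ·)) (hw : w.Pairwise (· ≤ ·))
    (k : ℕ) : cnt (rowWord p w).1 (k + 1) + cnt w k
      = max (cnt (rowWord p w).1 k) (cnt p (k + 1)) + cnt w (k + 1) := by
  induction w generalizing p with
  | nil =>
    have : cnt p k ≤ cnt p (k + 1) := cnt_mono p k.le_succ
    simp only [rowWord, cnt_nil]
    omega
  | cons x w ih =>
    have hp1 := rowInsert_sorted x hp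
    have hw' := List.pairwise_cons.1 hw
    have h1 := ih hp1 hw'.2
    have h2 := cnt_rowInsert x hp (k + 1)
    have h3 := cnt_rowInsert x hp k
    simp only [rowWord, cnt_cons]
    rcases lt_trichotomy (k + 1) x with hx | hx | hx
    · rw [if_pos (by omega)] at h2
      rw [if_neg (by omega), if_neg (by omega)]
      omega
    · rw [if_neg (by omega)] at h2
      rw [if_pos (by omega)] at h3
      -- When `x = k + 1` all remaining letters exceed `k`, so the count at `k` is frozen from here
      -- on.
      have h4 : cnt (rowWord (rowInsert x p).1 w).1 k = cnt (rowInsert x p).1 k :=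
        cnt_rowWord_of_lt hp1 fun y hy => by have := hw'.1 y hy; omega
      have : cnt p k ≤ cnt p (k + 1) := cnt_mono p k.le_succ
      rw [if_neg (by omega), if_pos (by omega)]
      subst hx
      omega
    · rw [if_neg (by omega)] at h2 h3
      have h4 := le_cnt_rowWord hp1 w k
      rw [if_pos (by omega), if_pos (by omega)]
      omega

end RSKJacobi

namespace RSKJacobi

/-! ### Insertion into tableaux -/

/-- Row insertion of a letter into a tableau, without recording. -/
def insertP : ℕ → List (List ℕ) → List (List ℕ)
  | x, [] => [[x]]
  | x, p :: T =>
    match rowInsert x p with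
    | (p', none) => p' :: T
    | (p', some y) => p' :: insertP y T

/-- The bumped letter, if any, is treated as a word of length at most one; this form iterates to
words. -/
lemma insertP_cons (x : ℕ) (p : List ℕ) (T : List (List ℕ)) :
    insertP x (p :: T) =
      (rowInsert x p).1 :: (rowInsert x p).2.toList.foldl (fun T x => insertP x T) T := by
  rw [insertP]
  rcases h : rowInsert x p with ⟨p', _ | y⟩ <;> simp

lemma map_fst_rskInsert (k x : ℕ) (T : List (List ℕ × List ℕ)) :
    (rskInsert k x T).map Prod.fst = insertP x (T.map Prod.fst) := by
  induction T generalizing x with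
  | nil => simp [rskInsert, insertP]
  | cons pq T ih =>
    obtain ⟨p, q⟩ := pq
    rw [rskInsert, List.map_cons, insertP]
    rcases h : rowInsert x p with ⟨p', _ | y⟩ <;> simp [ih]

lemma rowInsert_length (x : ℕ) (p : List ℕ) :
    (rowInsert x p).1.length = p.length + if (rowInsert x p).2 = none then 1 else 0 := by
  induction p with
  | nil => simp [rowInsert]
  | cons y ys ih =>
    rw [rowInsert]
    split
    · simp
    · simp only [List.length_cons, ih]; omega

/-- The new box is added to `P` and `Q` in the same row, so the shapes agree and the recording
tableau can be dropped from then on. -/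
lemma lengths_rskInsert (k x : ℕ) {T : List (List ℕ × List ℕ)}
    (hT : ∀ pq ∈ T, pq.1.length = pq.2.length) :
    ∀ pq ∈ rskInsert k x T, pq.1.length = pq.2.length := by
  induction T generalizing x with
  | nil => simp [rskInsert]
  | cons pq T ih =>
    obtain ⟨p, q⟩ := pq
    have h1 : p.length = q.length := hT (p, q) (by simp)
    have h2 : ∀ pq ∈ T, pq.1.length = pq.2.length := fun pq h => hT pq (by simp [h])
    have h3 := rowInsert_length x p
    rw [rskInsert]
    rcases h : rowInsert x p with ⟨p', _ | y⟩
    · intro pq hpq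
      rcases List.mem_cons.1 hpq with rfl | hpq
      · simp [h] at h3; simp [h3, h1]
      · exact h2 pq hpq
    · intro pq hpq
      rcases List.mem_cons.1 hpq with rfl | hpq
      · simp [h] at h3; simp [h3, h1]
      · exact ih y h2 pq hpq

/-- Row insertion of a word into a tableau. -/
def insertWord (T : List (List ℕ)) (w : List ℕ) : List (List ℕ) :=
  w.foldl (fun T x => insertP x T) T

lemma insertWord_append (T : List (List ℕ)) (w w' : List ℕ) :
    insertWord T (w ++ w') = insertWord (insertWord T w) w' := by
  simp [insertWord]

/-- The rows below the first only see the letters bumped from it, in the order of bumping, so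
inserting a word can be carried out one row of the tableau at a time instead of one letter at a
time. -/
lemma insertWord_cons (p : List ℕ) (T : List (List ℕ)) (w : List ℕ) :
    insertWord (p :: T) w = (rowWord p w).1 :: insertWord T (rowWord p w).2 := by
  induction w generalizing p T with
  | nil => rfl
  | cons x w ih =>
    have : insertWord (p :: T) (x :: w) = insertWord (insertP x (p :: T)) w := rfl
    rw [this, insertP_cons, ih, rowWord, insertWord_append]
    rfl

/-- The shape of the subtableau of the letters `≤ k`. -/
def levelShape (T : List (List ℕ)) (k r : ℕ) : ℕ := cnt (T.getD r []) k

@[simp] lemma levelShape_nil (k r : ℕ) : levelShape [] k r = 0 := by simp [levelShape]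

@[simp] lemma levelShape_cons_zero (p : List ℕ) (T : List (List ℕ)) (k : ℕ) :
    levelShape (p :: T) k 0 = cnt p k := by simp [levelShape]

@[simp] lemma levelShape_cons_succ (p : List ℕ) (T : List (List ℕ)) (k r : ℕ) :
    levelShape (p :: T) k (r + 1) = levelShape T k r := by simp [levelShape]

lemma levelShape_insertWord_nil (w : List ℕ) (k r : ℕ) :
    levelShape (insertWord [] w) k r = levelShape (insertWord [[]] w) k r := by
  cases w with
  | nil => cases r <;> simp [insertWord]
  | cons x w => rfl

/-- The local rule of the correspondence: the fourth partition around a cell. -/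
def localRule (α β γ : ℕ → ℕ) (c : ℕ) : ℕ → ℕ
  | 0 => max (β 0) (γ 0) + c
  | r + 1 => max (β (r + 1)) (γ (r + 1)) + (min (β r) (γ r) - α r)

/-- All rows are weakly increasing and all letters are positive. -/
def RowsGood (T : List (List ℕ)) : Prop :=
  ∀ p ∈ T, p.Pairwise (· ≤ ·) ∧ ∀ x ∈ p, 0 < x

lemma cnt_zero_of_pos {p : List ℕ} (h : ∀ x ∈ p, 0 < x) : cnt p 0 = 0 := cnt_eq_zero h

lemma rowsGood_insertP {x : ℕ} (hx : 0 < x) {T : List (List ℕ)} (hT : RowsGood T) :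
    RowsGood (insertP x T) := by
  induction T generalizing x with
  | nil => intro p hp; simp [insertP] at hp; subst hp; simp [hx]
  | cons p T ih =>
    have hp := hT p (by simp)
    have hT' : RowsGood T := fun q hq => hT q (by simp [hq])
    rw [insertP_cons]
    intro q hq
    rcases List.mem_cons.1 hq with rfl | hq
    · refine ⟨rowInsert_sorted x hp.1, fun z hz => ?_⟩
      rcases mem_rowInsert hz with rfl | hz
      · exact hx
      · exact hp.2 z hz
    · rcases h : (rowInsert x p).2 with _ | y
      · rw [h] at hq; exact hT' q hq
      · rw [h] at hq
        have := rowInsert_bumped hp.1 h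
        exact ih (hp.2 y this.2.1) hT' q hq

lemma rowsGood_insertWord {w : List ℕ} (hw : ∀ x ∈ w, 0 < x) {T : List (List ℕ)}
    (hT : RowsGood T) : RowsGood (insertWord T w) := by
  induction w generalizing T with
  | nil => exact hT
  | cons x w ih =>
    exact ih (fun y hy => hw y (by simp [hy])) (rowsGood_insertP (hw x (by simp)) hT)

lemma rowWord_pos {p w : List ℕ} (hp : p.Pairwise (· ≤ ·) ∧ ∀ x ∈ p, 0 < x)
    (hw : ∀ x ∈ w, 0 < x) :
    (∀ x ∈ (rowWord p w).1, 0 < x) ∧ ∀ x ∈ (rowWord p w).2, 0 < x := by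
  induction w generalizing p with
  | nil => simpa [rowWord] using hp.2
  | cons x w ih =>
    have hp1 : ∀ z ∈ (rowInsert x p).1, 0 < z := fun z hz => by
      rcases mem_rowInsert hz with rfl | hz
      · exact hw z (by simp)
      · exact hp.2 z hz
    obtain ⟨h1, h2⟩ := ih ⟨rowInsert_sorted x hp.1, hp1⟩ fun y hy => hw y (by simp [hy])
    refine ⟨h1, fun z hz => ?_⟩
    simp only [rowWord, List.mem_append, Option.mem_toList] at hz
    rcases hz with hz | hz
    · exact hp.2 z (rowInsert_bumped hp.1 hz).2.1
    · exact h2 z hz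

/-- Insertion of a weakly increasing word acts on the level shapes through the local rule. -/
theorem levelShape_insertWord_succ {T : List (List ℕ)} (hT : RowsGood T) {w : List ℕ}
    (hw : w.Pairwise (· ≤ ·)) (hpos : ∀ x ∈ w, 0 < x) (k r : ℕ) :
    levelShape (insertWord T w) (k + 1) r =
      localRule (levelShape T k) (levelShape T (k + 1)) (levelShape (insertWord T w) k)
        (cnt w (k + 1) - cnt w k) r := by
  -- Induction on the row index, with tableau and word both general: passing to the next row
  -- replaces the word by the word of bumped letters.
  have main : ∀ (r : ℕ) (p : List ℕ) (T : List (List ℕ)) (w : List ℕ), RowsGood (p :: T) →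
      w.Pairwise (· ≤ ·) → (∀ x ∈ w, 0 < x) →
      levelShape (insertWord (p :: T) w) (k + 1) r =
      localRule (levelShape (p :: T) k) (levelShape (p :: T) (k + 1))
        (levelShape (insertWord (p :: T) w) k) (cnt w (k + 1) - cnt w k) r := by
    clear hpos hw w hT T r
    intro r
    induction r with
    | zero =>
      intro p T w hT hw hpos
      have hp := hT p (by simp)
      have h1 := cnt_rowWord_succ hp.1 hw k
      have h2 : cnt w k ≤ cnt w (k + 1) := cnt_mono w k.le_succ
      simp only [insertWord_cons, localRule, levelShape_cons_zero]
      omega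
    | succ r ih =>
      intro p T w hT hw hpos
      have hp := hT p (by simp)
      have hd := bumped_sorted hp.1 hw
      have hdp := (rowWord_pos hp hpos).2
      -- If there is no further row, an empty one is added; this changes no level shape, before or
      -- after insertion.
      obtain ⟨q, T', hT', hq1, hq2⟩ : ∃ q T', RowsGood (q :: T') ∧
          (∀ k, levelShape T k = levelShape (q :: T') k) ∧
          (∀ k, levelShape (insertWord T (rowWord p w).2) k =
            levelShape (insertWord (q :: T') (rowWord p w).2) k) := by
        cases T with
        | nil =>
          refine ⟨[], [], by simp [RowsGood], fun k => ?_, fun k => ?_⟩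
          · funext r; cases r <;> simp
          · funext r; exact levelShape_insertWord_nil _ _ _
        | cons q T' =>
          exact ⟨q, T', fun s hs => hT s (by simp only [List.mem_cons] at hs ⊢; tauto),
            fun _ => rfl, fun _ => rfl⟩
      have h0 := ih q T' _ hT' hd hdp
      rw [← hq1, ← hq1, ← hq2, ← hq2] at h0
      rw [insertWord_cons]
      simp only [localRule, levelShape_cons_succ]
      rw [h0]
      cases r with
      | succ r => simp only [localRule, levelShape_cons_succ]
      | zero =>
        simp only [localRule, levelShape_cons_zero]
        -- By conservation of letters and the recursion for the first row, the multiplicity of `k +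
        -- 1` among the bumped letters is `min (β 0) (γ 0) - α 0`. This is the entry that the local
        -- rule feeds into the next row.
        have h1 := cnt_rowWord_succ hp.1 hw k
        have h2 := cnt_rowWord_add p w k
        have h3 := cnt_rowWord_add p w (k + 1)
        omega
  cases T with
  | cons p T => exact main r p T w hT hw hpos
  | nil =>
    have := main r [] [] w (by simp [RowsGood]) hw hpos
    have e : ∀ k, levelShape [[]] k = levelShape [] k := fun k => by
      funext r; cases r <;> simp
    have e' : ∀ k, levelShape (insertWord [[]] w) k = levelShape (insertWord [] w) k :=
      fun k => by funext r; exact (levelShape_insertWord_nil _ _ _).symm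
    rwa [e, e, e', e'] at this

end RSKJacobi

namespace RSKJacobi

/-! ### Tuples, words and growth -/

/-- Tuples of length `n`, stored with the last entry first. -/
def Tup (X : Type) : ℕ → Type
  | 0 => Unit
  | n + 1 => X × Tup X n

/-- The tuple of the values of a function on `Fin n`. -/
def Tup.ofFin {X : Type} : (n : ℕ) → (Fin n → X) ≃ Tup X n
  | 0 => Equiv.ofUnique _ Unit
  | n + 1 => (Fin.snocEquiv fun _ => X).symm.trans
      ((Equiv.refl X).prodCongr (Tup.ofFin n))

lemma Tup.ofFin_succ {X : Type} (n : ℕ) (f : Fin (n + 1) → X) :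
    Tup.ofFin (n + 1) f = (f (Fin.last n), Tup.ofFin n fun i => f i.castSucc) := rfl

/-- The last partition of a sequence of partitions that starts from the empty one. -/
def top : (n : ℕ) → Tup (ℕ → ℕ) n → ℕ → ℕ
  | 0, _ => fun _ => 0
  | _ + 1, δ => δ.1

/-- The effect of a row of the matrix on the sequence of level shapes. -/
def step : (n : ℕ) → Tup ℕ n → Tup (ℕ → ℕ) n → Tup (ℕ → ℕ) n
  | 0, _, _ => ()
  | n + 1, c, β => (localRule (top n β.2) β.1 (top n (step n c.2 β.2)) c.1, step n c.2 β.2)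

/-- The sequence of empty partitions. -/
def zeroTup : (n : ℕ) → Tup (ℕ → ℕ) n
  | 0 => ()
  | n + 1 => (fun _ => 0, zeroTup n)

/-- The sequence of level shapes that a matrix gives. -/
def growth (n : ℕ) : (m : ℕ) → Tup (Tup ℕ n) m → Tup (ℕ → ℕ) n
  | 0, _ => zeroTup n
  | m + 1, A => step n A.1 (growth n m A.2)

/-- The weakly increasing word with given multiplicities. -/
def word : (n : ℕ) → Tup ℕ n → List ℕ
  | 0, _ => []
  | n + 1, c => word n c.2 ++ List.replicate c.1 (n + 1)

/-- The sequence of level shapes of a tableau. -/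
def levels (T : List (List ℕ)) : (n : ℕ) → Tup (ℕ → ℕ) n
  | 0 => ()
  | n + 1 => (levelShape T (n + 1), levels T n)

lemma mem_word {n : ℕ} {c : Tup ℕ n} {x : ℕ} (h : x ∈ word n c) : 0 < x ∧ x ≤ n := by
  induction n with
  | zero => simp [word] at h
  | succ n ih =>
    simp only [word, List.mem_append, List.mem_replicate] at h
    rcases h with h | h
    · have := ih h; omega
    · omega

lemma word_sorted (n : ℕ) (c : Tup ℕ n) : (word n c).Pairwise (· ≤ ·) := by
  induction n with
  | zero => simp [word]
  | succ n ih =>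
    simp only [word, List.pairwise_append]
    refine ⟨ih _, List.pairwise_replicate.2 (Or.inr le_rfl), fun x hx y hy => ?_⟩
    have := mem_word hx
    have := List.eq_of_mem_replicate hy
    omega

lemma cnt_replicate (m x k : ℕ) : cnt (List.replicate m x) k = if x ≤ k then m else 0 := by
  simp [cnt, List.countP_replicate]

lemma levelShape_zero {T : List (List ℕ)} (hT : RowsGood T) (r : ℕ) : levelShape T 0 r = 0 := by
  refine cnt_zero_of_pos fun x hx => ?_
  rw [List.getD_eq_getElem?_getD] at hx
  rcases h : T[r]? with _ | p
  · rw [h] at hx; simp at hx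
  · rw [h] at hx
    exact (hT p (List.mem_of_getElem? h)).2 x hx

/-- For `n = 0` the convention that a chain starts at the empty partition is correct because all
letters are positive. -/
lemma top_levels {T : List (List ℕ)} (hT : RowsGood T) (n : ℕ) :
    top n (levels T n) = levelShape T n := by
  cases n with
  | zero => funext r; exact (levelShape_zero hT r).symm
  | succ n => rfl

/-- Only the counts of letters `≤ n` are compared, so the induction on `n` can keep the whole word
`w`, which contains larger letters as well. -/
lemma levels_insertWord_aux {T : List (List ℕ)} (hT : RowsGood T) {w : List ℕ}
    (hw : w.Pairwise (· ≤ ·)) (hpos : ∀ x ∈ w, 0 < x) (n : ℕ) (c : Tup ℕ n)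
    (hc : ∀ k ≤ n, cnt w k = cnt (word n c) k) :
    levels (insertWord T w) n = step n c (levels T n) := by
  induction n with
  | zero => rfl
  | succ n ih =>
    have h1 : ∀ k ≤ n, cnt w k = cnt (word n c.2) k := fun k hk => by
      rw [hc k (by omega), word, cnt_append, cnt_replicate, if_neg (by omega)]; rfl
    have h2 := ih c.2 h1
    have h3 : cnt w (n + 1) - cnt w n = c.1 := by
      rw [hc _ le_rfl, h1 _ le_rfl, word, cnt_append, cnt_replicate, if_pos le_rfl,
        cnt_eq_length fun x hx => (mem_word hx).2,
        cnt_eq_length fun x hx => (mem_word hx).2.trans n.le_succ]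
      omega
    have hT' := rowsGood_insertWord hpos hT
    simp only [levels, step]
    rw [← h2, top_levels hT, top_levels hT']
    refine Prod.ext (funext fun r => ?_) rfl
    show levelShape (insertWord T w) (n + 1) r = localRule _ _ _ _ r
    rw [levelShape_insertWord_succ hT hw hpos, h3]

lemma levels_insertWord {T : List (List ℕ)} (hT : RowsGood T) (n : ℕ) (c : Tup ℕ n) :
    levels (insertWord T (word n c)) n = step n c (levels T n) :=
  levels_insertWord_aux hT (word_sorted n c) (fun _ hx => (mem_word hx).1) n c fun _ _ => rfl

/-- The tableau that the rows of a matrix give. -/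
def tableau (n : ℕ) : (m : ℕ) → Tup (Tup ℕ n) m → List (List ℕ)
  | 0, _ => []
  | m + 1, A => insertWord (tableau n m A.2) (word n A.1)

lemma rowsGood_tableau (n m : ℕ) (A : Tup (Tup ℕ n) m) : RowsGood (tableau n m A) := by
  induction m with
  | zero => intro p hp; simp [tableau] at hp
  | succ m ih => exact rowsGood_insertWord (fun _ hx => (mem_word hx).1) (ih _)

lemma levels_nil (n : ℕ) : levels [] n = zeroTup n := by
  induction n with
  | zero => rfl
  | succ n ih =>
    rw [levels, zeroTup, ih]
    exact Prod.ext (funext fun r => levelShape_nil (n + 1) r) rfl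

lemma levels_tableau (n m : ℕ) (A : Tup (Tup ℕ n) m) :
    levels (tableau n m A) n = growth n m A := by
  induction m with
  | zero => exact levels_nil n
  | succ m ih => rw [tableau, levels_insertWord (rowsGood_tableau _ _ _), ih]; rfl

/-- All rows are non-empty with letters at most `n`. -/
def RowsBdd (n : ℕ) (T : List (List ℕ)) : Prop := ∀ p ∈ T, p ≠ [] ∧ ∀ x ∈ p, x ≤ n

lemma rowsBdd_insertP {n x : ℕ} (hx : x ≤ n) {T : List (List ℕ)} (hG : RowsGood T)
    (hT : RowsBdd n T) : RowsBdd n (insertP x T) := by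
  induction T generalizing x with
  | nil => intro p hp; simp [insertP] at hp; subst hp; simp [hx]
  | cons p T ih =>
    have hp := hT p (by simp)
    have hT' : RowsBdd n T := fun q hq => hT q (by simp [hq])
    rw [insertP_cons]
    intro q hq
    rcases List.mem_cons.1 hq with rfl | hq
    · refine ⟨rowInsert_ne_nil x p, fun z hz => ?_⟩
      rcases mem_rowInsert hz with rfl | hz
      · exact hx
      · exact hp.2 z hz
    · rcases h : (rowInsert x p).2 with _ | y
      · rw [h] at hq; exact hT' q hq
      · rw [h] at hq
        have := rowInsert_bumped (hG p (by simp)).1 h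
        exact ih (hp.2 y this.2.1) (fun q hq => hG q (by simp [hq])) hT' q hq

lemma rowsBdd_insertWord {n : ℕ} {w : List ℕ} (hpos : ∀ x ∈ w, 0 < x) (hw : ∀ x ∈ w, x ≤ n)
    {T : List (List ℕ)} (hG : RowsGood T) (hT : RowsBdd n T) : RowsBdd n (insertWord T w) := by
  induction w generalizing T with
  | nil => exact hT
  | cons x w ih =>
    exact ih (fun y hy => hpos y (by simp [hy])) (fun y hy => hw y (by simp [hy]))
      (rowsGood_insertP (hpos x (by simp)) hG) (rowsBdd_insertP (hw x (by simp)) hG hT)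

lemma rowsBdd_tableau (n m : ℕ) (A : Tup (Tup ℕ n) m) : RowsBdd n (tableau n m A) := by
  induction m with
  | zero => intro p hp; simp [tableau] at hp
  | succ m ih =>
    exact rowsBdd_insertWord (fun _ hx => (mem_word hx).1) (fun _ hx => (mem_word hx).2)
      (rowsGood_tableau _ _ _) (ih _)

/-- A matrix as a tuple of tuples. -/
def ofMatrix {m n : ℕ} (A : Matrix (Fin m) (Fin n) ℕ) : Tup (Tup ℕ n) m :=
  Tup.ofFin m fun i => Tup.ofFin n (A i)

lemma flatMap_replicate_eq_word {n : ℕ} (c : Fin n → ℕ) :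
    ((List.finRange n).flatMap fun j => List.replicate (c j) ((j : ℕ) + 1))
      = word n (Tup.ofFin n c) := by
  induction n with
  | zero => rfl
  | succ n ih =>
    have h : word (n + 1) (Tup.ofFin (n + 1) c)
        = word n (Tup.ofFin n fun i => c i.castSucc)
          ++ List.replicate (c (Fin.last n)) (n + 1) := rfl
    rw [List.finRange_succ_last, List.flatMap_append, h, ← ih]
    simp [List.flatMap_map]

lemma foldl_rskInsert (l : List (ℕ × ℕ)) (T : List (List ℕ × List ℕ)) :
    (l.foldl (fun T w => rskInsert w.1 w.2 T) T).map Prod.fst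
      = insertWord (T.map Prod.fst) (l.map Prod.snd) := by
  induction l generalizing T with
  | nil => rfl
  | cons w l ih => simp only [List.foldl_cons, ih, map_fst_rskInsert]; rfl

lemma lengths_foldl_rskInsert (l : List (ℕ × ℕ)) {T : List (List ℕ × List ℕ)}
    (hT : ∀ pq ∈ T, pq.1.length = pq.2.length) :
    ∀ pq ∈ l.foldl (fun T w => rskInsert w.1 w.2 T) T, pq.1.length = pq.2.length := by
  induction l generalizing T with
  | nil => exact hT
  | cons w l ih => exact ih (lengths_rskInsert _ _ hT)

/-- In lexicographic order the biword lists the rows of the matrix one after another, and the column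
labels within a row form a weakly increasing word. -/
lemma insertWord_biword {m n : ℕ} (A : Matrix (Fin m) (Fin n) ℕ) :
    insertWord [] ((biword A).map Prod.snd) = tableau n m (ofMatrix A) := by
  have h : (biword A).map Prod.snd
      = (List.finRange m).flatMap fun i => word n (Tup.ofFin n (A i)) := by
    unfold biword
    rw [List.map_flatMap]
    congr 1
    funext i
    rw [← flatMap_replicate_eq_word, List.map_flatMap]
    simp
  rw [h]
  clear h
  induction m with
  | zero => rfl
  | succ m ih =>
    rw [List.finRange_succ_last, List.flatMap_append, insertWord_append, List.flatMap_map,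
      ih fun i => A i.castSucc]
    simp [ofMatrix, Tup.ofFin_succ, tableau]

/-- `rowLens` lists only the positive row lengths; the absence of empty rows in `T` makes the two
lists end at the same place. -/
lemma map_length_eq_rowLens_iff {T : List (List ℕ)} (hT : ∀ p ∈ T, p ≠ []) (μ : YoungDiagram) :
    T.map List.length = μ.rowLens ↔ ∀ r, (T.getD r []).length = μ.rowLen r := by
  have h0 : ∀ r, μ.rowLens.getD r 0 = μ.rowLen r := fun r => by
    rw [List.getD_eq_getElem?_getD]
    rcases lt_or_ge r μ.rowLens.length with h | h
    · rw [List.getElem?_eq_getElem h]; simp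
    · rw [List.getElem?_eq_none h]
      rw [YoungDiagram.length_rowLens] at h
      symm
      by_contra hne
      have : (r, 0) ∈ μ := YoungDiagram.mem_iff_lt_rowLen.2 (Nat.pos_of_ne_zero hne)
      rw [YoungDiagram.mem_iff_lt_colLen] at this
      omega
  have h1 : ∀ r, (T.map List.length).getD r 0 = (T.getD r []).length := fun r => by
    simp only [List.getD_eq_getElem?_getD, List.getElem?_map]
    rcases T[r]? with _ | p <;> simp
  constructor
  · intro h r
    rw [← h0, ← h1, h]
  · intro h
    have h2 : ∀ r, (T.map List.length).getD r 0 = μ.rowLens.getD r 0 := fun r => by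
      rw [h0, h1, h]
    have hpos : ∀ x ∈ T.map List.length, 0 < x := by
      intro x hx
      obtain ⟨p, hp, rfl⟩ := List.mem_map.1 hx
      exact List.length_pos_iff.2 (hT p hp)
    have hpos' : ∀ x ∈ μ.rowLens, 0 < x := fun x hx => YoungDiagram.pos_of_mem_rowLens μ x hx
    generalize T.map List.length = l at h2 hpos
    generalize μ.rowLens = l' at h2 hpos'
    apply List.ext_getElem?
    intro r
    have := h2 r
    simp only [List.getD_eq_getElem?_getD] at this
    rcases hl : l[r]? with _ | x <;> rcases hl' : l'[r]? with _ | y <;> rw [hl, hl'] at this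
    · have := hpos' y (List.mem_of_getElem? hl'); simp at *; omega
    · have := hpos x (List.mem_of_getElem? hl); simp at *; omega
    · simpa using this

/-- The shape that the correspondence gives is read off from the growth. -/
theorem givesShape_iff {m n : ℕ} (A : Matrix (Fin m) (Fin n) ℕ) (μ : YoungDiagram) :
    GivesShape A μ ↔ top n (growth n m (ofMatrix A)) = μ.rowLen := by
  have h1 : (rsk A).1 = tableau n m (ofMatrix A) := by
    rw [← insertWord_biword]; exact foldl_rskInsert _ _
  have h2 : (rsk A).2.map List.length = (rsk A).1.map List.length := by
    simp only [rsk, List.map_map]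
    apply List.map_congr_left
    intro pq hpq
    exact (lengths_foldl_rskInsert (biword A) (by simp) pq hpq).symm
  have hB := rowsBdd_tableau n m (ofMatrix A)
  rw [GivesShape, h2, and_self, h1, map_length_eq_rowLens_iff (fun p hp => (hB p hp).1),
    ← levels_tableau, top_levels (rowsGood_tableau _ _ _), funext_iff]
  refine forall_congr' fun r => ?_
  rw [levelShape, cnt_eq_length]
  intro x hx
  rw [List.getD_eq_getElem?_getD] at hx
  rcases h : (tableau n m (ofMatrix A))[r]? with _ | p
  · rw [h] at hx; simp at hx
  · rw [h] at hx
    exact (hB p (List.mem_of_getElem? h)).2 x hx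

/-- The growth of the submatrix of the first columns. -/
lemma growth_tail {m n : ℕ} (A : Matrix (Fin m) (Fin (n + 1)) ℕ) :
    (growth (n + 1) m (ofMatrix A)).2
      = growth n m (ofMatrix (Matrix.of fun i j => A i j.castSucc)) := by
  induction m with
  | zero => rfl
  | succ m ih =>
    exact congrArg (step n (Tup.ofFin n fun j => A (Fin.last m) j.castSucc))
      (ih fun i => A i.castSucc)

end RSKJacobi

namespace RSKJacobi

/-! ### Weighted enumeration of matrices by growth -/

open scoped ENNReal Classical

/-- The skew diagram `β / α` is a horizontal strip. -/
def Inter (α β : ℕ → ℕ) : Prop := ∀ i, β (i + 1) ≤ α i ∧ α i ≤ β i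

/-- The number of boxes of `β / α` in the first `N` rows. -/
def skewSize (N : ℕ) (β α : ℕ → ℕ) : ℕ := ∑ r ∈ Finset.range N, (β r - α r)

/-- The weight of a sequence of partitions in which consecutive ones interlace. -/
noncomputable def chainWt (N : ℕ) (b : ℕ → ℝ≥0∞) : (n : ℕ) → Tup (ℕ → ℕ) n → ℝ≥0∞
  | 0, _ => 1
  | n + 1, δ =>
    (if Inter (top n δ.2) δ.1 then b n ^ skewSize N δ.1 (top n δ.2) else 0) * chainWt N b n δ.2

/-- The weight of a row of a matrix. -/
noncomputable def rowWt (a : ℝ≥0∞) (b : ℕ → ℝ≥0∞) : (n : ℕ) → Tup ℕ n → ℝ≥0∞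
  | 0, _ => 1
  | n + 1, c => (a * b n) ^ c.1 * rowWt a b n c.2

/-- The weight of a matrix. -/
noncomputable def matWt (a b : ℕ → ℝ≥0∞) (n : ℕ) : (m : ℕ) → Tup (Tup ℕ n) m → ℝ≥0∞
  | 0, _ => 1
  | m + 1, A => rowWt (a m) b n A.1 * matWt a b n m A.2

/-- The Schur function of the partition `μ` in `m` variables, through the branching rule. -/
noncomputable def schur (N : ℕ) (a : ℕ → ℝ≥0∞) : ℕ → (ℕ → ℕ) → ℝ≥0∞
  | 0, μ => if μ = 0 then 1 else 0
  | m + 1, μ => ∑' l, if Inter l μ then a m ^ skewSize N μ l * schur N a m l else 0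

/-- The empty tuple. -/
def Tup.nil {X : Type} : Tup X 0 := ()

/-- The tuple with a new last entry. -/
def Tup.cons {X : Type} {n : ℕ} (x : X) (c : Tup X n) : Tup X (n + 1) := (x, c)

lemma Tup.exists_cons {X : Type} {n : ℕ} (c : Tup X (n + 1)) : ∃ x c', c = Tup.cons x c' :=
  ⟨c.1, c.2, rfl⟩

/-- The tuple without its last entry. -/
def Tup.tail {X : Type} {n : ℕ} (c : Tup X (n + 1)) : Tup X n := c.2

lemma Tup.tail_cons {X : Type} {n : ℕ} (x : X) (c : Tup X n) : (Tup.cons x c).tail = c := rfl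

lemma Tup.cons_inj {X : Type} {n : ℕ} {x y : X} {c d : Tup X n} :
    Tup.cons x c = Tup.cons y d ↔ x = y ∧ c = d := Prod.ext_iff

lemma step_cons {n : ℕ} (x : ℕ) (c : Tup ℕ n) (β₁ : ℕ → ℕ) (β : Tup (ℕ → ℕ) n) :
    step (n + 1) (Tup.cons x c) (Tup.cons β₁ β)
      = Tup.cons (localRule (top n β) β₁ (top n (step n c β)) x) (step n c β) := rfl

lemma top_cons {n : ℕ} (δ₁ : ℕ → ℕ) (δ : Tup (ℕ → ℕ) n) : top (n + 1) (Tup.cons δ₁ δ) = δ₁ := rfl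

lemma top_nil (δ : Tup (ℕ → ℕ) 0) : top 0 δ = fun _ => 0 := rfl

lemma zeroTup_succ (n : ℕ) : zeroTup (n + 1) = Tup.cons (fun _ => 0) (zeroTup n) := rfl

lemma top_zeroTup (n : ℕ) : top n (zeroTup n) = fun _ => 0 := by cases n <;> rfl

lemma chainWt_cons (N : ℕ) (b : ℕ → ℝ≥0∞) {n : ℕ} (δ₁ : ℕ → ℕ) (δ : Tup (ℕ → ℕ) n) :
    chainWt N b (n + 1) (Tup.cons δ₁ δ)
      = (if Inter (top n δ) δ₁ then b n ^ skewSize N δ₁ (top n δ) else 0) * chainWt N b n δ :=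
  rfl

lemma rowWt_cons (a : ℝ≥0∞) (b : ℕ → ℝ≥0∞) {n : ℕ} (x : ℕ) (c : Tup ℕ n) :
    rowWt a b (n + 1) (Tup.cons x c) = (a * b n) ^ x * rowWt a b n c := rfl

lemma matWt_cons (a b : ℕ → ℝ≥0∞) {n m : ℕ} (c : Tup ℕ n) (A : Tup (Tup ℕ n) m) :
    matWt a b n (m + 1) (Tup.cons c A) = rowWt (a m) b n c * matWt a b n m A := rfl

lemma tsum_tup_succ {X : Type} (n : ℕ) (f : Tup X (n + 1) → ℝ≥0∞) :
    ∑' c, f c = ∑' (x : X) (c : Tup X n), f (Tup.cons x c) :=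
  ENNReal.tsum_prod (f := fun x c => f (Tup.cons x c))

lemma tsum_tup_zero {X : Type} (f : Tup X 0 → ℝ≥0∞) : ∑' c, f c = f Tup.nil :=
  tsum_eq_single Tup.nil fun _ hb => absurd rfl hb

lemma tsum_fiber {X Y : Type} (g : X → Y) (f : X → Y → ℝ≥0∞) :
    ∑' x, f x (g x) = ∑' y, ∑' x, if g x = y then f x y else 0 := by
  rw [ENNReal.tsum_comm]
  refine tsum_congr fun x => ?_
  rw [tsum_eq_single (g x)]
  · simp
  · intro y hy
    rw [if_neg (Ne.symm hy)]

/-- The inverse of the local rule. -/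
def localRuleInv (β γ δ : ℕ → ℕ) (r : ℕ) : ℕ :=
  max (β (r + 1)) (γ (r + 1)) + min (β r) (γ r) - δ (r + 1)

/-- For fixed `β`, `γ`, `δ` the local rule is a bijection: each part of `δ` after the first gives
back one part of `α`, the first part gives `c`, and the strips below `β` and `γ` correspond to the
strips above them. -/
lemma localRule_iff {α β γ δ : ℕ → ℕ} {c : ℕ} :
    (localRule α β γ c = δ ∧ Inter α β ∧ Inter α γ) ↔
      (Inter β δ ∧ Inter γ δ) ∧ α = localRuleInv β γ δ ∧ c = δ 0 - max (β 0) (γ 0) := by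
  constructor
  · rintro ⟨rfl, h1, h2⟩
    refine ⟨⟨fun i => ?_, fun i => ?_⟩, funext fun r => ?_, ?_⟩
    · have := h1 i; have := h2 i
      refine ⟨?_, ?_⟩
      · simp only [localRule]; omega
      · cases i <;> simp only [localRule] <;> omega
    · have := h1 i; have := h2 i
      refine ⟨?_, ?_⟩
      · simp only [localRule]; omega
      · cases i <;> simp only [localRule] <;> omega
    · have := h1 r; have := h2 r
      simp only [localRuleInv, localRule]; omega
    · simp only [localRule]; omega
  · rintro ⟨⟨h1, h2⟩, rfl, rfl⟩
    refine ⟨funext fun r => ?_, fun i => ?_, fun i => ?_⟩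
    · cases r with
      | zero => have := h1 0; have := h2 0; simp only [localRule]; omega
      | succ r =>
        have := h1 r; have := h2 r; have := h1 (r + 1); have := h2 (r + 1)
        simp only [localRule, localRuleInv]; omega
    · have := h1 i; have := h2 i; have := h1 (i + 1); have := h2 (i + 1)
      simp only [localRuleInv]; omega
    · have := h1 i; have := h2 i; have := h1 (i + 1); have := h2 (i + 1)
      simp only [localRuleInv]; omega

/-- In total size this is `|δ| - |γ| = c + |β| - |α|`. Truncating the sum after row `M` leaves the
boundary term `min (β M) (γ M) - α M`, which vanishes in row `N` since `γ N = 0`. -/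
lemma skewSize_localRule {α β γ : ℕ → ℕ} (c N : ℕ) (h1 : Inter α β) (h2 : Inter α γ)
    (hγ : γ N = 0) :
    skewSize (N + 1) (localRule α β γ c) γ = c + skewSize (N + 1) β α := by
  have key : ∀ M, skewSize (M + 1) (localRule α β γ c) γ + (min (β M) (γ M) - α M)
      = c + skewSize (M + 1) β α := by
    intro M
    induction M with
    | zero =>
      have := h1 0; have := h2 0
      simp only [skewSize, Finset.sum_range_one, zero_add, localRule]; omega
    | succ M ih =>
      have := h1 M; have := h2 M; have := h1 (M + 1); have := h2 (M + 1)
      unfold skewSize at ih ⊢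
      rw [Finset.sum_range_succ, Finset.sum_range_succ _ (M + 1)]
      simp only [localRule] at ih ⊢
      omega
  have := key N
  have := h2 N
  omega

lemma localRule_comm (α β γ : ℕ → ℕ) (c : ℕ) : localRule α β γ c = localRule α γ β c := by
  funext r
  cases r <;> simp only [localRule, max_comm, min_comm]

/-- The sum over the preimages of a partition under the local rule. -/
lemma tsum_localRule {β γ δ : ℕ → ℕ} {N : ℕ} (a b : ℝ≥0∞) (hγ : γ N = 0) :
    (∑' (c : ℕ) (α : ℕ → ℕ), if localRule α β γ c = δ ∧ Inter α β ∧ Inter α γ then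
        (a * b) ^ c * b ^ skewSize (N + 1) β α * a ^ skewSize (N + 1) γ α else 0)
      = if Inter β δ ∧ Inter γ δ then
          b ^ skewSize (N + 1) δ γ * a ^ skewSize (N + 1) δ β else 0 := by
  by_cases h : Inter β δ ∧ Inter γ δ
  · rw [if_pos h, tsum_eq_single (δ 0 - max (β 0) (γ 0)), tsum_eq_single (localRuleInv β γ δ)]
    · have h' := localRule_iff.2 ⟨h, rfl, rfl⟩
      rw [if_pos h']
      obtain ⟨e, h1, h2⟩ := h'
      by_cases hβ : β N = 0
      · have e1 := skewSize_localRule (δ 0 - max (β 0) (γ 0)) N h1 h2 hγ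
        have e2 := skewSize_localRule (δ 0 - max (β 0) (γ 0)) N h2 h1 hβ
        rw [localRule_comm, e] at e2
        rw [e] at e1
        rw [e1, e2]
        ring
      -- Without `β N = 0` the symmetric count is not available; instead, the two routes from `α` to
      -- `δ`, through `β` and through `γ`, add the same number of boxes in every row.
      · have e1 := skewSize_localRule (δ 0 - max (β 0) (γ 0)) N h1 h2 hγ
        have e3 : skewSize (N + 1) δ β + skewSize (N + 1) β (localRuleInv β γ δ)
            = skewSize (N + 1) δ γ + skewSize (N + 1) γ (localRuleInv β γ δ) := by
          unfold skewSize
          rw [← Finset.sum_add_distrib, ← Finset.sum_add_distrib]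
          refine Finset.sum_congr rfl fun r _ => ?_
          have := h1 r; have := h2 r; have := h.1 r; have := h.2 r
          omega
        rw [e] at e1
        have e2 : skewSize (N + 1) δ β = δ 0 - max (β 0) (γ 0)
            + skewSize (N + 1) γ (localRuleInv β γ δ) := by omega
        rw [e1, e2]
        ring
    · intro α hα
      rw [if_neg]
      exact fun h' => hα (localRule_iff.1 h').2.1
    · intro c hc
      rw [ENNReal.tsum_eq_zero]
      intro α
      rw [if_neg]
      exact fun h' => hc (localRule_iff.1 h').2.2
  · rw [if_neg h]
    simp only [ENNReal.tsum_eq_zero]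
    intro c α
    rw [if_neg]
    exact fun h' => h (localRule_iff.1 h').1

/-- A horizontal strip adds at most one new row, so a chain of length `n` ends in a partition with
at most `n` parts. -/
lemma top_eq_zero_of_chainWt_ne_zero {N : ℕ} {b : ℕ → ℝ≥0∞} {n : ℕ} {δ : Tup (ℕ → ℕ) n}
    (h : chainWt N b n δ ≠ 0) {r : ℕ} (hr : n ≤ r) : top n δ r = 0 := by
  induction n generalizing r with
  | zero => rfl
  | succ n ih =>
    obtain ⟨δ₁, δ', rfl⟩ := δ.exists_cons
    rw [chainWt_cons] at h
    have h1 := left_ne_zero_of_mul h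
    have h2 := ih (right_ne_zero_of_mul h) (r := r - 1) (by omega)
    have h3 : Inter (top n δ') δ₁ := by
      by_contra h'; exact h1 (if_neg h')
    have h4 := (h3 (r - 1)).1
    rw [Nat.sub_add_cancel (by omega)] at h4
    rw [top_cons]
    omega

lemma inter_zero_iff {α : ℕ → ℕ} : Inter α (fun _ => 0) ↔ α = fun _ => 0 := by
  constructor
  · intro h; funext r; exact Nat.le_zero.1 (h r).2
  · rintro rfl; intro r; simp

lemma skewSize_self (N : ℕ) (α : ℕ → ℕ) : skewSize N α α = 0 := by simp [skewSize]

/-- Adding a row to the matrix commutes with weighting chains: it preserves the chain weight and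
acts on functions of the top partition by one branching step in the row variable `a`. The induction
is over columns. `F` is arbitrary because the last column is absorbed into it, and the bound on `n`
ensures that `N + 1` rows see all boxes. -/
lemma tsum_step (N : ℕ) (a : ℝ≥0∞) (b : ℕ → ℝ≥0∞) (n : ℕ) (hn : n ≤ N + 1)
    (F : (ℕ → ℕ) → ℝ≥0∞) (δ : Tup (ℕ → ℕ) n) :
    (∑' (c : Tup ℕ n) (β : Tup (ℕ → ℕ) n),
        if step n c β = δ then rowWt a b n c * (chainWt (N + 1) b n β * F (top n β)) else 0)
      = chainWt (N + 1) b n δ * ∑' l, if Inter l (top n δ) then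
          a ^ skewSize (N + 1) (top n δ) l * F l else 0 := by
  induction n generalizing F with
  | zero =>
    simp only [tsum_tup_zero]
    rw [if_pos (show step 0 Tup.nil Tup.nil = δ from rfl), tsum_eq_single fun _ => 0]
    · rw [if_pos (show Inter (fun _ => 0) (top 0 δ) from inter_zero_iff.2 rfl)]
      simp [rowWt, chainWt, top_nil, skewSize]
    · intro l hl
      rw [if_neg]
      exact fun h => hl (inter_zero_iff.1 h)
  | succ n ih =>
    obtain ⟨δ₁, δ', rfl⟩ := δ.exists_cons
    -- For fixed last entry `c` and last partition `β`, the condition and the weight at the last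
    -- cell depend on the other partitions only through `top n β'`, once `step n c' β' = δ'` is
    -- imposed.
    have hL : (∑' (c : Tup ℕ (n + 1)) (β : Tup (ℕ → ℕ) (n + 1)),
        if step (n + 1) c β = Tup.cons δ₁ δ' then
          rowWt a b (n + 1) c * (chainWt (N + 1) b (n + 1) β * F (top (n + 1) β)) else 0)
        = ∑' (c : ℕ) (β : ℕ → ℕ) (c' : Tup ℕ n) (β' : Tup (ℕ → ℕ) n),
          if step n c' β' = δ' then rowWt a b n c' * (chainWt (N + 1) b n β' *
            (fun α => if localRule α β (top n δ') c = δ₁ ∧ Inter α β then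
              (a * b n) ^ c * b n ^ skewSize (N + 1) β α * F β else 0) (top n β')) else 0 := by
      rw [tsum_tup_succ]
      refine tsum_congr fun c => ?_
      rw [ENNReal.tsum_comm, tsum_tup_succ]
      refine tsum_congr fun β => ?_
      rw [ENNReal.tsum_comm]
      refine tsum_congr fun c' => tsum_congr fun β' => ?_
      rw [step_cons, rowWt_cons, chainWt_cons, top_cons, Tup.cons_inj]
      by_cases h1 : step n c' β' = δ'
      · rw [if_pos h1, h1]
        by_cases h2 : localRule (top n β') β (top n δ') c = δ₁ <;>
          by_cases h3 : Inter (top n β') β <;> simp [h2, h3]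
        ring
      · simp [h1]
    rw [hL]
    refine (tsum_congr fun c => tsum_congr fun β => ih (by omega)
      (fun α => if localRule α β (top n δ') c = δ₁ ∧ Inter α β then
              (a * b n) ^ c * b n ^ skewSize (N + 1) β α * F β else 0) δ').trans ?_
    simp only [ENNReal.tsum_mul_left]
    rw [ENNReal.tsum_comm]
    rw [chainWt_cons, top_cons]
    -- Either both sides vanish, or the partition before the last has no part in row `N`, which is
    -- what inverting the local rule at the last cell requires.
    by_cases h0 : chainWt (N + 1) b n δ' = 0
    · simp [h0]
    have hγ : top n δ' N = 0 := top_eq_zero_of_chainWt_ne_zero h0 (by omega)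
    rw [mul_comm _ (chainWt (N + 1) b n δ'), mul_assoc]
    congr 1
    rw [← ENNReal.tsum_mul_left]
    refine tsum_congr fun β => ?_
    have h := tsum_localRule (β := β) (δ := δ₁) a (b n) hγ
    calc _ = (∑' (c : ℕ) (α : ℕ → ℕ),
          if localRule α β (top n δ') c = δ₁ ∧ Inter α β ∧ Inter α (top n δ') then
          (a * b n) ^ c * b n ^ skewSize (N + 1) β α * a ^ skewSize (N + 1) (top n δ') α
          else 0) * F β := by
          rw [← ENNReal.tsum_mul_right]
          refine tsum_congr fun c => ?_
          rw [← ENNReal.tsum_mul_right]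
          refine tsum_congr fun α => ?_
          by_cases h1 : localRule α β (top n δ') c = δ₁ <;> by_cases h2 : Inter α β <;>
            by_cases h3 : Inter α (top n δ') <;> simp [h1, h2, h3]
          ring
      _ = _ := by
          rw [h]
          by_cases h1 : Inter β δ₁ <;> by_cases h2 : Inter (top n δ') δ₁ <;> simp [h1, h2]
          ring

lemma chainWt_zeroTup (N : ℕ) (b : ℕ → ℝ≥0∞) (n : ℕ) : chainWt N b n (zeroTup n) = 1 := by
  induction n with
  | zero => rfl
  | succ n ih =>
    rw [zeroTup_succ, chainWt_cons, top_zeroTup, ih, if_pos (inter_zero_iff.2 rfl), skewSize_self]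
    simp

lemma eq_zeroTup {N : ℕ} {b : ℕ → ℝ≥0∞} {n : ℕ} {δ : Tup (ℕ → ℕ) n}
    (h : chainWt N b n δ ≠ 0) (h0 : top n δ = 0) : δ = zeroTup n := by
  induction n with
  | zero => rfl
  | succ n ih =>
    obtain ⟨δ₁, δ', rfl⟩ := δ.exists_cons
    rw [chainWt_cons] at h
    have h1 := left_ne_zero_of_mul h
    have h3 : Inter (top n δ') δ₁ := by
      by_contra h'; exact h1 (if_neg h')
    rw [top_cons] at h0
    subst h0
    rw [zeroTup_succ, ih (right_ne_zero_of_mul h) (inter_zero_iff.1 h3)]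
    rfl

/-- The weighted number of matrices with given growth. -/
theorem tsum_growth (N : ℕ) (a b : ℕ → ℝ≥0∞) (n : ℕ) (hn : n ≤ N + 1) (m : ℕ)
    (δ : Tup (ℕ → ℕ) n) :
    (∑' A : Tup (Tup ℕ n) m, if growth n m A = δ then matWt a b n m A else 0)
      = chainWt (N + 1) b n δ * schur (N + 1) a m (top n δ) := by
  induction m generalizing δ with
  | zero =>
    rw [tsum_tup_zero]
    show (if zeroTup n = δ then 1 else 0) = chainWt (N + 1) b n δ * if top n δ = 0 then 1 else 0
    by_cases h : zeroTup n = δ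
    · subst h
      rw [if_pos rfl, chainWt_zeroTup, if_pos (show top n (zeroTup n) = 0 from top_zeroTup n)]
      simp
    · rw [if_neg h]
      by_cases h0 : chainWt (N + 1) b n δ = 0
      · simp [h0]
      · rw [if_neg fun h' => h (eq_zeroTup h0 h').symm]
        simp
  | succ m ih =>
    rw [tsum_tup_succ]
    have := tsum_step N (a m) b n hn (schur (N + 1) a m) δ
    rw [schur, ← this]
    refine tsum_congr fun c => ?_
    change (∑' A : Tup (Tup ℕ n) m, if step n c (growth n m A) = δ then
      rowWt (a m) b n c * matWt a b n m A else 0) = _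
    rw [tsum_fiber (growth n m) fun A β => if step n c β = δ then
      rowWt (a m) b n c * matWt a b n m A else 0]
    refine tsum_congr fun β => ?_
    by_cases h : step n c β = δ
    · rw [if_pos h, ← ih, ← ENNReal.tsum_mul_left]
      refine tsum_congr fun A => ?_
      by_cases h' : growth n m A = β <;> simp [h, h']
    · simp [h]

/-- A chain of horizontal strips ending in `κ` is a semistandard tableau of shape `κ`, read level by
level. -/
lemma tsum_chainWt (N : ℕ) (b : ℕ → ℝ≥0∞) (n : ℕ) (κ : ℕ → ℕ) :
    (∑' δ : Tup (ℕ → ℕ) n, if top n δ = κ then chainWt N b n δ else 0) = schur N b n κ := by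
  induction n generalizing κ with
  | zero =>
    rw [tsum_tup_zero, top_nil]
    show (if (fun _ => 0) = κ then 1 else 0) = if κ = 0 then 1 else 0
    by_cases h : κ = 0
    · subst h; rw [if_pos (show (fun _ => 0) = (0 : ℕ → ℕ) from rfl), if_pos rfl]
    · rw [if_neg h, if_neg fun h' => h h'.symm]
  | succ n ih =>
    rw [tsum_tup_succ, tsum_eq_single κ]
    · simp only [schur, top_cons, if_true, chainWt_cons]
      rw [tsum_fiber (top n) fun δ' l => (if Inter l κ then
        b n ^ skewSize N κ l else 0) * chainWt N b n δ']
      refine tsum_congr fun l => ?_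
      by_cases h : Inter l κ
      · rw [if_pos h, if_pos h, ← ih, ← ENNReal.tsum_mul_left]
        refine tsum_congr fun δ' => ?_
        split_ifs <;> simp
      · simp [h]
    · intro δ₁ h
      rw [ENNReal.tsum_eq_zero]
      intro δ'
      exact if_neg h

/-- The weighted number of matrices such that the matrix and the submatrix without the last column
have given shapes. -/
theorem tsum_shapes (N : ℕ) (a b : ℕ → ℝ≥0∞) (n : ℕ) (hn : n ≤ N) (m : ℕ) (μ κ : ℕ → ℕ) :
    (∑' A : Tup (Tup ℕ (n + 1)) m, if top (n + 1) (growth (n + 1) m A) = μ ∧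
        top n (Tup.tail (growth (n + 1) m A)) = κ then matWt a b (n + 1) m A else 0)
      = (if Inter κ μ then b n ^ skewSize (N + 1) μ κ else 0)
        * schur (N + 1) a m μ * schur (N + 1) b n κ := by
  rw [tsum_fiber (growth (n + 1) m) fun A δ => if top (n + 1) δ = μ ∧
        top n (Tup.tail δ) = κ then matWt a b (n + 1) m A else 0]
  have h1 : ∀ δ : Tup (ℕ → ℕ) (n + 1), (∑' A : Tup (Tup ℕ (n + 1)) m,
      if growth (n + 1) m A = δ then (if top (n + 1) δ = μ ∧
        top n (Tup.tail δ) = κ then matWt a b (n + 1) m A else 0) else 0)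
      = if top (n + 1) δ = μ ∧ top n (Tup.tail δ) = κ then
          chainWt (N + 1) b (n + 1) δ * schur (N + 1) a m (top (n + 1) δ) else 0 := by
    intro δ
    by_cases h : top (n + 1) δ = μ ∧ top n (Tup.tail δ) = κ
    · simp only [if_pos h]
      exact tsum_growth N a b (n + 1) (by omega) m δ
    · simp [h]
  simp only [h1]
  rw [tsum_tup_succ, tsum_eq_single μ]
  · rw [← tsum_chainWt (N + 1) b n κ, ← ENNReal.tsum_mul_left]
    refine tsum_congr fun δ' => ?_
    simp only [top_cons, Tup.tail_cons, chainWt_cons]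
    by_cases h : top n δ' = κ
    · subst h
      simp only [and_self, if_true]
      ring
    · simp [h]
  · intro δ₁ h
    rw [ENNReal.tsum_eq_zero]
    intro δ'
    exact if_neg fun h' => h h'.1

end RSKJacobi

namespace RSKJacobi

/-! ### Determinants over interlacing points and the principal specialization -/

open scoped ENNReal Classical

/-- `∏_{i < j} (v_j - v_i)`. -/
def vd {m : ℕ} (v : Fin m → ℝ) : ℝ := ∏ i, ∏ j ∈ Finset.Ioi i, (v j - v i)

lemma vd_eq_det {m : ℕ} (v : Fin m → ℝ) : vd v = (Matrix.vandermonde v).det :=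
  (Matrix.det_vandermonde v).symm

/-- A determinant with a column of ones in terms of the differences of consecutive rows. -/
lemma det_sub_pred {m : ℕ} (M : Matrix (Fin (m + 1)) (Fin (m + 1)) ℝ) (h : ∀ i, M i 0 = 1) :
    (Matrix.of fun i j : Fin m => M i.succ j.succ - M i.castSucc j.succ).det = M.det := by
  have h1 : M.det = (Matrix.of fun i j =>
      (Fin.cases (M 0 j) (fun i : Fin m => M i.succ j - M i.castSucc j) i : ℝ)).det := by
    refine Matrix.det_eq_of_forall_row_eq_smul_add_pred (fun _ => 1) (fun j => ?_)
      (fun i j => ?_)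
    · simp
    · simp
  rw [h1, Matrix.det_succ_column_zero, Fin.sum_univ_succ, Finset.sum_eq_zero]
  · simp [h]
    rfl
  · intro i _
    simp [h]

/-- The Vandermonde product through differences of powers. -/
lemma det_pow_sub_pow {m : ℕ} (w : Fin (m + 1) → ℝ) :
    (Matrix.of fun i j : Fin m => w i.succ ^ ((j : ℕ) + 1) - w i.castSucc ^ ((j : ℕ) + 1)).det
      = vd w := by
  rw [vd_eq_det, ← det_sub_pred (Matrix.vandermonde w) fun i => by simp]
  simp [Matrix.vandermonde_apply]

/-- Multilinearity in the rows: a sum over a box of a determinant whose `i`-th row depends only on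
the `i`-th variable can be taken inside, row by row. -/
lemma det_sum_piFinset {m : ℕ} (S : Fin m → Finset ℕ) (g : Fin m → ℕ → Fin m → ℝ) :
    (∑ l ∈ Fintype.piFinset S, (Matrix.of fun i j => g i (l i) j).det)
      = (Matrix.of fun i j => ∑ x ∈ S i, g i x j).det := by
  have := (Matrix.detRowAlternating (R := ℝ) (n := Fin m)).toMultilinearMap.map_sum_finset g S
  have e : (fun i => ∑ j ∈ S i, g i j) = Matrix.of fun i j => ∑ x ∈ S i, g i x j := by
    funext i j
    simp [Finset.sum_apply]
  rw [e] at this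
  exact this.symm

lemma geom_sum_Icc {q : ℝ} (hq : q ≠ 1) {b c : ℕ} (h : b ≤ c + 1) :
    ∑ x ∈ Finset.Icc b c, q ^ x = (q ^ b - q ^ (c + 1)) / (1 - q) := by
  have := geom_sum_Ico hq h
  rw [← Finset.Ico_add_one_right_eq_Icc, this, ← neg_div_neg_eq]
  congr 1 <;> ring

/-- The numbers `μ_i + m - 1 - i`. -/
def shiftFin (m : ℕ) (μ : ℕ → ℕ) (i : Fin m) : ℕ := μ i + (m - 1 - i)

/-- Extension by zero. -/
def extZero {m : ℕ} (l : Fin m → ℕ) (r : ℕ) : ℕ := if h : r < m then l ⟨r, h⟩ else 0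

lemma extZero_val {m : ℕ} (l : Fin m → ℕ) (i : Fin m) : extZero l i = l i := by
  simp [extZero]

lemma extZero_of_le {m : ℕ} (l : Fin m → ℕ) {r : ℕ} (h : m ≤ r) : extZero l r = 0 := by
  simp [extZero, h]

lemma sum_range_of_support {N m : ℕ} (hN : m ≤ N) {f : ℕ → ℕ} (h : ∀ r, m ≤ r → f r = 0) :
    ∑ r ∈ Finset.range N, f r = ∑ i : Fin m, f i := by
  rw [Fin.sum_univ_eq_sum_range f m]
  symm
  refine Finset.sum_subset (Finset.range_mono hN) fun r _ hr => h r ?_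
  simpa using hr

/-- The summand is a determinant with one variable per row, and the interlacing conditions form a
box. Each entry becomes a geometric sum, hence a multiple, depending only on the column, of a
difference between consecutive rows of the Vandermonde matrix of size `m + 1`. -/
lemma prod_pow_vd_sum {q : ℝ} (hq0 : 0 < q) (hq : q ≠ 1) {m : ℕ} {μ : ℕ → ℕ}
    (hμ : ∀ i, μ (i + 1) ≤ μ i) :
    ∑ l ∈ Fintype.piFinset (fun i : Fin m => Finset.Icc (μ (i + 1)) (μ i)),
      (∏ i, q ^ shiftFin m (extZero l) i) * vd (fun i => q ^ shiftFin m (extZero l) i)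
    = (∏ j : Fin m, (1 - q ^ ((j : ℕ) + 1)))⁻¹ * vd fun i => q ^ shiftFin (m + 1) μ i := by
  have h1 : ∀ l : Fin m → ℕ,
      (∏ i, q ^ shiftFin m (extZero l) i) * vd (fun i => q ^ shiftFin m (extZero l) i)
      = (Matrix.of fun i j : Fin m => (fun (i : Fin m) (x : ℕ) (j : Fin m) =>
          (q ^ ((j : ℕ) + 1)) ^ (x + (m - 1 - i))) i (l i) j).det := by
    intro l
    beta_reduce
    rw [vd_eq_det, ← Matrix.det_mul_column]
    congr 1
    ext i j
    simp only [Matrix.of_apply, Matrix.vandermonde_apply, shiftFin, extZero_val]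
    rw [← pow_succ', ← pow_mul, ← pow_mul, mul_comm]
  refine (Finset.sum_congr rfl fun l _ => h1 l).trans
    ((det_sum_piFinset (fun i : Fin m => Finset.Icc (μ (i + 1)) (μ i))
      (fun (i : Fin m) (x : ℕ) (j : Fin m) =>
        (q ^ ((j : ℕ) + 1)) ^ (x + (m - 1 - (i : ℕ))))).trans ?_)
  have h2 : (Matrix.of fun i j : Fin m => ∑ x ∈ Finset.Icc (μ (i + 1)) (μ i),
        (fun (i : Fin m) (x : ℕ) (j : Fin m) =>
          (q ^ ((j : ℕ) + 1)) ^ (x + (m - 1 - i))) i x j)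
      = Matrix.of fun i j : Fin m => (1 - q ^ ((j : ℕ) + 1))⁻¹ *
        (Matrix.of fun i j : Fin m => (q ^ shiftFin (m + 1) μ i.succ) ^ ((j : ℕ) + 1)
          - (q ^ shiftFin (m + 1) μ i.castSucc) ^ ((j : ℕ) + 1)) i j := by
    ext i j
    have hQ : q ^ ((j : ℕ) + 1) ≠ 1 := by
      intro h
      exact hq ((pow_eq_one_iff_of_nonneg hq0.le (by omega)).1 h)
    simp only [Matrix.of_apply, pow_add (q ^ ((j : ℕ) + 1)), ← Finset.sum_mul]
    -- The ends `μ (i + 1)` and `μ i + 1` of the geometric sum, shifted by `m - 1 - i`, are the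
    -- shifted parts of `μ` of indices `i + 1` and `i` among `m + 1` rows.
    rw [geom_sum_Icc hQ (by have := hμ i; omega)]
    simp only [shiftFin, Fin.val_succ, Fin.val_castSucc]
    have e1 : m + 1 - 1 - ((i : ℕ) + 1) = m - 1 - i := by omega
    have e2 : m + 1 - 1 - (i : ℕ) = m - 1 - i + 1 := by omega
    rw [e1, e2, div_mul_eq_mul_div, div_eq_inv_mul, ← pow_mul, ← pow_mul, ← pow_mul, ← pow_mul,
      ← pow_mul, sub_mul, ← pow_add, ← pow_add]
    congr 2 <;> congr 1 <;> ring
  rw [h2, Matrix.det_mul_row, Finset.prod_inv_distrib]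
  exact congrArg _ (det_pow_sub_pow fun i => q ^ shiftFin (m + 1) μ i)

/-! ### Schur functions at a geometric progression -/

lemma schur_support {N : ℕ} {a : ℕ → ℝ≥0∞} {m : ℕ} {μ : ℕ → ℕ} (h : schur N a m μ ≠ 0) :
    (∀ r, m ≤ r → μ r = 0) ∧ ∀ i, μ (i + 1) ≤ μ i := by
  induction m generalizing μ with
  | zero =>
    have : μ = 0 := by
      by_contra h'
      rw [schur, if_neg h'] at h
      exact h rfl
    subst this
    simp
  | succ m ih =>
    rw [schur, Ne, ENNReal.tsum_eq_zero, not_forall] at h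
    obtain ⟨l, hl⟩ := h
    have h1 : Inter l μ := by
      by_contra h'
      rw [if_neg h'] at hl
      exact hl rfl
    rw [if_pos h1] at hl
    have h2 := ih (right_ne_zero_of_mul hl)
    refine ⟨fun r hr => ?_, fun i => (h1 i).1.trans (h1 i).2⟩
    have h3 := (h1 (r - 1)).1
    rw [Nat.sub_add_cancel (by omega), h2.1 (r - 1) (by omega)] at h3
    omega

lemma schur_succ_eq_sum {N : ℕ} {a : ℕ → ℝ≥0∞} {m : ℕ} {μ : ℕ → ℕ}
    (hμ : ∀ r, m + 1 ≤ r → μ r = 0) :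
    schur N a (m + 1) μ =
      ∑ l ∈ Fintype.piFinset (fun i : Fin m => Finset.Icc (μ (i + 1)) (μ i)),
        a m ^ skewSize N μ (extZero l) * schur N a m (extZero l) := by
  rw [schur, tsum_eq_sum (s := (Fintype.piFinset
    (fun i : Fin m => Finset.Icc (μ (i + 1)) (μ i))).image extZero)]
  · rw [Finset.sum_image]
    · refine Finset.sum_congr rfl fun l hl => ?_
      by_cases h0 : schur N a m (extZero l) = 0
      · simp [h0]
      rw [if_pos]
      intro i
      rcases lt_or_ge i m with hi | hi
      · have := Finset.mem_Icc.1 (Fintype.mem_piFinset.1 hl ⟨i, hi⟩)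
        have e := extZero_val l ⟨i, hi⟩
        simp only at e this
        rwa [e]
      · rw [extZero_of_le l hi, hμ (i + 1) (by omega)]
        omega
    · intro l _ l' _ h
      funext i
      rw [← extZero_val l, ← extZero_val l', h]
  · intro l hl
    by_contra h
    have h1 : Inter l μ := by
      by_contra h'
      rw [if_neg h'] at h
      exact h rfl
    rw [if_pos h1] at h
    have h2 := (schur_support (right_ne_zero_of_mul h)).1
    apply hl
    rw [Finset.mem_image]
    refine ⟨fun i => l i, Fintype.mem_piFinset.2 fun i => Finset.mem_Icc.2 (h1 i), ?_⟩
    funext r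
    rcases lt_or_ge r m with hr | hr
    · exact extZero_val _ ⟨r, hr⟩
    · rw [extZero_of_le _ hr, h2 r hr]

lemma schur_zero (N : ℕ) (a : ℕ → ℝ≥0∞) (m : ℕ) : schur N a m (fun _ => 0) = 1 := by
  induction m with
  | zero => exact if_pos rfl
  | succ m ih =>
    rw [schur, tsum_eq_single fun _ => 0]
    · rw [if_pos (inter_zero_iff.2 rfl), skewSize_self, ih]
      simp
    · intro l hl
      exact if_neg fun h => hl (inter_zero_iff.1 h)

/-- The base is `t⁻¹` because branching strips off the variable `s * t ^ m`: replacing `s * t ^ (m -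
1)` by it on the remaining boxes costs a factor `t⁻¹` per box, which is the product weight of
`prod_pow_vd_sum`. The constant is left open and is found afterwards from the empty partition;
nonnegativity is carried along for `ENNReal.ofReal`. -/
lemma exists_schur_eq {s t : ℝ} (hs : 0 < s) (ht : 0 < t) (ht1 : t ≠ 1) (N m : ℕ) (hm : m ≤ N) :
    ∃ k : ℝ, ∀ μ : ℕ → ℕ, (∀ r, m ≤ r → μ r = 0) → (∀ i, μ (i + 1) ≤ μ i) →
      schur N (fun i => ENNReal.ofReal (s * t ^ i)) m μ = ENNReal.ofReal
        ((s * t ^ (m - 1)) ^ (∑ i : Fin m, μ i) * k * vd fun i => t⁻¹ ^ shiftFin m μ i) ∧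
      0 ≤ (s * t ^ (m - 1)) ^ (∑ i : Fin m, μ i) * k * vd fun i => t⁻¹ ^ shiftFin m μ i := by
  induction m with
  | zero =>
    refine ⟨1, fun μ h _ => ?_⟩
    have h0 : μ = 0 := funext fun r => h r (by omega)
    simp [schur, h0, vd]
  | succ m ih =>
    obtain ⟨k, hk⟩ := ih (by omega)
    -- The power of `t` cancels the staircase part of the product weight; the inverse product is the
    -- constant of the summation formula.
    refine ⟨k * t ^ (∑ i : Fin m, (m - 1 - (i : ℕ)))
      * (∏ j : Fin m, (1 - t⁻¹ ^ ((j : ℕ) + 1)))⁻¹, fun μ h1 h2 => ?_⟩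
    have hq0 : 0 < t⁻¹ := inv_pos.2 ht
    have hq1 : t⁻¹ ≠ 1 := by simpa using ht1
    set S := Fintype.piFinset fun i : Fin m => Finset.Icc (μ (i + 1)) (μ i) with hS
    have key : ∀ l ∈ S,
        (∀ r, m ≤ r → extZero l r = 0) ∧ (∀ i, extZero l (i + 1) ≤ extZero l i) ∧
          skewSize N μ (extZero l) + ∑ i, l i = ∑ i : Fin (m + 1), μ i := by
      intro l hl
      have hl' : ∀ i : Fin m, μ (i + 1) ≤ l i ∧ l i ≤ μ i := fun i =>
        Finset.mem_Icc.1 (Fintype.mem_piFinset.1 hl i)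
      have hle : ∀ r, extZero l r ≤ μ r := fun r => by
        rcases lt_or_ge r m with hr | hr
        · have := (hl' ⟨r, hr⟩).2
          rwa [← extZero_val l ⟨r, hr⟩] at this
        · rw [extZero_of_le l hr]; omega
      refine ⟨fun r => extZero_of_le l, fun i => ?_, ?_⟩
      · rcases lt_or_ge (i + 1) m with hr | hr
        · have a1 := (hl' ⟨i, by omega⟩).1
          have a2 := hle (i + 1)
          rw [← extZero_val l ⟨i, by omega⟩] at a1
          exact a2.trans a1
        · rw [extZero_of_le l hr]; omega
      · rw [← sum_range_of_support hm h1]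
        have e : ∑ i, l i = ∑ r ∈ Finset.range N, extZero l r := by
          rw [sum_range_of_support (by omega : m ≤ N) fun r => extZero_of_le l]
          exact Finset.sum_congr rfl fun i _ => (extZero_val l i).symm
        rw [e, skewSize, ← Finset.sum_add_distrib]
        exact Finset.sum_congr rfl fun r _ => by have := hle r; omega
    have hterm : ∀ l ∈ S, ENNReal.ofReal (s * t ^ m) ^ skewSize N μ (extZero l) *
        schur N (fun i => ENNReal.ofReal (s * t ^ i)) m (extZero l) = ENNReal.ofReal
          ((s * t ^ m) ^ (∑ i : Fin (m + 1), μ i) * k * t ^ (∑ i : Fin m, (m - 1 - (i : ℕ))) *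
            ((∏ i, t⁻¹ ^ shiftFin m (extZero l) i)
              * vd (fun i => t⁻¹ ^ shiftFin m (extZero l) i))) ∧
        0 ≤ (s * t ^ m) ^ (∑ i : Fin (m + 1), μ i) * k * t ^ (∑ i : Fin m, (m - 1 - (i : ℕ))) *
            ((∏ i, t⁻¹ ^ shiftFin m (extZero l) i)
              * vd (fun i => t⁻¹ ^ shiftFin m (extZero l) i)) := by
      intro l hl
      obtain ⟨k1, k2, k3⟩ := key l hl
      obtain ⟨e1, e2⟩ := hk _ k1 k2
      have e3 : (s * t ^ m) ^ (∑ i : Fin (m + 1), μ i) * k *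
          t ^ (∑ i : Fin m, (m - 1 - (i : ℕ))) * ((∏ i, t⁻¹ ^ shiftFin m (extZero l) i)
              * vd (fun i => t⁻¹ ^ shiftFin m (extZero l) i))
          = (s * t ^ m) ^ skewSize N μ (extZero l) * ((s * t ^ (m - 1)) ^ (∑ i : Fin m, extZero l i)
            * k * vd fun i => t⁻¹ ^ shiftFin m (extZero l) i) := by
        simp only [shiftFin, extZero_val, Finset.prod_pow_eq_pow_sum, Finset.sum_add_distrib] at *
        rw [← k3]
        rcases Nat.eq_zero_or_pos m with rfl | hm0
        · simp; ring
        · have e4 : s * t ^ m = s * t ^ (m - 1) * t := by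
            rw [mul_assoc, ← pow_succ, Nat.sub_add_cancel hm0]
          rw [pow_add (s * t ^ m), pow_add t⁻¹]
          nth_rw 2 [e4]
          rw [mul_pow _ t, inv_pow, inv_pow]
          field_simp
      rw [e3, e1, ← ENNReal.ofReal_pow (by positivity), ← ENNReal.ofReal_mul (by positivity)]
      exact ⟨rfl, mul_nonneg (by positivity) e2⟩
    have hsum : (s * t ^ (m + 1 - 1)) ^ (∑ i : Fin (m + 1), μ i) *
        (k * t ^ (∑ i : Fin m, (m - 1 - (i : ℕ))) * (∏ j : Fin m, (1 - t⁻¹ ^ ((j : ℕ) + 1)))⁻¹) *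
          vd (fun i => t⁻¹ ^ shiftFin (m + 1) μ i)
        = ∑ l ∈ S, (s * t ^ m) ^ (∑ i : Fin (m + 1), μ i) * k *
          t ^ (∑ i : Fin m, (m - 1 - (i : ℕ))) * ((∏ i, t⁻¹ ^ shiftFin m (extZero l) i)
              * vd (fun i => t⁻¹ ^ shiftFin m (extZero l) i)) := by
      rw [← Finset.mul_sum, prod_pow_vd_sum hq0 hq1 h2, Nat.add_sub_cancel]
      ring
    rw [hsum]
    refine ⟨?_, Finset.sum_nonneg fun l hl => (hterm l hl).2⟩
    rw [schur_succ_eq_sum h1, ENNReal.ofReal_sum_of_nonneg fun l hl => (hterm l hl).2]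
    exact Finset.sum_congr rfl fun l hl => (hterm l hl).1

/-- Each factor `t ^ h j - t ^ h i` equals `-(t ^ h i * t ^ h j)` times the corresponding factor for
`t⁻¹`, and every index lies in `m - 1` pairs: `m - 1 - i` as the smaller and `i` as the larger. -/
lemma vd_inv {m : ℕ} {t : ℝ} (ht : 0 < t) (h : Fin m → ℕ) :
    vd (fun i => t ^ h i) = (∏ i : Fin m, ∏ _j ∈ Finset.Ioi i, (-1 : ℝ)) * t ^ ((m - 1) * ∑ i, h i)
      * vd (fun i => t⁻¹ ^ h i) := by
  have e1 : ∏ i : Fin m, ∏ j ∈ Finset.Ioi i, (t ^ h i * t ^ h j) = t ^ ((m - 1) * ∑ i, h i) := by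
    have := Finset.prod_comm' (s := Finset.univ) (t := fun i : Fin m => Finset.Ioi i)
      (t' := Finset.univ) (s' := fun j : Fin m => Finset.Iio j) (f := fun _ j => t ^ h j)
      (by simp)
    simp only [Finset.prod_mul_distrib, this]
    simp only [Finset.prod_const, Fin.card_Ioi, Fin.card_Iio]
    rw [← Finset.prod_mul_distrib, Finset.mul_sum, ← Finset.prod_pow_eq_pow_sum]
    refine Finset.prod_congr rfl fun i _ => ?_
    rw [← pow_add, ← pow_mul, mul_comm]
    congr 2
    omega
  rw [← e1, vd, vd, ← Finset.prod_mul_distrib, ← Finset.prod_mul_distrib]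
  refine Finset.prod_congr rfl fun i _ => ?_
  rw [← Finset.prod_mul_distrib, ← Finset.prod_mul_distrib]
  refine Finset.prod_congr rfl fun j _ => ?_
  have := ht.ne'
  rw [inv_pow, inv_pow]
  field_simp
  ring

lemma vd_pow_ne_zero {m : ℕ} {t : ℝ} (ht : 0 < t) (ht1 : t ≠ 1) {h : Fin m → ℕ}
    (hh : Function.Injective h) : vd (fun i => t ^ h i) ≠ 0 := by
  rw [vd_eq_det, Matrix.det_vandermonde_ne_zero_iff]
  intro i j hij
  exact hh (pow_right_injective₀ ht ht1 hij)

lemma shiftFin_injective {m : ℕ} {μ : ℕ → ℕ} (hμ : ∀ i, μ (i + 1) ≤ μ i) :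
    Function.Injective (shiftFin m μ) := by
  have hanti : Antitone μ := antitone_nat_of_succ_le hμ
  have : StrictAnti (shiftFin m μ) := by
    intro i j hij
    have := hanti (show (i : ℕ) ≤ j from le_of_lt hij)
    have hij' : (i : ℕ) < j := hij
    simp only [shiftFin]
    omega
  exact this.injective

/-- The principal specialization of the Schur functions. -/
theorem schur_eq {s t : ℝ} (hs : 0 < s) (ht : 0 < t) (ht1 : t ≠ 1) {N m : ℕ} (hm : m ≤ N)
    {μ : ℕ → ℕ} (h1 : ∀ r, m ≤ r → μ r = 0) (h2 : ∀ i, μ (i + 1) ≤ μ i) :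
    schur N (fun i => ENNReal.ofReal (s * t ^ i)) m μ = ENNReal.ofReal
        (s ^ (∑ i : Fin m, μ i) * (vd (fun i => t ^ shiftFin m μ i)
          / vd fun i : Fin m => t ^ (m - 1 - (i : ℕ)))) ∧
      0 < s ^ (∑ i : Fin m, μ i) * (vd (fun i => t ^ shiftFin m μ i)
          / vd fun i : Fin m => t ^ (m - 1 - (i : ℕ))) := by
  obtain ⟨k, hk⟩ := exists_schur_eq hs ht ht1 N m hm
  -- The Schur function of the empty partition is `1`, which determines `k`.
  have h0 := (hk (fun _ => 0) (by simp) (by simp)).1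
  rw [schur_zero] at h0
  have h3 : k * vd (fun i : Fin m => t⁻¹ ^ (m - 1 - (i : ℕ))) = 1 := by
    have := (ENNReal.ofReal_eq_one.1 h0.symm)
    simpa [shiftFin] using this
  obtain ⟨e1, e2⟩ := hk μ h1 h2
  have hv := vd_pow_ne_zero ht ht1 (shiftFin_injective (m := m) h2)
  have hv0 := vd_pow_ne_zero ht ht1 (shiftFin_injective (m := m) (μ := fun _ => 0) (by simp))
  simp only [shiftFin, zero_add] at hv0
  have e3 : s ^ (∑ i : Fin m, μ i) * (vd (fun i => t ^ shiftFin m μ i)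
          / vd fun i : Fin m => t ^ (m - 1 - (i : ℕ)))
      = (s * t ^ (m - 1)) ^ (∑ i : Fin m, μ i) * k * vd fun i => t⁻¹ ^ shiftFin m μ i := by
    have e4 := vd_inv ht (fun i : Fin m => m - 1 - (i : ℕ))
    have e5 := vd_inv ht (shiftFin m μ)
    rw [mul_div_assoc', div_eq_iff hv0, e5, e4]
    simp only [shiftFin, Finset.sum_add_distrib, Nat.mul_add, pow_add, pow_mul, mul_pow]
    linear_combination (-(s ^ (∑ i : Fin m, μ i) * (t ^ (m - 1)) ^ (∑ i : Fin m, μ i)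
      * (∏ i : Fin m, ∏ _j ∈ Finset.Ioi i, (-1 : ℝ))
      * (t ^ (m - 1)) ^ (∑ i : Fin m, (m - 1 - (i : ℕ)))
      * vd (fun i : Fin m => t⁻¹ ^ μ i * t⁻¹ ^ (m - 1 - (i : ℕ))))) * h3
  rw [e3]
  refine ⟨e1, lt_of_le_of_ne e2 (Ne.symm ?_)⟩
  rw [← e3]
  exact mul_ne_zero (pow_ne_zero _ hs.ne') (div_ne_zero hv hv0)

end RSKJacobi

namespace RSKJacobi

/-! ### The joint probability -/

open scoped ENNReal Classical

lemma rowWt_ofFin (a : ℝ≥0∞) (b : ℕ → ℝ≥0∞) {n : ℕ} (c : Fin n → ℕ) :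
    rowWt a b n (Tup.ofFin n c) = ∏ j : Fin n, (a * b j) ^ c j := by
  induction n with
  | zero => rfl
  | succ n ih =>
    have h : Tup.ofFin (n + 1) c = Tup.cons (c (Fin.last n)) (Tup.ofFin n fun i => c i.castSucc) :=
      rfl
    rw [h, rowWt_cons, ih, Fin.prod_univ_castSucc, mul_comm]
    rfl

lemma matWt_ofMatrix (a b : ℕ → ℝ≥0∞) {n m : ℕ} (A : Matrix (Fin m) (Fin n) ℕ) :
    matWt a b n m (ofMatrix A) = ∏ i : Fin m, ∏ j : Fin n, (a i * b j) ^ A i j := by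
  induction m with
  | zero => rfl
  | succ m ih =>
    have h : ofMatrix A = Tup.cons (Tup.ofFin n (A (Fin.last m)))
      (ofMatrix fun i => A i.castSucc) := rfl
    rw [h, matWt_cons, ih fun i => A i.castSucc, Fin.prod_univ_castSucc, mul_comm, rowWt_ofFin]
    rfl

/-- Matrices correspond to tuples of tuples. -/
def ofMatrixEquiv (m n : ℕ) : (Fin m → Fin n → ℕ) ≃ Tup (Tup ℕ n) m :=
  (Equiv.piCongrRight fun _ => Tup.ofFin n).trans (Tup.ofFin m)

lemma schur_congr {N : ℕ} {a a' : ℕ → ℝ≥0∞} {m : ℕ} (h : ∀ i < m, a i = a' i) (μ : ℕ → ℕ) :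
    schur N a m μ = schur N a' m μ := by
  induction m generalizing μ with
  | zero => rfl
  | succ m ih =>
    simp only [schur, h m (Nat.lt_succ_self m), ih fun i hi => h i (by omega)]

lemma one_sub_siteParam_pos {n₁ n₂ : ℕ} {z α t : ℝ}
    (hq : ∀ (i : Fin n₁) (j : Fin (n₂ + 1)), siteParam z α t i j < 1) (i : Fin n₁)
    (j : Fin (n₂ + 1)) : 0 < 1 - siteParam z α t i j := sub_pos.2 (hq i j)

/-- The column parameters. -/
noncomputable def colParam (n₂ : ℕ) (z α t : ℝ) (j : ℕ) : ℝ :=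
  if j = n₂ then α * z else z ^ 2 * t ^ j

/-- The product form in row and column is what makes the law of the matrix a Schur-type weight; the
exceptional last column only changes one column variable. -/
lemma siteParam_eq {n₁ n₂ : ℕ} (z α t : ℝ) (i : Fin n₁) (j : Fin (n₂ + 1)) :
    siteParam z α t i j = t ^ (i : ℕ) * colParam n₂ z α t j := by
  unfold siteParam colParam
  by_cases h : j = Fin.last n₂
  · subst h; simp; ring
  · rw [if_neg h, if_neg fun h' : (j : ℕ) = n₂ => h (Fin.ext h'), pow_add]; ring

/-- The probability of a configuration. -/
lemma measure_config {n₁ n₂ : ℕ} {Ω : Type*} [MeasurableSpace Ω] {P : Measure Ω}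
    [IsProbabilityMeasure P] {z α t : ℝ} (hz : 0 < z) (hα : 0 < α) (ht : 0 < t)
    (hq : ∀ (i : Fin n₁) (j : Fin (n₂ + 1)), siteParam z α t i j < 1)
    {X : Fin n₁ → Fin (n₂ + 1) → Ω → ℕ} (hX : HasSiteLaw P X z α t)
    (A : Fin n₁ → Fin (n₂ + 1) → ℕ) :
    P ((fun ω i j => X i j ω) ⁻¹' {A})
      = ENNReal.ofReal (∏ i : Fin n₁, ∏ j : Fin (n₂ + 1), (1 - siteParam z α t i j))
        * matWt (fun i => ENNReal.ofReal (1 * t ^ i))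
          (fun j => ENNReal.ofReal (colParam n₂ z α t j)) (n₂ + 1) n₁ (ofMatrix A) := by
  obtain ⟨hm, hind, hlaw⟩ := hX
  have hc : ∀ j, 0 ≤ colParam n₂ z α t j := fun j => by unfold colParam; split_ifs <;> positivity
  have h1 : (fun ω i j => X i j ω) ⁻¹' {A}
      = ⋂ p ∈ (Finset.univ : Finset (Fin n₁ × Fin (n₂ + 1))),
        (fun p : Fin n₁ × Fin (n₂ + 1) => X p.1 p.2) p ⁻¹' {A p.1 p.2} := by
    ext ω
    simp [funext_iff]
  rw [h1, hind.measure_inter_preimage_eq_mul Finset.univ fun _ _ => MeasurableSet.singleton _,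
    matWt_ofMatrix _ _ A, ENNReal.ofReal_prod_of_nonneg, ← Finset.prod_mul_distrib,
    Fintype.prod_prod_type]
  · refine Finset.prod_congr rfl fun i _ => ?_
    rw [ENNReal.ofReal_prod_of_nonneg fun j _ => (one_sub_siteParam_pos hq i j).le,
      ← Finset.prod_mul_distrib]
    refine Finset.prod_congr rfl fun j _ => ?_
    have h2 : P (X i j ⁻¹' {A i j})
        = ENNReal.ofReal ((1 - siteParam z α t i j) * siteParam z α t i j ^ A i j) := by
      rw [← hlaw i j (A i j), ofReal_measureReal]
      rfl
    show P (X i j ⁻¹' {A i j}) = _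
    have ha : 0 ≤ t ^ (i : ℕ) := by positivity
    rw [h2, ENNReal.ofReal_mul (one_sub_siteParam_pos hq i j).le, siteParam_eq, one_mul,
      ← ENNReal.ofReal_mul ha, ENNReal.ofReal_pow (mul_nonneg ha (hc j))]
  · exact fun i _ => Finset.prod_nonneg fun j _ => (one_sub_siteParam_pos hq i j).le

/-- The joint probability of the two shapes in terms of Schur functions. -/
theorem measure_shapes {n₁ n₂ : ℕ} {Ω : Type*} [MeasurableSpace Ω] {P : Measure Ω}
    [IsProbabilityMeasure P] {z α t : ℝ} (hz : 0 < z) (hα : 0 < α) (ht : 0 < t)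
    (hq : ∀ (i : Fin n₁) (j : Fin (n₂ + 1)), siteParam z α t i j < 1)
    {X : Fin n₁ → Fin (n₂ + 1) → Ω → ℕ} (hX : HasSiteLaw P X z α t) (μ κ : YoungDiagram) (N : ℕ)
    (hN : n₂ ≤ N) :
    P {ω | GivesShape (config X ω) μ ∧ GivesShape (subconfig X ω) κ}
      = ENNReal.ofReal (∏ i : Fin n₁, ∏ j : Fin (n₂ + 1), (1 - siteParam z α t i j))
        * ((if Inter κ.rowLen μ.rowLen then
            ENNReal.ofReal (α * z) ^ skewSize (N + 1) μ.rowLen κ.rowLen else 0)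
          * schur (N + 1) (fun i => ENNReal.ofReal (1 * t ^ i)) n₁ μ.rowLen
          * schur (N + 1) (fun j => ENNReal.ofReal (z ^ 2 * t ^ j)) n₂ κ.rowLen) := by
  set F : Ω → Fin n₁ → Fin (n₂ + 1) → ℕ := fun ω i j => X i j ω with hF
  have hFm : Measurable F :=
    measurable_pi_lambda _ fun i => measurable_pi_lambda _ fun j => hX.1 i j
  set b : ℕ → ℝ≥0∞ := fun j => ENNReal.ofReal (colParam n₂ z α t j) with hb
  set S : Set (Fin n₁ → Fin (n₂ + 1) → ℕ) := {A |
    top (n₂ + 1) (growth (n₂ + 1) n₁ (ofMatrixEquiv n₁ (n₂ + 1) A)) = μ.rowLen ∧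
    top n₂ (Tup.tail (growth (n₂ + 1) n₁ (ofMatrixEquiv n₁ (n₂ + 1) A))) = κ.rowLen} with hS
  have h1 : {ω | GivesShape (config X ω) μ ∧ GivesShape (subconfig X ω) κ} = F ⁻¹' S := by
    ext ω
    simp only [Set.mem_ofPred_eq, givesShape_iff, Set.mem_preimage, hS]
    refine and_congr Iff.rfl (Eq.congr_left ?_)
    exact congrArg (top n₂) (growth_tail (config X ω)).symm
  have h2 : schur (N + 1) (fun j => ENNReal.ofReal (z ^ 2 * t ^ j)) n₂ κ.rowLen
      = schur (N + 1) b n₂ κ.rowLen :=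
    schur_congr (fun i hi => by simp [hb, colParam, hi.ne]) _
  have h3 : ENNReal.ofReal (α * z) = b n₂ := by simp [hb, colParam]
  -- The event depends only on the matrix, and there are countably many matrices, so its probability
  -- is a sum over atoms, compared term by term with the weighted count.
  rw [h1, h2, h3, ← tsum_shapes N _ b n₂ hN n₁, ← (ofMatrixEquiv n₁ (n₂ + 1)).tsum_eq,
    ← Measure.map_apply hFm (Set.to_countable S).measurableSet,
    ← Measure.tsum_indicator_apply_singleton _ _ (Set.to_countable S).measurableSet,
    ← ENNReal.tsum_mul_left]
  refine tsum_congr fun A => ?_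
  by_cases hA : A ∈ S
  · rw [Set.indicator_of_mem hA, Measure.map_apply hFm (MeasurableSet.singleton A),
      measure_config hz hα ht hq hX A]
    rw [if_pos (show _ ∧ _ from hA)]
    rfl
  · rw [Set.indicator_of_notMem hA, if_neg (show ¬ (_ ∧ _) from hA), mul_zero]

/-! ### The explicit formula -/

lemma colLen_zero_le_iff (μ : YoungDiagram) (k : ℕ) :
    μ.colLen 0 ≤ k ↔ ∀ r, k ≤ r → μ.rowLen r = 0 := by
  have h : ∀ r, r < μ.colLen 0 ↔ 0 < μ.rowLen r := fun r => by
    rw [← YoungDiagram.mem_iff_lt_colLen, YoungDiagram.mem_iff_lt_rowLen]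
  constructor
  · intro hk r hr
    have := h r
    omega
  · intro hk
    by_contra hlt
    have h1 := (h k).1 (by omega)
    have h2 := hk k le_rfl
    omega

/-- `h_j` and `r_j` carry the same shift, while the shift of `h_{j+1}` is one less; this turns
`μ_{j+1} ≤ κ_j` into a strict inequality. Beyond row `n₂` the strip condition is trivial. -/
lemma interlaced_iff {n₂ : ℕ} {μ κ : YoungDiagram} (hμ : μ.colLen 0 ≤ n₂ + 1)
    (hκ : κ.colLen 0 ≤ n₂) :
    Interlaced (shiftMu n₂ μ) (shiftKappa n₂ κ) ↔ Inter κ.rowLen μ.rowLen := by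
  rw [colLen_zero_le_iff] at hμ hκ
  simp only [Interlaced, shiftMu, shiftKappa, Fin.val_castSucc, Fin.val_succ]
  constructor
  · intro h i
    rcases lt_or_ge i n₂ with hi | hi
    · have := h ⟨i, hi⟩
      simp only at this
      omega
    · rw [hκ i hi, hμ (i + 1) (by omega)]
      omega
  · intro h j
    have := h j
    have := j.2
    omega

lemma vd_succ {m : ℕ} (v : Fin (m + 1) → ℝ) :
    vd v = vd (fun i => v i.castSucc) * ∏ i : Fin m, (v (Fin.last m) - v i.castSucc) := by
  have h : ∀ i : Fin m, ∏ j ∈ Finset.Ioi i.castSucc, (v j - v i.castSucc)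
      = (∏ j ∈ Finset.Ioi i, (v j.castSucc - v i.castSucc))
        * (v (Fin.last m) - v i.castSucc) := by
    intro i
    have e : Finset.Ioi i.castSucc
        = insert (Fin.last m) ((Finset.Ioi i).map Fin.castSuccEmb) := by
      ext j
      refine Fin.lastCases ?_ (fun j => ?_) j
      · simp [Fin.castSucc_lt_last]
      · simp [Fin.le_last]
    rw [e, Finset.prod_insert (by simp), Finset.prod_map, mul_comm]
    rfl
  rw [vd, Fin.prod_univ_castSucc]
  simp only [h, Finset.prod_mul_distrib]
  have e : Finset.Ioi (Fin.last m) = ∅ := by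
    ext j; simp [Fin.le_last]
  rw [e, Finset.prod_empty, mul_one]
  rfl

lemma vd_smul {m : ℕ} (c : ℝ) (v : Fin m → ℝ) : vd (fun i => c * v i) = c ^ m.choose 2 * vd v := by
  induction m with
  | zero => simp [vd]
  | succ m ih =>
    have h : (∏ i : Fin m, (c * v (Fin.last m) - c * v i.castSucc))
        = c ^ m * ∏ i : Fin m, (v (Fin.last m) - v i.castSucc) := by
      simp only [← mul_sub, Finset.prod_mul_distrib, Finset.prod_const, Finset.card_univ,
        Fintype.card_fin]
    rw [vd_succ, vd_succ v, ih, h, Nat.choose_succ_succ' m 1, Nat.choose_one_right, pow_add]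
    ring

/-- One more zero part raises every shifted part by one and appends the point `0`, where `t ^ 0 =
1`; the pairs with that point give the extra factors. -/
lemma vd_shift_succ (t : ℝ) {m : ℕ} {μ : ℕ → ℕ} (hμ : μ m = 0) :
    vd (fun i => t ^ shiftFin (m + 1) μ i)
      = t ^ m.choose 2 * vd (fun i => t ^ shiftFin m μ i)
        * ∏ i : Fin m, (1 - t ^ (shiftFin m μ i + 1)) := by
  have h : ∀ i : Fin m, shiftFin (m + 1) μ i.castSucc = shiftFin m μ i + 1 := fun i => by
    simp only [shiftFin, Fin.val_castSucc]; omega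
  have h0 : shiftFin (m + 1) μ (Fin.last m) = 0 := by simp [shiftFin, hμ]
  rw [vd_succ, ← vd_smul]
  simp only [h, h0, pow_zero, pow_succ']

lemma qPoch_succ (t : ℝ) (l : ℕ) : qPoch t (l + 1) = qPoch t l * (1 - t ^ (l + 1)) := by
  rw [qPoch, Finset.prod_Icc_succ_top (by omega)]
  rfl

lemma qPoch_ne_zero {t : ℝ} (ht : 0 < t) (ht1 : t ≠ 1) (l : ℕ) : qPoch t l ≠ 0 := by
  rw [qPoch, Finset.prod_ne_zero_iff]
  intro m hm
  rw [Finset.mem_Icc] at hm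
  rw [sub_ne_zero]
  intro h
  exact ht1 ((pow_eq_one_iff_of_nonneg ht.le (by omega)).1 h.symm)

lemma prod_Icc_one {M : Type*} [CommMonoid M] (f : ℕ → M) (n : ℕ) :
    ∏ i ∈ Finset.Icc 1 n, f i = ∏ i : Fin n, f (i + 1) := by
  induction n with
  | zero => simp
  | succ n ih => rw [Finset.prod_Icc_succ_top (by omega), ih, Fin.prod_univ_castSucc]; simp

/-- The principal Vandermonde product. -/
lemma vd_principal (t : ℝ) (m : ℕ) :
    vd (fun i : Fin m => t ^ (m - 1 - (i : ℕ)))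
      = t ^ m.choose 3 * ∏ l ∈ Finset.range m, qPoch t l := by
  induction m with
  | zero => simp [vd]
  | succ m ih =>
    have h := vd_shift_succ t (m := m) (μ := fun _ => 0) rfl
    simp only [shiftFin, zero_add] at h
    have h2 : ∏ i : Fin m, (1 - t ^ (m - 1 - (i : ℕ) + 1)) = qPoch t m := by
      rw [qPoch, prod_Icc_one, ← Equiv.prod_comp Fin.revPerm]
      refine Finset.prod_congr rfl fun i _ => ?_
      rw [Fin.revPerm_apply, Fin.val_rev]
      congr 3
      omega
    rw [h, ih, h2, Finset.prod_range_succ, Nat.choose_succ_succ' m 2, pow_add]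
    ring

/-- Adding variables to a principal specialization. -/
lemma vd_ratio {t : ℝ} (ht : 0 < t) (ht1 : t ≠ 1) {m : ℕ} {μ : ℕ → ℕ}
    (hμ : ∀ r, m ≤ r → μ r = 0) (d : ℕ) :
    vd (fun i => t ^ shiftFin (m + d) μ i) / vd (fun i : Fin (m + d) => t ^ (m + d - 1 - (i : ℕ)))
      = vd (fun i => t ^ shiftFin m μ i) / vd (fun i : Fin m => t ^ (m - 1 - (i : ℕ)))
        * ((∏ i : Fin m, qPoch t (shiftFin m μ i + d) / qPoch t (shiftFin m μ i))
          / ∏ i : Fin m, qPoch t (m - 1 - i + d) / qPoch t (m - 1 - i)) := by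
  have hq := qPoch_ne_zero ht ht1
  induction d with
  | zero =>
    have h1 : ∀ f : Fin m → ℕ, ∏ i : Fin m, qPoch t (f i + 0) / qPoch t (f i) = 1 := fun f =>
      Finset.prod_eq_one fun i _ => by rw [add_zero, div_self (hq _)]
    rw [h1, h1 fun i => m - 1 - i]
    simp
  | succ d ih =>
    have h1 := vd_shift_succ t (hμ (m + d) (by omega))
    have h2 := vd_shift_succ t (m := m + d) (μ := fun _ => 0) rfl
    -- The new factors split into those of the `m` genuine rows, which extend the q-Pochhammer
    -- ratios, and those of the `d` zero rows, which are the same for `μ` and for the empty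
    -- partition and cancel.
    have h3 : ∀ ν : ℕ → ℕ, (∀ r, m ≤ r → ν r = 0) →
        ∏ i : Fin (m + d), (1 - t ^ (shiftFin (m + d) ν i + 1))
        = (∏ i : Fin m, (1 - t ^ (shiftFin m ν i + d + 1)))
          * ∏ i : Fin d, (1 - t ^ (d - 1 - (i : ℕ) + 1)) := by
      intro ν hν
      rw [Fin.prod_univ_add]
      congr 1
      · refine Finset.prod_congr rfl fun i _ => ?_
        simp only [shiftFin, Fin.val_castAdd]
        congr 3
        omega
      · refine Finset.prod_congr rfl fun i _ => ?_
        simp only [shiftFin, Fin.val_natAdd]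
        rw [hν _ (by omega)]
        congr 3
        omega
    have h4 : ∀ f : Fin m → ℕ, ∏ i : Fin m, qPoch t (f i + (d + 1)) / qPoch t (f i)
        = (∏ i : Fin m, qPoch t (f i + d) / qPoch t (f i)) * ∏ i : Fin m, (1 - t ^ (f i + d + 1)) := by
      intro f
      rw [← Finset.prod_mul_distrib]
      refine Finset.prod_congr rfl fun i _ => ?_
      rw [← add_assoc, qPoch_succ]
      ring
    rw [h3 _ hμ] at h1
    rw [h3 _ fun _ _ => rfl] at h2
    simp only [shiftFin, zero_add] at h2
    have hD : ∏ i : Fin d, (1 - t ^ (d - 1 - (i : ℕ) + 1)) ≠ 0 := by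
      rw [Finset.prod_ne_zero_iff]
      intro i _
      rw [sub_ne_zero]
      intro h
      exact ht1 ((pow_eq_one_iff_of_nonneg ht.le (by omega)).1 h.symm)
    rw [h4, h4 fun i => m - 1 - i]
    change vd (fun i => t ^ shiftFin (m + d + 1) μ i)
      / vd (fun i : Fin (m + d + 1) => t ^ (m + d + 1 - 1 - (i : ℕ))) = _
    rw [h1, h2]
    rw [mul_div_mul_comm, mul_div_mul_comm, ih, mul_div_mul_comm, mul_div_mul_comm,
      div_self (pow_ne_zero _ ht.ne'), div_self hD]
    ring

end RSKJacobi

/-! ### Powers of `z`, `α`, `t` and the normalising constant -/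

namespace RSKJacobi

open scoped ENNReal Classical

lemma sum_Icc_one {M : Type*} [AddCommMonoid M] (f : ℕ → M) (n : ℕ) :
    ∑ i ∈ Finset.Icc 1 n, f i = ∑ i ∈ Finset.range n, f (i + 1) := by
  induction n with
  | zero => simp
  | succ n ih => rw [Finset.sum_Icc_succ_top (by omega), ih, Finset.sum_range_succ]

lemma sum_range_cast (n : ℕ) : ∑ i ∈ Finset.range n, (i : ℤ) = n.choose 2 := by
  rw [← Nat.cast_sum, Finset.sum_range_id, Nat.choose_two_right]

lemma sum_exponent (n : ℕ) :
    ∑ j ∈ Finset.Icc 1 n, ((j : ℤ) - 1) * ((n : ℤ) + 1 - j) = (n + 1).choose 3 := by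
  rw [sum_Icc_one]
  induction n with
  | zero => rfl
  | succ n ih =>
    have h : ∀ i : ℕ, (((i + 1 : ℕ) : ℤ) - 1) * (((n + 1 : ℕ) : ℤ) + 1 - ((i + 1 : ℕ) : ℤ))
        = (((i + 1 : ℕ) : ℤ) - 1) * ((n : ℤ) + 1 - ((i + 1 : ℕ) : ℤ)) + i := fun i => by
      push_cast; ring
    rw [Finset.sum_congr rfl fun i _ => h i, Finset.sum_add_distrib, sum_range_cast,
      Finset.sum_range_succ, ih, Nat.choose_succ_succ' (n + 1) 2]
    push_cast
    ring

/-- The exponent of `t` in the constant of the joint probability does not depend on `n₁`. -/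
lemma exponent_eq (n d : ℕ) :
    -(∑ j ∈ Finset.Icc 1 d, (j : ℤ) * ((j : ℤ) - 1))
      + -((n : ℤ) + 1) * ∑ j ∈ Finset.Icc 1 d, (j : ℤ)
      + -(∑ j ∈ Finset.Icc 1 (n + 1 + d), ((j : ℤ) - 1) * ((n : ℤ) + 1 - j))
    = -((n + 1).choose 3 : ℤ) := by
  induction d with
  | zero =>
    have := sum_exponent n
    simp only [add_zero, Finset.Icc_eq_empty_of_lt Nat.zero_lt_one, Finset.sum_empty, mul_zero,
      neg_zero, zero_add, neg_inj]
    rw [Finset.sum_Icc_succ_top (by omega), this]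
    push_cast
    ring
  | succ d ih =>
    rw [← ih, ← add_assoc, Finset.sum_Icc_succ_top (by omega), Finset.sum_Icc_succ_top (by omega),
      Finset.sum_Icc_succ_top (by omega)]
    push_cast
    ring

/-- The index `0` may be added because `(t; t)_0 = 1`, and truncated subtraction makes this valid
for `n = 0` too. -/
lemma prod_qPoch_Icc (t : ℝ) (n : ℕ) :
    ∏ l ∈ Finset.Icc 1 (n - 1), qPoch t l = ∏ l ∈ Finset.range n, qPoch t l := by
  cases n with
  | zero => simp
  | succ n =>
    rw [Finset.prod_range_succ', prod_Icc_one, Fin.prod_univ_eq_prod_range (fun i => qPoch t (i + 1))]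
    simp [qPoch]

lemma prod_qPoch_div {t : ℝ} (n d : ℕ) (hq : ∀ l, qPoch t l ≠ 0) :
    (∏ i : Fin (n + 1), qPoch t (n + 1 - 1 - i + d) / qPoch t (n + 1 - 1 - i))
      = (∏ l ∈ Finset.range (n + 1 + d), qPoch t l) / (∏ l ∈ Finset.range d, qPoch t l)
        / ∏ l ∈ Finset.range (n + 1), qPoch t l := by
  rw [Finset.prod_div_distrib]
  have r1 : ∏ i : Fin (n + 1), qPoch t (n + 1 - 1 - i)
      = ∏ l ∈ Finset.range (n + 1), qPoch t l := by
    rw [Fin.prod_univ_eq_prod_range (fun i => qPoch t (n + 1 - 1 - i)),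
      Finset.prod_range_reflect]
  have r2 : ∏ i : Fin (n + 1), qPoch t (n + 1 - 1 - i + d)
      = ∏ l ∈ Finset.range (n + 1), qPoch t (d + l) := by
    rw [Fin.prod_univ_eq_prod_range (fun i => qPoch t (n + 1 - 1 - i + d)),
      Finset.prod_range_reflect (fun i => qPoch t (i + d))]
    simp only [add_comm]
  rw [r1, r2, add_comm (n + 1) d, Finset.prod_range_add _ d (n + 1), mul_div_cancel_left₀]
  exact Finset.prod_ne_zero_iff.2 fun l _ => hq l

/-- The staircase shifts in `h` and `r` cancel against the power of `z` in `K`; what is left is `α ^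
|μ/κ|` times `z ^ (|μ| + |κ|)`, and `|μ| + |κ| = |μ/κ| + 2 |κ|`. -/
lemma zpow_shift {n₂ d : ℕ} {z α : ℝ} (hz : 0 < z) (hα : 0 < α) {μ κ : YoungDiagram}
    (hμ : ∀ r, n₂ + 1 ≤ r → μ.rowLen r = 0) (hκ : ∀ r, n₂ ≤ r → κ.rowLen r = 0)
    (hI : Inter κ.rowLen μ.rowLen) :
    z ^ (-2 * ∑ j ∈ Finset.Icc 1 n₂, ((n₂ : ℤ) + 1 - (j : ℤ)))
        * z ^ (∑ j : Fin n₂, (shiftMu n₂ μ j.castSucc + shiftKappa n₂ κ j))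
        * α ^ (∑ j : Fin n₂, ((shiftMu n₂ μ j.castSucc : ℤ) - (shiftKappa n₂ κ j : ℤ)))
        * (z * α) ^ shiftMu n₂ μ (Fin.last n₂)
      = (α * z) ^ skewSize (n₂ + 1 + d + 1) μ.rowLen κ.rowLen
        * (z ^ 2) ^ (∑ i : Fin n₂, κ.rowLen i) := by
  have hsk : (skewSize (n₂ + 1 + d + 1) μ.rowLen κ.rowLen : ℤ)
      = (∑ i : Fin n₂, (μ.rowLen i : ℤ)) + μ.rowLen n₂ - ∑ i : Fin n₂, (κ.rowLen i : ℤ) := by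
    have h1 := sum_range_of_support (N := n₂ + 1 + d + 1) (by omega) hμ
    have h2 := sum_range_of_support (N := n₂ + 1 + d + 1) (by omega) hκ
    have h3 : skewSize (n₂ + 1 + d + 1) μ.rowLen κ.rowLen
        + ∑ r ∈ Finset.range (n₂ + 1 + d + 1), κ.rowLen r
        = ∑ r ∈ Finset.range (n₂ + 1 + d + 1), μ.rowLen r := by
      rw [skewSize, ← Finset.sum_add_distrib]
      exact Finset.sum_congr rfl fun r _ => by have := hI r; omega
    rw [h1, h2, Fin.sum_univ_castSucc] at h3
    have h4 : ((skewSize (n₂ + 1 + d + 1) μ.rowLen κ.rowLen + ∑ i : Fin n₂, κ.rowLen i : ℕ) : ℤ)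
      = ((∑ i : Fin n₂, μ.rowLen i.castSucc + μ.rowLen (Fin.last n₂) : ℕ) : ℤ) := by rw [h3]
    push_cast at h4
    simp only [Fin.val_castSucc] at h4
    linarith
  have g1 : ∑ j ∈ Finset.Icc 1 n₂, ((n₂ : ℤ) + 1 - (j : ℤ)) = ∑ j : Fin n₂, ((n₂ : ℤ) - (j : ℤ)) := by
    rw [sum_Icc_one, ← Fin.sum_univ_eq_sum_range (fun i => (n₂ : ℤ) + 1 - ((i + 1 : ℕ) : ℤ))]
    refine Finset.sum_congr rfl fun j _ => ?_
    push_cast; ring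
  have g2 : ∀ j : Fin n₂, ((n₂ - (j : ℕ) : ℕ) : ℤ) = (n₂ : ℤ) - j := fun j => by
    rw [Nat.cast_sub j.2.le]
  have g3 : ((∑ j : Fin n₂, (shiftMu n₂ μ j.castSucc + shiftKappa n₂ κ j) : ℕ) : ℤ)
      = (∑ i : Fin n₂, (μ.rowLen i : ℤ)) + (∑ i : Fin n₂, (κ.rowLen i : ℤ))
        + 2 * ∑ j : Fin n₂, ((n₂ : ℤ) - (j : ℤ)) := by
    simp only [shiftMu, shiftKappa, Fin.val_castSucc]
    push_cast
    simp only [g2, Finset.sum_add_distrib]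
    ring
  have g4 : ∑ j : Fin n₂, ((shiftMu n₂ μ j.castSucc : ℤ) - (shiftKappa n₂ κ j : ℤ))
      = (∑ i : Fin n₂, (μ.rowLen i : ℤ)) - ∑ i : Fin n₂, (κ.rowLen i : ℤ) := by
    rw [← Finset.sum_sub_distrib]
    refine Finset.sum_congr rfl fun j _ => ?_
    simp only [shiftMu, shiftKappa, Fin.val_castSucc]
    push_cast; ring
  have g5 : shiftMu n₂ μ (Fin.last n₂) = μ.rowLen n₂ := by simp [shiftMu]
  rw [g4, g5, mul_pow, mul_pow, ← pow_mul]
  simp only [← zpow_natCast z, ← zpow_natCast α]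
  rw [g3, g1, hsk]
  have e1 : ∀ a b c e f g u v : ℤ, a + b + e = f + g → c + e = u →
      z ^ a * z ^ b * α ^ c * (z ^ e * α ^ e) = α ^ u * z ^ f * z ^ g := by
    intro a b c e f g u v h1 h2
    have : z ^ a * z ^ b * α ^ c * (z ^ e * α ^ e)
        = (z ^ a * z ^ b * z ^ e) * (α ^ c * α ^ e) := by ring
    rw [this, ← zpow_add₀ hz.ne', ← zpow_add₀ hz.ne', ← zpow_add₀ hα.ne', h1, h2,
      zpow_add₀ hz.ne']
    ring
  refine e1 _ _ _ _ _ _ _ 0 ?_ ?_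
  · push_cast; ring
  · ring

/-- The last bracket collects the shift of `κ` and the two principal Vandermonde products. By
Pascal's rule its exponent is twice `(n₂ + 1).choose 3`, and the constant `K` contributes the
opposite. -/
lemma zpow_exponent {t : ℝ} (ht : t ≠ 0) (n₂ d : ℕ) :
    t ^ (-∑ j ∈ Finset.Icc 1 n₂, ((j : ℤ) - 1) * ((n₂ : ℤ) + 1 - (j : ℤ)))
      * (t ^ (-∑ j ∈ Finset.Icc 1 d, (j : ℤ) * ((j : ℤ) - 1))
      * t ^ (-((n₂ : ℤ) + 1) * ∑ j ∈ Finset.Icc 1 d, (j : ℤ))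
      * t ^ (-∑ j ∈ Finset.Icc 1 (n₂ + 1 + d), ((j : ℤ) - 1) * ((n₂ : ℤ) + 1 - (j : ℤ))))
      * (t ^ n₂.choose 2 * t ^ n₂.choose 3 * t ^ (n₂ + 1).choose 3) = 1 := by
  rw [← zpow_add₀ ht, ← zpow_add₀ ht, exponent_eq, sum_exponent, ← pow_add,
    ← Nat.choose_succ_succ' n₂ 2, zpow_neg, zpow_natCast]
  have := pow_ne_zero ((n₂ + 1).choose 3) ht
  field_simp

/-- The letters stand for q-Pochhammer products (`G`), powers of `t` (`T`, `U`), powers of `z` and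
`α` (`Z`), site products (`Q`) and Vandermonde products (`V`). -/
lemma normalization_algebra {G1 G2 G3 G4 U2 U3 U4 Z1 Z2 Z3 Z4 Z5 Z6 T1 T2 T3 T4 Q1 Q2 V1 V2 G : ℝ}
    (h2 : G2 ≠ 0) (h3 : G3 ≠ 0) (u3 : U3 ≠ 0) (u4 : U4 ≠ 0)
    (hZ : Z1 * Z2 * Z3 * Z4 = Z5 * Z6) (hT : T1 * (T2 * T3 * T4) * (U2 * U3 * U4) = 1) :
    Z1 * (T1 / G4) * T2 * T3 * (T4 / G1) * G2 * Q1 * Q2 * Z2 * Z3 * Z4 * G * V1 * (U2 * V2)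
      = Q1 * Q2 * (Z5 * (1 * (V1 / (U4 * G3) * (G / (G1 / G2 / G3)))) * (Z6 * (V2 / (U3 * G4)))) := by
  have e1 : V1 / (U4 * G3) * (G / (G1 / G2 / G3)) = V1 * G * G2 * U4⁻¹ * G1⁻¹ := by
    field_simp
  have e2 : T1 * T2 * T3 * T4 * U2 = U3⁻¹ * U4⁻¹ := by
    rw [← mul_inv, ← mul_right_inj' (mul_ne_zero u3 u4), mul_inv_cancel₀ (mul_ne_zero u3 u4), ← hT]
    ring
  have e3 : Z1 * (T1 / G4) * T2 * T3 * (T4 / G1) * G2 * Q1 * Q2 * Z2 * Z3 * Z4 * G * V1 * (U2 * V2)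
      = (Z1 * Z2 * Z3 * Z4) * (T1 * T2 * T3 * T4 * U2)
        * (Q1 * Q2 * G * V1 * V2 * G2 * G4⁻¹ * G1⁻¹) := by
    ring
  rw [e3, hZ, e1, e2]
  ring

/-- The probability density in terms of normalized Vandermonde products. -/
lemma probFormula_eq {n₁ n₂ : ℕ} (hn : n₂ < n₁) {z α t : ℝ} (hz : 0 < z) (hα : 0 < α)
    (ht : 0 < t) (ht1 : t ≠ 1) {μ κ : YoungDiagram} (hμ : μ.colLen 0 ≤ n₂ + 1)
    (hκ : κ.colLen 0 ≤ n₂) (hI : Inter κ.rowLen μ.rowLen) :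
    probFormula n₁ n₂ α z t (shiftMu n₂ μ) (shiftKappa n₂ κ)
      = (∏ i : Fin n₁, ∏ j : Fin (n₂ + 1), (1 - siteParam z α t i j))
        * ((α * z) ^ skewSize (n₁ + 1) μ.rowLen κ.rowLen
        * (1 ^ (∑ i : Fin n₁, μ.rowLen i) * (vd (fun i => t ^ shiftFin n₁ μ.rowLen i)
          / vd fun i : Fin n₁ => t ^ (n₁ - 1 - (i : ℕ))))
        * ((z ^ 2) ^ (∑ i : Fin n₂, κ.rowLen i) * (vd (fun i => t ^ shiftFin n₂ κ.rowLen i)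
          / vd fun i : Fin n₂ => t ^ (n₂ - 1 - (i : ℕ))))) := by
  rw [colLen_zero_le_iff] at hμ hκ
  obtain ⟨d, rfl⟩ : ∃ d, n₁ = n₂ + 1 + d := ⟨n₁ - (n₂ + 1), by omega⟩
  have hq := qPoch_ne_zero ht ht1
  have ed : n₂ + 1 + d - (n₂ + 1) = d := by omega
  have ed1 : n₂ + 1 + d - n₂ - 1 = d := by omega
  -- For `d = 0` both sides truncate to `0`, so the corresponding product is empty.
  have ed2 : n₂ + 1 + d - n₂ - 2 = d - 1 := by omega
  -- the Vandermonde products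
  have hκv : vd (fun i => t ^ shiftKappa n₂ κ i)
      = t ^ n₂.choose 2 * vd (fun i => t ^ shiftFin n₂ κ.rowLen i) := by
    rw [← vd_smul]
    congr 1
    funext i
    rw [← pow_succ']
    congr 1
    simp only [shiftKappa, shiftFin]
    omega
  have hμv : shiftMu n₂ μ = shiftFin (n₂ + 1) μ.rowLen := rfl
  have hP := prod_qPoch_div n₂ d hq
  -- the parameters
  have hS : (∏ i : Fin (n₂ + 1 + d), ∏ j : Fin (n₂ + 1), (1 - siteParam z α t i j))
      = (∏ i ∈ Finset.Icc 1 (n₂ + 1 + d), ∏ j ∈ Finset.Icc 1 n₂, (1 - z ^ 2 * t ^ (i + j - 2)))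
        * ∏ i ∈ Finset.Icc 1 (n₂ + 1 + d), (1 - α * z * t ^ (i - 1)) := by
    simp only [prod_Icc_one]
    rw [← Finset.prod_mul_distrib]
    refine Finset.prod_congr rfl fun i _ => ?_
    rw [Fin.prod_univ_castSucc]
    congr 1
    · refine Finset.prod_congr rfl fun j _ => ?_
      rw [siteParam, if_neg (Fin.castSucc_ne_last j)]
      congr 3
      simp only [Fin.val_castSucc]
      omega
    · simp [siteParam]
  have hpow := zpow_shift (d := d) hz hα hμ hκ hI
  have hexp := zpow_exponent ht.ne' n₂ d
  have hR := vd_ratio ht ht1 hμ d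
  have hne : ∀ m, ∏ l ∈ Finset.range m, qPoch t l ≠ 0 := fun m =>
    Finset.prod_ne_zero_iff.2 fun l _ => hq l
  rw [hR, hP, hS]
  simp only [probFormula, K]
  rw [ed, ed1, ed2]
  simp only [prod_qPoch_Icc]
  have v1 : ∏ i, ∏ j ∈ Finset.Ioi i, (t ^ shiftMu n₂ μ j - t ^ shiftMu n₂ μ i)
      = vd fun i => t ^ shiftFin (n₂ + 1) μ.rowLen i := rfl
  have v2 : ∏ i, ∏ j ∈ Finset.Ioi i, (t ^ shiftKappa n₂ κ j - t ^ shiftKappa n₂ κ i)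
      = vd fun i => t ^ shiftKappa n₂ κ i := rfl
  have v3 := vd_principal t (n₂ + 1)
  have v4 := vd_principal t n₂
  rw [v1, v2, hκv, v3, v4, ← hμv]
  rw [one_pow]
  exact normalization_algebra (hne _) (hne _) (pow_ne_zero _ ht.ne')
    (pow_ne_zero _ ht.ne') hpow hexp

/-- The joint probability of the shapes: support and explicit form. -/
theorem jointProb_eq {n₁ n₂ : ℕ} (hn : n₂ < n₁) {Ω : Type*} [MeasurableSpace Ω] {P : Measure Ω}
    [IsProbabilityMeasure P] {z α t : ℝ} (hz : 0 < z) (hα : 0 < α) (ht : 0 < t) (ht1 : t ≠ 1)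
    (hq : ∀ (i : Fin n₁) (j : Fin (n₂ + 1)), siteParam z α t i j < 1)
    {X : Fin n₁ → Fin (n₂ + 1) → Ω → ℕ} (hX : HasSiteLaw P X z α t) (μ κ : YoungDiagram) :
    (jointProb P X μ κ ≠ 0 ↔ μ.colLen 0 ≤ n₂ + 1 ∧ κ.colLen 0 ≤ n₂ ∧
        Interlaced (shiftMu n₂ μ) (shiftKappa n₂ κ)) ∧
    (μ.colLen 0 ≤ n₂ + 1 → κ.colLen 0 ≤ n₂ → Interlaced (shiftMu n₂ μ) (shiftKappa n₂ κ) →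
      jointProb P X μ κ = probFormula n₁ n₂ α z t (shiftMu n₂ μ) (shiftKappa n₂ κ)) := by
  have hM := measure_shapes hz hα ht hq hX μ κ n₁ hn.le
  have hpos : 0 < ∏ i : Fin n₁, ∏ j : Fin (n₂ + 1), (1 - siteParam z α t i j) :=
    Finset.prod_pos fun i _ => Finset.prod_pos fun j _ => one_sub_siteParam_pos hq i j
  have main : μ.colLen 0 ≤ n₂ + 1 → κ.colLen 0 ≤ n₂ →
      Interlaced (shiftMu n₂ μ) (shiftKappa n₂ κ) →
      jointProb P X μ κ = probFormula n₁ n₂ α z t (shiftMu n₂ μ) (shiftKappa n₂ κ) ∧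
        jointProb P X μ κ ≠ 0 := by
    intro hμ hκ hI
    rw [interlaced_iff hμ hκ] at hI
    have hμ' := (colLen_zero_le_iff μ _).1 hμ
    have hκ' := (colLen_zero_le_iff κ _).1 hκ
    obtain ⟨s1, s2⟩ := schur_eq one_pos ht ht1 (N := n₁ + 1) (m := n₁) (by omega)
      (fun r hr => hμ' r (by omega)) fun i => μ.rowLen_anti i (i + 1) (by omega)
    obtain ⟨s3, s4⟩ := schur_eq (s := z ^ 2) (by positivity) ht ht1 (N := n₁ + 1) (m := n₂)
      (by omega) hκ' fun i => κ.rowLen_anti i (i + 1) (by omega)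
    have haz : 0 < (α * z) ^ skewSize (n₁ + 1) μ.rowLen κ.rowLen := by positivity
    rw [jointProb, measureReal_def, hM, if_pos hI, s1, s3, ← ENNReal.ofReal_pow (by positivity),
      ← ENNReal.ofReal_mul haz.le, ← ENNReal.ofReal_mul (mul_pos haz s2).le,
      ← ENNReal.ofReal_mul hpos.le,
      ENNReal.toReal_ofReal (mul_pos hpos (mul_pos (mul_pos haz s2) s4)).le,
      probFormula_eq hn hz hα ht ht1 hμ hκ hI]
    exact ⟨rfl, (mul_pos hpos (mul_pos (mul_pos haz s2) s4)).ne'⟩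
  -- Conversely, a nonzero probability makes every factor nonzero: the Schur function bounds the
  -- rows of `κ`, the strip condition holds, and together they bound the rows of `μ`.
  refine ⟨⟨fun h => ?_, fun h => (main h.1 h.2.1 h.2.2).2⟩, fun h1 h2 h3 => (main h1 h2 h3).1⟩
  have h1 : P {ω | GivesShape (config X ω) μ ∧ GivesShape (subconfig X ω) κ} ≠ 0 := by
    intro h0
    exact h (by rw [jointProb, measureReal_def, h0, ENNReal.toReal_zero])
  rw [hM] at h1
  have h2 := right_ne_zero_of_mul h1
  have h3 := (schur_support (right_ne_zero_of_mul h2)).1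
  have h4 := left_ne_zero_of_mul (left_ne_zero_of_mul h2)
  have hI : Inter κ.rowLen μ.rowLen := by
    by_contra h'
    exact h4 (if_neg h')
  have hκ := (colLen_zero_le_iff κ n₂).2 h3
  have hμ : μ.colLen 0 ≤ n₂ + 1 := by
    rw [colLen_zero_le_iff]
    intro r hr
    have h5 := (hI (r - 1)).1
    rw [Nat.sub_add_cancel (by omega), h3 (r - 1) (by omega)] at h5
    omega
  exact ⟨hμ, hκ, (interlaced_iff hμ hκ).2 hI⟩

end RSKJacobi

namespace RSKJacobi

/-! ### The Jacobi limit -/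

/-- This is the derivative of `1 - exp (-c x)` at `0`, taken along `x = 1 / L`. -/
lemma tendsto_mul_one_sub_exp (c : ℝ) :
    Tendsto (fun L : ℝ => L * (1 - Real.exp (-c / L))) atTop (𝓝 c) := by
  have h1 : HasDerivAt (fun x : ℝ => 1 - Real.exp (-c * x)) c 0 := by
    have := ((((hasDerivAt_id (0 : ℝ)).const_mul (-c)).exp).const_sub 1)
    simpa using this
  have h2 := h1.tendsto_slope_zero_right
  have h3 := h2.comp tendsto_inv_atTop_nhdsGT_zero
  refine h3.congr fun L => ?_
  simp [div_eq_mul_inv]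

lemma tendsto_qPoch (l : ℕ) :
    Tendsto (fun L : ℝ => L ^ l * qPoch (Real.exp (-1 / L)) l) atTop (𝓝 (l.factorial : ℝ)) := by
  have h : ∀ L : ℝ, L ^ l * qPoch (Real.exp (-1 / L)) l
      = ∏ m ∈ Finset.Icc 1 l, L * (1 - Real.exp (-(m : ℝ) / L)) := fun L => by
    rw [Finset.prod_mul_distrib, Finset.prod_const, Nat.card_Icc, Nat.add_sub_cancel, qPoch]
    congr 1
    refine Finset.prod_congr rfl fun m _ => ?_
    rw [← Real.exp_nat_mul]
    congr 2
    ring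
  simp only [h]
  rw [← Finset.prod_Ico_id_eq_factorial, Nat.cast_prod, Finset.Ico_add_one_right_eq_Icc]
  exact tendsto_finsetProd _ fun m _ => tendsto_mul_one_sub_exp m

lemma tendsto_prod_qPoch (n : ℕ) :
    Tendsto (fun L : ℝ => L ^ (∑ l ∈ Finset.Icc 1 n, l)
      * ∏ l ∈ Finset.Icc 1 n, qPoch (Real.exp (-1 / L)) l) atTop
      (𝓝 (∏ l ∈ Finset.Icc 1 n, (l.factorial : ℝ))) := by
  simp only [← Finset.prod_pow_eq_pow_sum, ← Finset.prod_mul_distrib]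
  exact tendsto_finsetProd _ fun m _ => tendsto_qPoch m

lemma tendsto_exp_pow {c : ℝ} {k : ℝ → ℕ} {x : ℝ}
    (h : Tendsto (fun L => (k L : ℝ) / L) atTop (𝓝 x)) :
    Tendsto (fun L => Real.exp (-c / L) ^ k L) atTop (𝓝 (Real.exp (-c * x))) := by
  have h1 : ∀ L : ℝ, Real.exp (-c / L) ^ k L = Real.exp (-c * ((k L : ℝ) / L)) := fun L => by
    rw [← Real.exp_nat_mul]
    congr 1
    ring
  simp only [h1]
  exact (Real.continuous_exp.tendsto _).comp (h.const_mul _)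

lemma tendsto_exp_zpow {c : ℝ} {k : ℝ → ℤ} {x : ℝ}
    (h : Tendsto (fun L => (k L : ℝ) / L) atTop (𝓝 x)) :
    Tendsto (fun L => Real.exp (-c / L) ^ k L) atTop (𝓝 (Real.exp (-c * x))) := by
  have h1 : ∀ L : ℝ, Real.exp (-c / L) ^ k L = Real.exp (-c * ((k L : ℝ) / L)) := fun L => by
    rw [← Real.rpow_intCast, ← Real.exp_mul]
    congr 1
    ring
  simp only [h1]
  exact (Real.continuous_exp.tendsto _).comp (h.const_mul _)

lemma tendsto_exp_zpow_const (c : ℝ) (k : ℤ) :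
    Tendsto (fun L => Real.exp (-c / L) ^ k) atTop (𝓝 1) := by
  have : Tendsto (fun L : ℝ => (k : ℝ) / L) atTop (𝓝 0) := tendsto_const_nhds.div_atTop tendsto_id
  simpa using tendsto_exp_zpow (c := c) this

/-- The ratio has `d` factors whatever `l` is, so its limit can be taken while `l` grows with `L`.
-/
lemma qPoch_add_div {t : ℝ} (ht : 0 < t) (ht1 : t ≠ 1) (l d : ℕ) :
    qPoch t (l + d) / qPoch t l = ∏ m ∈ Finset.range d, (1 - t ^ l * t ^ (m + 1)) := by
  induction d with
  | zero => simp [qPoch_ne_zero ht ht1]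
  | succ d ih =>
    rw [Finset.prod_range_succ, ← ih, ← add_assoc, qPoch_succ, add_assoc, pow_add]
    ring

lemma tendsto_qPoch_div {k : ℝ → ℕ} {x : ℝ} (h : Tendsto (fun L => (k L : ℝ) / L) atTop (𝓝 x))
    (d : ℕ) :
    Tendsto (fun L => qPoch (Real.exp (-1 / L)) (k L + d) / qPoch (Real.exp (-1 / L)) (k L)) atTop
      (𝓝 ((1 - Real.exp (-x)) ^ d)) := by
  have h1 : ∀ᶠ L : ℝ in atTop,
      ∏ m ∈ Finset.range d, (1 - Real.exp (-1 / L) ^ k L * Real.exp (-1 / L) ^ (m + 1))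
      = qPoch (Real.exp (-1 / L)) (k L + d) / qPoch (Real.exp (-1 / L)) (k L) := by
    filter_upwards [eventually_gt_atTop 0] with L hL
    rw [qPoch_add_div (Real.exp_pos _)]
    rw [Ne, Real.exp_eq_one_iff]
    exact div_ne_zero (by norm_num) hL.ne'
  refine Tendsto.congr' h1 ?_
  have h2 : (1 - Real.exp (-x)) ^ d = ∏ m ∈ Finset.range d, (1 - Real.exp (-x) * 1) := by simp
  rw [h2]
  refine tendsto_finsetProd _ fun m _ => Tendsto.const_sub _ (Tendsto.mul ?_ ?_)
  · simpa using tendsto_exp_pow (c := 1) h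
  · exact_mod_cast tendsto_exp_zpow_const 1 (m + 1 : ℕ)

lemma gamma_add_div {s : ℝ} (hs : 0 < s) (n : ℕ) :
    Real.Gamma (s + n) / Real.Gamma s = ∏ i ∈ Finset.Icc 1 n, (s + (i - 1 : ℕ)) := by
  induction n with
  | zero => simp [(Real.Gamma_pos_of_pos hs).ne']
  | succ n ih =>
    have h : s + ((n + 1 : ℕ) : ℝ) = (s + n) + 1 := by push_cast; ring
    rw [Finset.prod_Icc_succ_top (by omega), ← ih, h, Real.Gamma_add_one (by positivity)]
    simp
    ring

lemma prod_gamma_div {a : ℝ} (ha : 0 < a) (n₁ n : ℕ) :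
    ∏ i ∈ Finset.Icc 1 n₁,
      Real.Gamma (2 * a + (i : ℝ) + (n : ℝ) - 1) / Real.Gamma (2 * a + (i : ℝ) - 1)
    = ∏ i ∈ Finset.Icc 1 n₁, ∏ j ∈ Finset.Icc 1 n, (2 * a + (i + j - 2 : ℕ)) := by
  refine Finset.prod_congr rfl fun i hi => ?_
  have hi1 : (1 : ℝ) ≤ i := by exact_mod_cast (Finset.mem_Icc.1 hi).1
  have h : 2 * a + (i : ℝ) + n - 1 = (2 * a + (i : ℝ) - 1) + n := by ring
  rw [h, gamma_add_div (by linarith)]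
  refine Finset.prod_congr rfl fun j hj => ?_
  have hi2 := (Finset.mem_Icc.1 hi).1
  have hj2 := (Finset.mem_Icc.1 hj).1
  rw [Nat.cast_sub hj2, Nat.cast_sub (by omega)]
  push_cast
  ring

/-- Power counting: `(t; t)_l` is of order `L ^ (-l)` and each site factor of order `L ^ (-1)`. The
excess of numerator over denominator in `K` is the number `2 n + 1` of coordinates. -/
lemma degree_identity (n d : ℕ) :
    2 * n + 1 + (∑ l ∈ Finset.Icc 1 (n - 1), l + ∑ l ∈ Finset.Icc 1 (n + 1 + d - 1), l)
      = ∑ l ∈ Finset.Icc 1 (d - 1), l + (n + 1 + d) * n + (n + 1 + d) := by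
  have h : ∀ m, ∑ l ∈ Finset.Icc 1 (m - 1), l = ∑ l ∈ Finset.range m, l := fun m => by
    cases m with
    | zero => simp
    | succ m => rw [sum_Icc_one, Finset.sum_range_succ']; simp
  rw [h, h, h]
  induction d with
  | zero =>
    have := Finset.sum_range_id_mul_two n
    rcases n with _ | n
    · simp
    · simp only [Finset.sum_range_succ, Nat.add_sub_cancel] at this ⊢
      simp
      nlinarith
  | succ d ih =>
    rw [← add_assoc (n + 1) d 1, Finset.sum_range_succ _ (n + 1 + d), Finset.sum_range_succ _ d]
    linarith

/-- The rescaled joint probability converges to the density. -/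
theorem tendsto_probFormula {n₁ n₂ : ℕ} (hn : n₂ < n₁) {a a₁ : ℝ} (ha : 0 < a) (ha₁ : 0 < a + a₁)
    {x : Fin (n₂ + 1) → ℝ} {y : Fin n₂ → ℝ} {h : ℝ → Fin (n₂ + 1) → ℕ} {r : ℝ → Fin n₂ → ℕ}
    (hh : ∀ j, Tendsto (fun L => (h L j : ℝ) / L) atTop (𝓝 (x j)))
    (hr : ∀ j, Tendsto (fun L => (r L j : ℝ) / L) atTop (𝓝 (y j))) :
    Tendsto (fun L : ℝ => L ^ (2 * n₂ + 1) *
        probFormula n₁ n₂ (Real.exp (-a₁ / L)) (Real.exp (-a / L)) (Real.exp (-1 / L)) (h L) (r L))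
      atTop (𝓝 (jacobiDensity n₁ n₂ a a₁ x y)) := by
  obtain ⟨d, rfl⟩ : ∃ d, n₁ = n₂ + 1 + d := ⟨n₁ - (n₂ + 1), by omega⟩
  have ed : n₂ + 1 + d - (n₂ + 1) = d := by omega
  have ed2 : n₂ + 1 + d - n₂ - 2 = d - 1 := by omega
  have hKt : Ktilde (n₂ + 1 + d) n₂ a a₁
      = (∏ l ∈ Finset.Icc 1 (d - 1), (l.factorial : ℝ))
        / ((∏ l ∈ Finset.Icc 1 (n₂ - 1), (l.factorial : ℝ))
          * ∏ l ∈ Finset.Icc 1 (n₂ + 1 + d - 1), (l.factorial : ℝ))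
        * (∏ i ∈ Finset.Icc 1 (n₂ + 1 + d), ∏ j ∈ Finset.Icc 1 n₂, (2 * a + (i + j - 2 : ℕ)))
        * ∏ i ∈ Finset.Icc 1 (n₂ + 1 + d), (a + a₁ + (i - 1 : ℕ)) := by
    rw [Ktilde, prod_gamma_div ha, gamma_add_div ha₁, ed2]
    ring
  -- the constant
  have hK : Tendsto (fun L : ℝ => L ^ (2 * n₂ + 1) *
      K (n₂ + 1 + d) n₂ (Real.exp (-a₁ / L)) (Real.exp (-a / L)) (Real.exp (-1 / L))) atTop
      (𝓝 (Ktilde (n₂ + 1 + d) n₂ a a₁)) := by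
    set E : ℤ := -2 * ∑ j ∈ Finset.Icc 1 n₂, ((n₂ : ℤ) + 1 - (j : ℤ))
    set e1 : ℤ := -∑ j ∈ Finset.Icc 1 n₂, ((j : ℤ) - 1) * ((n₂ : ℤ) + 1 - (j : ℤ))
    set e2 : ℤ := -∑ j ∈ Finset.Icc 1 (n₂ + 1 + d - n₂ - 1), (j : ℤ) * ((j : ℤ) - 1)
    set e3 : ℤ := -((n₂ : ℤ) + 1) * ∑ j ∈ Finset.Icc 1 (n₂ + 1 + d - n₂ - 1), (j : ℤ)
    set e4 : ℤ := -∑ j ∈ Finset.Icc 1 (n₂ + 1 + d), ((j : ℤ) - 1) * ((n₂ : ℤ) + 1 - (j : ℤ))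
    -- The power of `L` is distributed so that each factor has a limit: `L` for each site factor, `L
    -- ^ l` for each `(t; t)_l`. The five powers with fixed exponents tend to `1`.
    have h1 : ∀ᶠ L : ℝ in atTop,
        Real.exp (-a / L) ^ E * Real.exp (-1 / L) ^ e1 * Real.exp (-1 / L) ^ e2
          * Real.exp (-1 / L) ^ e3 * Real.exp (-1 / L) ^ e4
        * ((L ^ (∑ l ∈ Finset.Icc 1 (d - 1), l)
            * ∏ l ∈ Finset.Icc 1 (d - 1), qPoch (Real.exp (-1 / L)) l)
          / ((L ^ (∑ l ∈ Finset.Icc 1 (n₂ - 1), l)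
            * ∏ l ∈ Finset.Icc 1 (n₂ - 1), qPoch (Real.exp (-1 / L)) l)
            * (L ^ (∑ l ∈ Finset.Icc 1 (n₂ + 1 + d - 1), l)
            * ∏ l ∈ Finset.Icc 1 (n₂ + 1 + d - 1), qPoch (Real.exp (-1 / L)) l)))
        * (∏ i ∈ Finset.Icc 1 (n₂ + 1 + d), ∏ j ∈ Finset.Icc 1 n₂,
            L * (1 - Real.exp (-(2 * a + (i + j - 2 : ℕ)) / L)))
        * (∏ i ∈ Finset.Icc 1 (n₂ + 1 + d), L * (1 - Real.exp (-(a + a₁ + (i - 1 : ℕ)) / L)))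
        = L ^ (2 * n₂ + 1) * K (n₂ + 1 + d) n₂ (Real.exp (-a₁ / L)) (Real.exp (-a / L))
          (Real.exp (-1 / L)) := by
      filter_upwards [eventually_gt_atTop 0] with L hL
      have hp1 : ∏ i ∈ Finset.Icc 1 (n₂ + 1 + d), ∏ j ∈ Finset.Icc 1 n₂,
            L * (1 - Real.exp (-(2 * a + (i + j - 2 : ℕ)) / L))
          = L ^ ((n₂ + 1 + d) * n₂) * ∏ i ∈ Finset.Icc 1 (n₂ + 1 + d), ∏ j ∈ Finset.Icc 1 n₂,
            (1 - Real.exp (-a / L) ^ 2 * Real.exp (-1 / L) ^ (i + j - 2)) := by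
        simp only [Finset.prod_mul_distrib, Finset.prod_const, Nat.card_Icc, Nat.add_sub_cancel,
          ← pow_mul, mul_comm n₂]
        congr 1
        refine Finset.prod_congr rfl fun i _ => Finset.prod_congr rfl fun j _ => ?_
        rw [← Real.exp_nat_mul, ← Real.exp_nat_mul, ← Real.exp_add]
        congr 2
        push_cast
        ring
      have hp2 : ∏ i ∈ Finset.Icc 1 (n₂ + 1 + d), L * (1 - Real.exp (-(a + a₁ + (i - 1 : ℕ)) / L))
          = L ^ (n₂ + 1 + d) * ∏ i ∈ Finset.Icc 1 (n₂ + 1 + d),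
            (1 - Real.exp (-a₁ / L) * Real.exp (-a / L) * Real.exp (-1 / L) ^ (i - 1)) := by
        simp only [Finset.prod_mul_distrib, Finset.prod_const, Nat.card_Icc, Nat.add_sub_cancel]
        congr 1
        refine Finset.prod_congr rfl fun i _ => ?_
        rw [← Real.exp_nat_mul, ← Real.exp_add, ← Real.exp_add]
        congr 2
        ring
      have hdeg : L ^ (2 * n₂ + 1) * (L ^ (∑ l ∈ Finset.Icc 1 (n₂ - 1), l)
          * L ^ (∑ l ∈ Finset.Icc 1 (n₂ + 1 + d - 1), l))
          = L ^ (∑ l ∈ Finset.Icc 1 (d - 1), l) * L ^ ((n₂ + 1 + d) * n₂) * L ^ (n₂ + 1 + d) := by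
        rw [← pow_add, ← pow_add, ← pow_add, ← pow_add, degree_identity]
      rw [hp1, hp2, K, ed2]
      have hLa : L ^ (∑ l ∈ Finset.Icc 1 (n₂ - 1), l)
          * L ^ (∑ l ∈ Finset.Icc 1 (n₂ + 1 + d - 1), l) ≠ 0 := by positivity
      have hdiv := (eq_div_iff hLa).2 hdeg
      rw [hdiv]
      simp only [div_eq_mul_inv, mul_inv]
      ring
    refine Tendsto.congr' h1 ?_
    rw [hKt]
    have one : ∀ c : ℝ, c = 1 * 1 * 1 * 1 * 1 * c := fun c => by ring
    rw [one (_ / _)]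
    refine ((Tendsto.mul ?_ (Tendsto.div (tendsto_prod_qPoch _)
      ((tendsto_prod_qPoch _).mul (tendsto_prod_qPoch _)) ?_)).mul ?_).mul ?_
    · exact ((((tendsto_exp_zpow_const a E).mul (tendsto_exp_zpow_const 1 e1)).mul
        (tendsto_exp_zpow_const 1 e2)).mul (tendsto_exp_zpow_const 1 e3)).mul
        (tendsto_exp_zpow_const 1 e4)
    · exact mul_ne_zero (Finset.prod_ne_zero_iff.2 fun l _ => by positivity)
        (Finset.prod_ne_zero_iff.2 fun l _ => by positivity)
    · exact tendsto_finsetProd _ fun i _ => tendsto_finsetProd _ fun j _ =>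
        tendsto_mul_one_sub_exp _
    · exact tendsto_finsetProd _ fun i _ => tendsto_mul_one_sub_exp _
  have hz : Tendsto (fun L => Real.exp (-a / L) ^ (∑ j : Fin n₂, (h L j.castSucc + r L j))) atTop
      (𝓝 (Real.exp (-a * ∑ j : Fin n₂, (x j.castSucc + y j)))) := by
    refine tendsto_exp_pow ?_
    simp only [Nat.cast_sum, Finset.sum_div, Nat.cast_add, add_div]
    exact tendsto_finsetSum _ fun j _ => (hh _).add (hr _)
  have hα : Tendsto (fun L => Real.exp (-a₁ / L) ^
        (∑ j : Fin n₂, ((h L j.castSucc : ℤ) - (r L j : ℤ)))) atTop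
      (𝓝 (Real.exp (-a₁ * ∑ j : Fin n₂, (x j.castSucc - y j)))) := by
    refine tendsto_exp_zpow ?_
    simp only [Int.cast_sum, Finset.sum_div, Int.cast_sub, Int.cast_natCast, sub_div]
    exact tendsto_finsetSum _ fun j _ => (hh _).sub (hr _)
  have hzα : Tendsto (fun L => (Real.exp (-a / L) * Real.exp (-a₁ / L)) ^ h L (Fin.last n₂)) atTop
      (𝓝 (Real.exp (-(a + a₁) * x (Fin.last n₂)))) := by
    refine (tendsto_exp_pow (c := a + a₁) (hh (Fin.last n₂))).congr fun L => ?_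
    rw [← Real.exp_add]
    congr 2
    ring
  have hq : Tendsto (fun L => ∏ i, qPoch (Real.exp (-1 / L)) (h L i + (n₂ + 1 + d - (n₂ + 1)))
        / qPoch (Real.exp (-1 / L)) (h L i)) atTop
      (𝓝 (∏ i, (1 - Real.exp (-x i)) ^ (n₂ + 1 + d - (n₂ + 1)))) :=
    tendsto_finsetProd _ fun i _ => tendsto_qPoch_div (hh i) _
  have hv : ∀ {m : ℕ} {k : ℝ → Fin m → ℕ} {w : Fin m → ℝ},
      (∀ j, Tendsto (fun L => (k L j : ℝ) / L) atTop (𝓝 (w j))) →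
      Tendsto (fun L => ∏ i, ∏ j ∈ Finset.Ioi i,
        (Real.exp (-1 / L) ^ k L j - Real.exp (-1 / L) ^ k L i)) atTop
      (𝓝 (∏ i, ∏ j ∈ Finset.Ioi i, (Real.exp (-w j) - Real.exp (-w i)))) := by
    intro m k w hk
    refine tendsto_finsetProd _ fun i _ => tendsto_finsetProd _ fun j _ => ?_
    have := (tendsto_exp_pow (c := 1) (hk j)).sub (tendsto_exp_pow (c := 1) (hk i))
    simpa using this
  have := ((((((hK.mul hz).mul hα).mul hzα).mul hq).mul (hv hh)).mul (hv hr))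
  refine (this.congr fun L => ?_).trans_eq ?_
  · simp only [probFormula]
    ring
  · rw [jacobiDensity]
    congr 1
    ring

end RSKJacobi

namespace RSKJacobi

/-! ### Integrals over interlacing points -/

open scoped ENNReal

/-- The one-dimensional weight. -/
noncomputable def wt1 (p : ℝ) (q : ℕ) (u : ℝ) : ℝ := Real.exp (-p * u) * (1 - Real.exp (-u)) ^ q

/-- The tail integral of the one-dimensional weight. -/
noncomputable def tailInt (p : ℝ) (q : ℕ) (u : ℝ) : ℝ := ∫ v in Set.Ioi u, wt1 p q v

/-- The rising factorial `p (p + 1) ⋯ (p + N - 1)`. -/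
def rising (p : ℝ) (N : ℕ) : ℝ := ∏ i ∈ Finset.range N, (p + i)

lemma rising_pos {p : ℝ} (hp : 0 < p) (N : ℕ) : 0 < rising p N :=
  Finset.prod_pos fun i _ => by positivity

lemma continuous_wt1 (p : ℝ) (q : ℕ) : Continuous (wt1 p q) := by
  unfold wt1; fun_prop

lemma wt1_nonneg (p : ℝ) (q : ℕ) {u : ℝ} (hu : 0 ≤ u) : 0 ≤ wt1 p q u :=
  mul_nonneg (Real.exp_pos _).le
    (pow_nonneg (sub_nonneg.2 (Real.exp_le_one_iff.2 (by linarith))) _)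

lemma wt1_le (p : ℝ) (q : ℕ) {u : ℝ} (hu : 0 ≤ u) : wt1 p q u ≤ Real.exp (-p * u) := by
  have h1 : Real.exp (-u) ≤ 1 := Real.exp_le_one_iff.2 (by linarith)
  have h2 := (Real.exp_pos (-u)).le
  exact mul_le_of_le_one_right (Real.exp_pos _).le (pow_le_one₀ (by linarith) (by linarith))

lemma integrableOn_wt1 {p : ℝ} (hp : 0 < p) (q : ℕ) {u : ℝ} (hu : 0 ≤ u) :
    IntegrableOn (wt1 p q) (Set.Ioi u) := by
  refine Integrable.mono' (exp_neg_integrableOn_Ioi u hp)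
    (continuous_wt1 p q).aestronglyMeasurable ?_
  filter_upwards [ae_restrict_mem measurableSet_Ioi] with v hv
  have hv' : 0 ≤ v := hu.trans (le_of_lt hv)
  rw [Real.norm_of_nonneg (wt1_nonneg p q hv')]
  exact wt1_le p q hv'

/-- Splitting off one factor `1 - exp (-u)` expresses the derivative through the weights with
parameters `p` and `p + 1` and the same `q`; integrated, this links tail integrals of neighbouring
columns. -/
lemma hasDerivAt_wt1 (p : ℝ) (q : ℕ) (u : ℝ) :
    HasDerivAt (wt1 p (q + 1)) (-p * wt1 p q u + (p + q + 1) * wt1 (p + 1) q u) u := by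
  have h1 : HasDerivAt (fun u => Real.exp (-p * u)) (Real.exp (-p * u) * -p) u := by
    simpa using ((hasDerivAt_id u).const_mul (-p)).exp
  have h2 : HasDerivAt (fun u => 1 - Real.exp (-u)) (Real.exp (-u)) u := by
    simpa using ((hasDerivAt_id u).neg.exp).const_sub 1
  have h3 := h1.mul (h2.pow (q + 1))
  refine h3.congr_deriv ?_
  have e : Real.exp (-(p + 1) * u) = Real.exp (-p * u) * Real.exp (-u) := by
    rw [← Real.exp_add]; congr 1; ring
  simp only [wt1, e, Nat.add_sub_cancel, Pi.pow_apply]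
  push_cast
  ring

lemma tendsto_wt1 {p : ℝ} (hp : 0 < p) (q : ℕ) : Tendsto (wt1 p q) atTop (𝓝 0) := by
  refine squeeze_zero' (g := fun u => Real.exp (-p * u)) ?_ ?_ ?_
  · filter_upwards [eventually_ge_atTop 0] with u hu using wt1_nonneg p q hu
  · filter_upwards [eventually_ge_atTop 0] with u hu using wt1_le p q hu
  · refine Real.tendsto_exp_atBot.comp ?_
    exact tendsto_id.const_mul_atTop_of_neg (neg_lt_zero.2 hp)

lemma tailInt_succ {p : ℝ} (hp : 0 < p) (q : ℕ) {u : ℝ} (hu : 0 ≤ u) :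
    (p + q + 1) * tailInt (p + 1) q u = p * tailInt p q u - wt1 p (q + 1) u := by
  have h1 := (integrableOn_wt1 hp q hu).const_mul (-p)
  have h2 := (integrableOn_wt1 (p := p + 1) (by linarith) q hu).const_mul (p + q + 1)
  have h := integral_Ioi_of_hasDerivAt_of_tendsto' (a := u) (fun v _ => hasDerivAt_wt1 p q v)
    (h1.add h2) (tendsto_wt1 hp (q + 1))
  rw [integral_add h1 h2, integral_const_mul, integral_const_mul] at h
  simp only [tailInt]
  linarith

lemma wt1_zero (p : ℝ) (q : ℕ) : wt1 p (q + 1) 0 = 0 := by simp [wt1]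

/-- The Beta integral. The step from `q` to `q + 1` expands one factor `1 - exp (-u)` and eliminates
the `p + 1` integral by `tailInt_succ`, whose boundary term vanishes at `0`. -/
lemma tailInt_zero {p : ℝ} (hp : 0 < p) (q : ℕ) :
    tailInt p q 0 = q.factorial / rising p (q + 1) := by
  induction q with
  | zero =>
    simp only [tailInt, wt1, pow_zero, mul_one]
    rw [integral_exp_mul_Ioi (neg_lt_zero.2 hp)]
    simp [rising]
  | succ q ih =>
    have h1 : tailInt p (q + 1) 0 = tailInt p q 0 - tailInt (p + 1) q 0 := by
      simp only [tailInt]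
      rw [← integral_sub (integrableOn_wt1 hp q le_rfl)
        (integrableOn_wt1 (p := p + 1) (by linarith) q le_rfl)]
      refine integral_congr_ae (Eventually.of_forall fun u => ?_)
      have e : Real.exp (-(p + 1) * u) = Real.exp (-p * u) * Real.exp (-u) := by
        rw [← Real.exp_add]; congr 1; ring
      simp only [wt1, e, pow_succ]
      ring
    have h2 := tailInt_succ hp q le_rfl
    rw [wt1_zero, sub_zero] at h2
    have h3 : 0 < p + q + 1 := by positivity
    have h4 := (rising_pos hp (q + 1)).ne'
    have h5 : rising p (q + 1 + 1) = rising p (q + 1) * (p + q + 1) := by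
      rw [rising, Finset.prod_range_succ]
      push_cast
      rw [← add_assoc]
      rfl
    have h6 : tailInt (p + 1) q 0 = p * tailInt p q 0 / (p + q + 1) := by
      rw [eq_div_iff h3.ne', mul_comm, h2]
    rw [h1, h6, ih, h5, Nat.factorial_succ]
    push_cast
    field_simp
    ring

/-- The integral of a determinant over a box. -/
lemma integral_det_box {m : ℕ} (I : Fin m → Set ℝ) (f : Fin m → ℝ → ℝ)
    (hf : ∀ i j, IntegrableOn (f j) (I i)) :
    IntegrableOn (fun x : Fin m → ℝ => (Matrix.of fun i j => f j (x i)).det)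
        (Set.pi Set.univ I) ∧
      ∫ x in Set.pi Set.univ I, (Matrix.of fun i j => f j (x i)).det
        = (Matrix.of fun i j => ∫ u in I i, f j u).det := by
  have hμ : (volume : Measure (Fin m → ℝ)).restrict (Set.pi Set.univ I)
      = Measure.pi fun i => volume.restrict (I i) := by
    rw [volume_pi, Measure.restrict_pi_pi]
  have hdet : ∀ x : Fin m → ℝ, (Matrix.of fun i j => f j (x i)).det
      = ∑ σ : Equiv.Perm (Fin m), ((Equiv.Perm.sign σ : ℤ) : ℝ) * ∏ i, f (σ i) (x i) := fun x => by
    rw [← Matrix.det_transpose, Matrix.det_apply']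
    rfl
  have hint : ∀ σ : Equiv.Perm (Fin m), Integrable (fun x : Fin m → ℝ =>
      ((Equiv.Perm.sign σ : ℤ) : ℝ) * ∏ i, f (σ i) (x i))
      (Measure.pi fun i => volume.restrict (I i)) := fun σ =>
    (Integrable.fintype_prod (f := fun i => f (σ i)) fun i => hf i (σ i)).const_mul _
  constructor
  · rw [IntegrableOn, hμ]
    simp only [hdet]
    exact integrable_finsetSum _ fun σ _ => hint σ
  · rw [hμ]
    simp only [hdet]
    rw [integral_finsetSum _ fun σ _ => hint σ, ← Matrix.det_transpose, Matrix.det_apply']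
    refine Finset.sum_congr rfl fun σ _ => ?_
    rw [integral_const_mul]
    congr 1
    exact integral_fintype_prod_eq_prod (fun i => f (σ i))

/-- The strictly decreasing positive points. -/
def ordered (n : ℕ) : Set (Fin n → ℝ) := {y | StrictAnti y ∧ ∀ i, 0 < y i}

/-- The Vandermonde product in the variables `exp (-y_i)`. -/
noncomputable def expVd {n : ℕ} (y : Fin n → ℝ) : ℝ := vd fun i => Real.exp (-y i)

/-- The product weight. -/
noncomputable def wtProd {n : ℕ} (p : ℝ) (q : ℕ) (y : Fin n → ℝ) : ℝ := ∏ i, wt1 p q (y i)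

lemma expVd_nonneg {n : ℕ} {y : Fin n → ℝ} (hy : StrictAnti y) : 0 ≤ expVd y := by
  unfold expVd vd
  exact Finset.prod_nonneg fun i _ => Finset.prod_nonneg fun j hj => sub_nonneg.2
    (Real.exp_le_exp.2 (neg_le_neg (hy (Finset.mem_Ioi.1 hj)).le))

lemma wtProd_nonneg {n : ℕ} (p : ℝ) (q : ℕ) {y : Fin n → ℝ} (hy : ∀ i, 0 < y i) :
    0 ≤ wtProd p q y := Finset.prod_nonneg fun i _ => wt1_nonneg p q (hy i).le

lemma continuous_expVd (n : ℕ) : Continuous (expVd : (Fin n → ℝ) → ℝ) := by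
  unfold expVd vd
  refine continuous_finsetProd _ fun i _ => continuous_finsetProd _ fun j _ => ?_
  fun_prop

lemma continuous_wtProd (n : ℕ) (p : ℝ) (q : ℕ) : Continuous (wtProd p q : (Fin n → ℝ) → ℝ) :=
  continuous_finsetProd _ fun i _ => (continuous_wt1 p q).comp (continuous_apply i)

/-- Multiplying row `i` of the Vandermonde matrix by its weight turns the power `exp (-y i) ^ j`
into a shift of `p` by `j`. -/
lemma expVd_mul_wtProd {n : ℕ} (p : ℝ) (q : ℕ) (y : Fin n → ℝ) :
    expVd y * wtProd p q y = (Matrix.of fun i j : Fin n => wt1 (p + (j : ℕ)) q (y i)).det := by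
  rw [expVd, vd_eq_det, mul_comm, wtProd, ← Matrix.det_mul_column]
  congr 1
  ext i j
  simp only [Matrix.of_apply, Matrix.vandermonde_apply, wt1]
  rw [← Real.exp_nat_mul, mul_right_comm, ← Real.exp_add]
  congr 2
  ring

/-- The lower ends of the intervals in which the interlacing points vary. -/
noncomputable def lowerEnd {n : ℕ} (y : Fin n → ℝ) : Fin (n + 1) → ℝ := Fin.snoc y 0

lemma lowerEnd_castSucc {n : ℕ} (y : Fin n → ℝ) (j : Fin n) : lowerEnd y j.castSucc = y j := by
  simp [lowerEnd]

lemma lowerEnd_last {n : ℕ} (y : Fin n → ℝ) : lowerEnd y (Fin.last n) = 0 := by simp [lowerEnd]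

lemma lowerEnd_nonneg {n : ℕ} {y : Fin n → ℝ} (hy : ∀ i, 0 < y i) (i : Fin (n + 1)) :
    0 ≤ lowerEnd y i := by
  refine Fin.lastCases ?_ (fun j => ?_) i
  · rw [lowerEnd_last]
  · rw [lowerEnd_castSucc]; exact (hy j).le

lemma lowerEnd_succ_le {n : ℕ} {y : Fin n → ℝ} (hy : y ∈ ordered n) (i : Fin n) :
    lowerEnd y i.succ ≤ lowerEnd y i.castSucc := by
  rw [lowerEnd_castSucc]
  rcases Fin.eq_castSucc_or_eq_last i.succ with ⟨j, hj⟩ | h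
  · rw [hj, lowerEnd_castSucc]
    refine (hy.1 ?_).le
    have := congrArg Fin.val hj
    simp only [Fin.val_succ, Fin.val_castSucc] at this
    rw [Fin.lt_def]
    omega
  · rw [h, lowerEnd_last]
    exact (hy.2 i).le

/-- The intervals in which the points that interlace with `y` vary. -/
noncomputable def interval {n : ℕ} (y : Fin n → ℝ) (i : Fin (n + 1)) : Set ℝ :=
  Fin.cases (motive := fun _ => Set ℝ) (Set.Ioi (lowerEnd y 0))
    (fun j => Set.Ioo (lowerEnd y j.succ) (lowerEnd y j.castSucc)) i

lemma interval_zero {n : ℕ} (y : Fin n → ℝ) : interval y 0 = Set.Ioi (lowerEnd y 0) := rfl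

lemma interval_succ {n : ℕ} (y : Fin n → ℝ) (j : Fin n) :
    interval y j.succ = Set.Ioo (lowerEnd y j.succ) (lowerEnd y j.castSucc) := rfl

/-- For fixed `y` the coordinates of `x` are constrained independently: the first lies above `y_1`
without upper bound, the last between `0` and `y_n`. This box structure allows determinants to be
integrated row by row. -/
lemma fiber_eq_pi {n : ℕ} (y : Fin n → ℝ) :
    {x : Fin (n + 1) → ℝ | (x, y) ∈ region n} = Set.pi Set.univ (interval y) := by
  ext x
  have h1 : x ∈ Set.pi Set.univ (interval y) ↔ (∀ i, lowerEnd y i < x i) ∧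
      ∀ j : Fin n, x j.succ < y j := by
    rw [Set.mem_univ_pi, Fin.forall_fin_succ, Fin.forall_fin_succ (P := fun i => lowerEnd y i < x i)]
    simp only [interval_zero, interval_succ, Set.mem_Ioi, Set.mem_Ioo, lowerEnd_castSucc,
      forall_and, and_assoc]
  have h2 : (∀ i, lowerEnd y i < x i) ↔ (∀ j : Fin n, y j < x j.castSucc) ∧ 0 < x (Fin.last n) := by
    constructor
    · intro h
      refine ⟨fun j => ?_, ?_⟩
      · rw [← lowerEnd_castSucc y j]; exact h _
      · rw [← lowerEnd_last y]; exact h _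
    · rintro ⟨h, h'⟩ i
      refine Fin.lastCases ?_ (fun j => ?_) i
      · rw [lowerEnd_last]; exact h'
      · rw [lowerEnd_castSucc]; exact h j
  rw [h1, h2]
  show (∀ j : Fin n, y j < x j.castSucc ∧ x j.succ < y j) ∧ 0 < x (Fin.last n) ↔ _
  rw [forall_and]
  tauto

lemma region_ordered {n : ℕ} {x : Fin (n + 1) → ℝ} {y : Fin n → ℝ} (h : (x, y) ∈ region n) :
    x ∈ ordered (n + 1) ∧ y ∈ ordered n := by
  obtain ⟨h1, h2⟩ := h
  have hx : StrictAnti x := Fin.strictAnti_iff_succ_lt.2 fun i => (h1 i).2.trans (h1 i).1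
  have hx0 : ∀ i, 0 < x i := fun i => h2.trans_le (hx.antitone (Fin.le_last i))
  refine ⟨⟨hx, hx0⟩, ?_, fun i => (hx0 _).trans (h1 i).2⟩
  intro i j hij
  refine (h1 j).1.trans_le (le_trans (hx.antitone ?_) (h1 i).2.le)
  rw [Fin.le_def]
  simp only [Fin.val_succ, Fin.val_castSucc]
  exact hij

end RSKJacobi

/-! ### Evaluation of the interlacing integrals by determinants -/

namespace RSKJacobi

open scoped ENNReal

lemma setIntegral_wt1_Ioo {p : ℝ} (hp : 0 < p) (q : ℕ) {u v : ℝ} (hu : 0 ≤ u) (huv : u ≤ v) :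
    ∫ w in Set.Ioo u v, wt1 p q w = tailInt p q u - tailInt p q v := by
  have h := integrableOn_wt1 hp q hu
  rw [eq_sub_iff_add_eq, ← integral_Ioc_eq_integral_Ioo, tailInt, tailInt,
    ← setIntegral_union (Set.Ioc_disjoint_Ioi le_rfl) measurableSet_Ioi
      (h.mono_set Set.Ioc_subset_Ioi_self) (h.mono_set (Set.Ioi_subset_Ioi huv)),
    Set.Ioc_union_Ioi_eq_Ioi huv]

lemma det_of_last_row {n : ℕ} (M : Matrix (Fin (n + 1)) (Fin (n + 1)) ℝ)
    (hM : ∀ j : Fin n, M (Fin.last n) j.succ = 0) :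
    M.det = (-1) ^ n * M (Fin.last n) 0 *
      (Matrix.of fun i j : Fin n => M i.castSucc j.succ).det := by
  rw [Matrix.det_succ_row M (Fin.last n), Fin.sum_univ_succ, Finset.sum_eq_zero, add_zero]
  · have e : M.submatrix (Fin.last n).succAbove (0 : Fin (n + 1)).succAbove
        = Matrix.of fun i j : Fin n => M i.castSucc j.succ := by
      ext i j
      simp
    rw [e, Fin.val_last, Fin.val_zero, add_zero]
  · intro j _
    rw [hM j, mul_zero, zero_mul]

/-- An integral over a bounded interval is a difference of tail integrals at consecutive lower ends,
so adding successive rows restores the tails. -/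
lemma det_interval_eq {n : ℕ} {y : Fin n → ℝ} (hy : y ∈ ordered n) {p : ℝ} (hp : 0 < p) (q : ℕ) :
    (Matrix.of fun i j : Fin (n + 1) => ∫ u in interval y i, wt1 (p + (j : ℕ)) q u).det
      = (Matrix.of fun i j : Fin (n + 1) => tailInt (p + (j : ℕ)) q (lowerEnd y i)).det := by
  symm
  refine Matrix.det_eq_of_forall_row_eq_smul_add_pred (fun _ => 1) (fun j => ?_) fun i j => ?_
  · rw [Matrix.of_apply, Matrix.of_apply, interval_zero, tailInt]
  · rw [Matrix.of_apply, Matrix.of_apply, Matrix.of_apply, interval_succ,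
      setIntegral_wt1_Ioo (by positivity) q (lowerEnd_nonneg hy.2 _) (lowerEnd_succ_le hy i),
      one_mul, sub_add_cancel]

/-- The matrix obtained from the tail integrals by column operations. -/
noncomputable def reducedTail {n : ℕ} (p : ℝ) (q : ℕ) (y : Fin n → ℝ) (i : Fin (n + 1)) :
    Fin (n + 1) → ℝ :=
  Fin.cons (tailInt p q (lowerEnd y i))
    fun j : Fin n => -(p + (j : ℕ) + q + 1)⁻¹ * wt1 (p + (j : ℕ)) (q + 1) (lowerEnd y i)

lemma reducedTail_zero {n : ℕ} (p : ℝ) (q : ℕ) (y : Fin n → ℝ) (i : Fin (n + 1)) :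
    reducedTail p q y i 0 = tailInt p q (lowerEnd y i) := by
  rw [reducedTail, Fin.cons_zero]

lemma reducedTail_succ {n : ℕ} (p : ℝ) (q : ℕ) (y : Fin n → ℝ) (i : Fin (n + 1)) (j : Fin n) :
    reducedTail p q y i j.succ
      = -(p + (j : ℕ) + q + 1)⁻¹ * wt1 (p + (j : ℕ)) (q + 1) (lowerEnd y i) := by
  rw [reducedTail, Fin.cons_succ]

/-- `tailInt_succ` writes each column as a multiple of the previous one plus a boundary term; column
operations leave a genuine integral only in the first column. -/
lemma det_tailInt {n : ℕ} {y : Fin n → ℝ} (hy : y ∈ ordered n) {p : ℝ} (hp : 0 < p) (q : ℕ) :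
    (Matrix.of fun i j : Fin (n + 1) => tailInt (p + (j : ℕ)) q (lowerEnd y i)).det
      = (Matrix.of (reducedTail p q y)).det := by
  refine Matrix.det_eq_of_forall_col_eq_smul_add_pred
    (fun j => (p + (j : ℕ)) / (p + (j : ℕ) + q + 1)) (fun i => ?_) fun i j => ?_
  · rw [Matrix.of_apply, Matrix.of_apply, reducedTail_zero, Fin.val_zero, Nat.cast_zero, add_zero]
  · have hpj : 0 < p + (j : ℕ) := by positivity
    have h := tailInt_succ hpj q (lowerEnd_nonneg hy.2 i)
    have h3 : 0 < p + (j : ℕ) + q + 1 := by positivity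
    rw [Matrix.of_apply, Matrix.of_apply, Matrix.of_apply, reducedTail_succ, Fin.val_succ,
      Fin.val_castSucc, Nat.cast_add_one, ← add_assoc, ← mul_right_inj' h3.ne', h]
    field_simp
    ring

/-- The last lower end is `0`, where the boundary terms vanish, so the last row has a single nonzero
entry, a Beta integral. Its cofactor is a weighted Vandermonde determinant in `y` with `q + 1`, and
the cofactor sign cancels the `n` signs of the columns. -/
lemma det_reducedTail {n : ℕ} (y : Fin n → ℝ) {p : ℝ} (hp : 0 < p) (q : ℕ) :
    (Matrix.of (reducedTail p q y)).det
      = q.factorial / rising p (q + 1 + n) * (expVd y * wtProd p (q + 1) y) := by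
  have h0 : ∀ j : Fin n, Matrix.of (reducedTail p q y) (Fin.last n) j.succ = 0 := fun j => by
    rw [Matrix.of_apply, reducedTail_succ, lowerEnd_last, wt1_zero, mul_zero]
  have h3 : (Matrix.of fun i j : Fin n => Matrix.of (reducedTail p q y) i.castSucc j.succ)
      = Matrix.of fun i j : Fin n => -(p + (j : ℕ) + q + 1)⁻¹ *
        (Matrix.of fun i j : Fin n => wt1 (p + (j : ℕ)) (q + 1) (y i)) i j := by
    ext i j
    rw [Matrix.of_apply, Matrix.of_apply, Matrix.of_apply, Matrix.of_apply, reducedTail_succ,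
      lowerEnd_castSucc]
  have h4 : ∏ j : Fin n, -(p + (j : ℕ) + q + 1)⁻¹
      = (-1) ^ n * (∏ j ∈ Finset.range n, (p + ((q + 1 + j : ℕ) : ℝ)))⁻¹ := by
    rw [Fin.prod_univ_eq_prod_range (fun j => -(p + (j : ℕ) + q + 1)⁻¹), Finset.prod_neg,
      Finset.prod_inv_distrib, Finset.card_range]
    congr 2
    refine Finset.prod_congr rfl fun j _ => ?_
    push_cast
    ring
  have h5 : ((-1 : ℝ) ^ n) * (-1) ^ n = 1 := by rw [← mul_pow, neg_one_mul, neg_neg, one_pow]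
  have h6 : rising p (q + 1 + n)
      = rising p (q + 1) * ∏ j ∈ Finset.range n, (p + ((q + 1 + j : ℕ) : ℝ)) := by
    rw [rising, rising, Finset.prod_range_add]
  rw [det_of_last_row _ h0, h3, Matrix.det_mul_row, h4, h6, ← expVd_mul_wtProd, Matrix.of_apply,
    reducedTail_zero, lowerEnd_last, tailInt_zero hp, div_mul_eq_div_div]
  generalize expVd y * wtProd p (q + 1) y = D
  generalize (q.factorial : ℝ) / rising p (q + 1) = E
  generalize ∏ j ∈ Finset.range n, (p + ((q + 1 + j : ℕ) : ℝ)) = F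
  rw [div_eq_mul_inv]
  linear_combination (E * F⁻¹ * D) * h5

/-- Integration of a weighted Vandermonde product over the points `x` that interlace with `y`. -/
theorem integral_fiber {n : ℕ} {y : Fin n → ℝ} (hy : y ∈ ordered n) {p : ℝ} (hp : 0 < p) (q : ℕ) :
    IntegrableOn (fun x => expVd x * wtProd p q x) (Set.pi Set.univ (interval y)) ∧
      ∫ x in Set.pi Set.univ (interval y), expVd x * wtProd p q x
        = q.factorial / rising p (q + 1 + n) * (expVd y * wtProd p (q + 1) y) := by
  have hl := lowerEnd_nonneg hy.2
  have hf : ∀ i j : Fin (n + 1), IntegrableOn (wt1 (p + (j : ℕ)) q) (interval y i) := by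
    intro i j
    have hpj : 0 < p + (j : ℕ) := by positivity
    refine Fin.cases ?_ (fun i => ?_) i
    · rw [interval_zero]
      exact integrableOn_wt1 hpj q (hl 0)
    · rw [interval_succ]
      exact (integrableOn_wt1 hpj q (hl i.succ)).mono_set Set.Ioo_subset_Ioi_self
  have hbox := integral_det_box (interval y) (fun j => wt1 (p + (j : ℕ)) q) hf
  rw [← det_reducedTail y hp q, ← det_tailInt hy hp q, ← det_interval_eq hy hp q]
  simp only [expVd_mul_wtProd]
  exact hbox

/-- Integration of a weighted Vandermonde product over the points `y` that interlace with `x`. -/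
theorem integral_cofiber {n : ℕ} {x : Fin (n + 1) → ℝ} (hx : x ∈ ordered (n + 1)) :
    IntegrableOn (fun y => expVd y * wtProd 1 0 y)
        (Set.pi Set.univ fun i : Fin n => Set.Ioo (x i.succ) (x i.castSucc)) ∧
      ∫ y in Set.pi Set.univ fun i : Fin n => Set.Ioo (x i.succ) (x i.castSucc),
        expVd y * wtProd 1 0 y = (n.factorial : ℝ)⁻¹ * expVd x := by
  have hpj : ∀ j : ℕ, (0 : ℝ) < 1 + j := fun j => by positivity
  have hf : ∀ i j : Fin n, IntegrableOn (wt1 (1 + (j : ℕ)) 0) (Set.Ioo (x i.succ) (x i.castSucc)) :=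
    fun i j => (integrableOn_wt1 (hpj j) 0 (hx.2 _).le).mono_set Set.Ioo_subset_Ioi_self
  have hbox := integral_det_box _ (fun j : Fin n => wt1 (1 + (j : ℕ)) 0) hf
  simp only [expVd_mul_wtProd]
  refine ⟨hbox.1, ?_⟩
  rw [hbox.2]
  -- For `q = 0` the tails are pure powers of `exp (-u)`, so the entries are differences of powers;
  -- the column factors `1 / (j + 1)` multiply to `1 / n!`.
  have ht : ∀ (j : ℕ) (u : ℝ), tailInt (1 + j) 0 u = (j + 1 : ℝ)⁻¹ * Real.exp (-u) ^ (j + 1) := by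
    intro j u
    simp only [tailInt, wt1, pow_zero, mul_one]
    rw [integral_exp_mul_Ioi (neg_lt_zero.2 (hpj j)), ← Real.exp_nat_mul]
    have e : -(1 + (j : ℝ)) * u = ((j + 1 : ℕ) : ℝ) * -u := by push_cast; ring
    rw [e, neg_div_neg_eq, div_eq_inv_mul, add_comm]
  have h1 : (Matrix.of fun i j : Fin n => ∫ u in Set.Ioo (x i.succ) (x i.castSucc),
        wt1 (1 + (j : ℕ)) 0 u)
      = Matrix.of fun i j : Fin n => ((j : ℕ) + 1 : ℝ)⁻¹ * (Matrix.of fun i j : Fin n =>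
          Real.exp (-x i.succ) ^ ((j : ℕ) + 1) - Real.exp (-x i.castSucc) ^ ((j : ℕ) + 1)) i j := by
    ext i j
    simp only [Matrix.of_apply]
    rw [setIntegral_wt1_Ioo (hpj j) 0 (hx.2 _).le (hx.1 i.castSucc_lt_succ).le, ht, ht, mul_sub]
  rw [h1, Matrix.det_mul_row, det_pow_sub_pow fun i => Real.exp (-x i), Finset.prod_inv_distrib,
    Fin.prod_univ_eq_prod_range (fun j => (j : ℝ) + 1), ← Finset.prod_range_add_one_eq_factorial]
  push_cast
  rfl

/-! ### Tonelli's theorem on the interlacing region -/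

lemma isOpen_region (n : ℕ) : IsOpen (region n) := by
  have h : region n = (⋂ j : Fin n, ({p | p.2 j < p.1 j.castSucc} ∩ {p | p.1 j.succ < p.2 j})) ∩
      {p | 0 < p.1 (Fin.last n)} := by
    ext p
    rw [Set.mem_inter_iff, Set.mem_iInter]
    rfl
  rw [h]
  refine IsOpen.inter (isOpen_iInter_of_finite fun j => IsOpen.inter ?_ ?_) ?_
  · exact isOpen_lt (by fun_prop) (by fun_prop)
  · exact isOpen_lt (by fun_prop) (by fun_prop)
  · exact isOpen_lt (by fun_prop) (by fun_prop)

lemma isOpen_ordered (n : ℕ) : IsOpen (ordered n) := by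
  have h : ordered n = (⋂ (i : Fin n) (j : Fin n) (_ : i < j), {y | y j < y i}) ∩
      ⋂ i : Fin n, {y | 0 < y i} := by
    ext y
    simp only [Set.mem_inter_iff, Set.mem_iInter]
    exact Iff.rfl
  rw [h]
  refine IsOpen.inter (isOpen_iInter_of_finite fun i => isOpen_iInter_of_finite fun j =>
    isOpen_iInter_of_finite fun _ => ?_) (isOpen_iInter_of_finite fun i => ?_)
  · exact isOpen_lt (by fun_prop) (by fun_prop)
  · exact isOpen_lt (by fun_prop) (by fun_prop)

section Fubini

variable {n : ℕ} {F : (Fin (n + 1) → ℝ) → ℝ≥0∞} {G : (Fin n → ℝ) → ℝ≥0∞}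

/-- Outside `ordered n` the fibre over `y` is empty, so the outer integral may be restricted to
ordered points. -/
lemma lintegral_region_fst (hF : Measurable F) (hG : Measurable G) :
    ∫⁻ p in region n, F p.1 * G p.2
      = ∫⁻ y in ordered n, (∫⁻ x in {x | (x, y) ∈ region n}, F x) * G y := by
  have hm := (isOpen_region n).measurableSet
  rw [← lintegral_indicator hm, Measure.volume_eq_prod, lintegral_prod_symm',
    ← lintegral_indicator (isOpen_ordered n).measurableSet]
  · refine lintegral_congr fun y => ?_
    have hmy : MeasurableSet {x : Fin (n + 1) → ℝ | (x, y) ∈ region n} :=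
      measurable_prodMk_right hm
    by_cases hy : y ∈ ordered n
    · rw [Set.indicator_of_mem hy, ← lintegral_mul_const _ hF, ← lintegral_indicator hmy]
      refine lintegral_congr fun x => ?_
      rfl
    · rw [Set.indicator_of_notMem hy, lintegral_eq_zero_of_ae_eq_zero]
      refine Eventually.of_forall fun x => Set.indicator_of_notMem (fun h => hy ?_) _
      exact (region_ordered h).2
  · exact (((hF.comp measurable_fst).mul (hG.comp measurable_snd)).indicator hm)

lemma lintegral_region_snd (hF : Measurable F) (hG : Measurable G) :
    ∫⁻ p in region n, F p.1 * G p.2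
      = ∫⁻ x in ordered (n + 1), F x * ∫⁻ y in {y | (x, y) ∈ region n}, G y := by
  have hm := (isOpen_region n).measurableSet
  rw [← lintegral_indicator hm, Measure.volume_eq_prod, lintegral_prod,
    ← lintegral_indicator (isOpen_ordered (n + 1)).measurableSet]
  · refine lintegral_congr fun x => ?_
    have hmx : MeasurableSet {y : Fin n → ℝ | (x, y) ∈ region n} :=
      measurable_prodMk_left hm
    by_cases hx : x ∈ ordered (n + 1)
    · rw [Set.indicator_of_mem hx, ← lintegral_const_mul _ hG, ← lintegral_indicator hmx]
      refine lintegral_congr fun x => ?_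
      rfl
    · rw [Set.indicator_of_notMem hx, lintegral_eq_zero_of_ae_eq_zero]
      refine Eventually.of_forall fun y => Set.indicator_of_notMem (fun h => hx ?_) _
      exact (region_ordered h).1
  · exact (((hF.comp measurable_fst).mul (hG.comp measurable_snd)).indicator hm).aemeasurable

end Fubini

lemma lintegral_fiber {n : ℕ} {y : Fin n → ℝ} (hy : y ∈ ordered n) {p : ℝ} (hp : 0 < p) (q : ℕ) :
    ∫⁻ x in {x | (x, y) ∈ region n}, ENNReal.ofReal (expVd x * wtProd p q x)
      = ENNReal.ofReal (q.factorial / rising p (q + 1 + n) * (expVd y * wtProd p (q + 1) y)) := by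
  have hm : MeasurableSet {x : Fin (n + 1) → ℝ | (x, y) ∈ region n} :=
    measurable_prodMk_right (isOpen_region n).measurableSet
  obtain ⟨h1, h2⟩ := integral_fiber hy hp q
  rw [← h2]
  rw [← fiber_eq_pi] at h1 ⊢
  rw [ofReal_integral_eq_lintegral_ofReal h1]
  filter_upwards [ae_restrict_mem hm] with x hx
  have := (region_ordered hx).1
  exact mul_nonneg (expVd_nonneg this.1) (wtProd_nonneg p q this.2)

lemma cofiber_eq_pi {n : ℕ} {x : Fin (n + 1) → ℝ} (hx : x ∈ ordered (n + 1)) :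
    {y : Fin n → ℝ | (x, y) ∈ region n}
      = Set.pi Set.univ fun i : Fin n => Set.Ioo (x i.succ) (x i.castSucc) := by
  ext y
  rw [Set.mem_univ_pi]
  constructor
  · intro h i
    exact ⟨(h.1 i).2, (h.1 i).1⟩
  · intro h
    exact ⟨fun i => ⟨(h i).2, (h i).1⟩, hx.2 _⟩

lemma lintegral_cofiber {n : ℕ} {x : Fin (n + 1) → ℝ} (hx : x ∈ ordered (n + 1)) :
    ∫⁻ y in {y | (x, y) ∈ region n}, ENNReal.ofReal (expVd y * wtProd 1 0 y)
      = ENNReal.ofReal ((n.factorial : ℝ)⁻¹ * expVd x) := by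
  have hm : MeasurableSet {y : Fin n → ℝ | (x, y) ∈ region n} :=
    measurable_prodMk_left (isOpen_region n).measurableSet
  obtain ⟨h1, h2⟩ := integral_cofiber hx
  rw [← h2]
  rw [← cofiber_eq_pi hx] at h1 ⊢
  rw [ofReal_integral_eq_lintegral_ofReal h1]
  filter_upwards [ae_restrict_mem hm] with y hy
  have := (region_ordered hy).2
  exact mul_nonneg (expVd_nonneg this.1) (wtProd_nonneg 1 0 this.2)

end RSKJacobi

namespace RSKJacobi

/-! ### The normalisation of the limiting density -/

open scoped ENNReal

lemma wtProd_mul {n : ℕ} (p p' : ℝ) (q q' : ℕ) (y : Fin n → ℝ) :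
    wtProd p q y * wtProd p' q' y = wtProd (p + p') (q + q') y := by
  rw [wtProd, wtProd, wtProd, ← Finset.prod_mul_distrib]
  refine Finset.prod_congr rfl fun i _ => ?_
  have e : Real.exp (-(p + p') * y i) = Real.exp (-p * y i) * Real.exp (-p' * y i) := by
    rw [← Real.exp_add]; congr 1; ring
  rw [wt1, wt1, wt1, e, pow_add]
  ring

/-- The value of the Selberg integral below. -/
noncomputable def selbergValue (n : ℕ) (p : ℝ) (q : ℕ) : ℝ :=
  ∏ k ∈ Finset.range n, ((n - 1 - k).factorial * (q + k).factorial / rising (p + k) (q + n))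

lemma selbergValue_succ (n : ℕ) (p : ℝ) (q : ℕ) :
    selbergValue (n + 1) p q
      = n.factorial * (q.factorial / rising p (q + 1 + n)) * selbergValue n (p + 1) (q + 1) := by
  rw [selbergValue, Finset.prod_range_succ', mul_comm, selbergValue]
  congr 1
  · rw [Nat.cast_zero, add_zero, add_zero, Nat.add_sub_cancel, Nat.sub_zero, mul_div_assoc,
      add_assoc, add_comm 1 n]
  · refine Finset.prod_congr rfl fun k _ => ?_
    have e1 : n + 1 - 1 - (k + 1) = n - 1 - k := by omega
    have e2 : q + (k + 1) = q + 1 + k := by omega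
    have e3 : q + (n + 1) = q + 1 + n := by omega
    have e4 : p + ((k + 1 : ℕ) : ℝ) = p + 1 + k := by push_cast; ring
    rw [e1, e2, e3, e4]

/-- Integration over the first component of an interlacing pair. -/
lemma lintegral_interlacing {n : ℕ} {p : ℝ} (hp : 0 < p) (q : ℕ) (G : (Fin n → ℝ) → ℝ)
    (hG : Measurable G) :
    ∫⁻ w in region n, ENNReal.ofReal (expVd w.1 * wtProd p q w.1) * ENNReal.ofReal (G w.2)
      = ENNReal.ofReal (q.factorial / rising p (q + 1 + n)) *
        ∫⁻ y in ordered n, ENNReal.ofReal (expVd y * wtProd p (q + 1) y * G y) := by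
  have hF : Measurable fun x : Fin (n + 1) → ℝ => ENNReal.ofReal (expVd x * wtProd p q x) :=
    ((continuous_expVd _).mul (continuous_wtProd _ p q)).measurable.ennreal_ofReal
  have hr := rising_pos hp (q + 1 + n)
  rw [lintegral_region_fst hF hG.ennreal_ofReal, ← lintegral_const_mul']
  · refine setLIntegral_congr_fun (isOpen_ordered n).measurableSet fun y hy => ?_
    have h0 := mul_nonneg (expVd_nonneg hy.1) (wtProd_nonneg p (q + 1) hy.2)
    rw [lintegral_fiber hy hp, ENNReal.ofReal_mul (by positivity), ENNReal.ofReal_mul h0, mul_assoc]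
  · exact ENNReal.ofReal_ne_top

/-- A Selberg integral. -/
theorem lintegral_expVd_sq (n : ℕ) : ∀ {p : ℝ} (_ : 0 < p) (q : ℕ),
    ∫⁻ y in ordered n, ENNReal.ofReal (expVd y * wtProd p q y * expVd y)
      = ENNReal.ofReal (selbergValue n p q) := by
  induction n with
  | zero =>
    intro p hp q
    have h1 : ordered 0 = Set.univ := Set.eq_univ_of_forall fun y =>
      ⟨fun i => i.elim0, fun i => i.elim0⟩
    have h2 : ∀ y : Fin 0 → ℝ, expVd y * wtProd p q y * expVd y = 1 := fun y => by
      simp [expVd, vd, wtProd]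
    simp only [h1, h2, Measure.restrict_univ, selbergValue]
    simp [volume_pi]
  | succ n ih =>
    intro p hp q
    have hF : Measurable fun x : Fin (n + 1) → ℝ => ENNReal.ofReal (expVd x * wtProd p q x) :=
      ((continuous_expVd _).mul (continuous_wtProd _ p q)).measurable.ennreal_ofReal
    have hG : Measurable fun y : Fin n → ℝ => expVd y * wtProd 1 0 y :=
      ((continuous_expVd _).mul (continuous_wtProd _ 1 0)).measurable
    -- One integral over interlacing pairs, in two orders. Integrating out `y`, weighted by the
    -- Jacobian of `exp (-y)`, gives a second factor `expVd x` over `n!`; integrating out `x` leads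
    -- to the case `n` with `p + 1` and `q + 1`.
    have h1 := lintegral_region_snd hF hG.ennreal_ofReal
    rw [lintegral_interlacing hp q _ hG] at h1
    have h2 : ∫⁻ x in ordered (n + 1), ENNReal.ofReal (expVd x * wtProd p q x) *
          ∫⁻ y in {y | (x, y) ∈ region n}, ENNReal.ofReal (expVd y * wtProd 1 0 y)
        = ENNReal.ofReal (n.factorial : ℝ)⁻¹ *
          ∫⁻ x in ordered (n + 1), ENNReal.ofReal (expVd x * wtProd p q x * expVd x) := by
      rw [← lintegral_const_mul' _ _ ENNReal.ofReal_ne_top]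
      refine setLIntegral_congr_fun (isOpen_ordered _).measurableSet fun x hx => ?_
      have h0 := mul_nonneg (expVd_nonneg hx.1) (wtProd_nonneg p q hx.2)
      rw [lintegral_cofiber hx, ENNReal.ofReal_mul (p := (n.factorial : ℝ)⁻¹) (by positivity),
        ENNReal.ofReal_mul h0]
      ring
    have h3 : ∀ y : Fin n → ℝ, expVd y * wtProd p (q + 1) y * (expVd y * wtProd 1 0 y)
        = expVd y * wtProd (p + 1) (q + 1) y * expVd y := fun y => by
      rw [← add_zero (q + 1), ← wtProd_mul p 1 (q + 1) 0, add_zero]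
      ring
    rw [h2] at h1
    simp only [h3] at h1
    rw [ih (by linarith)] at h1
    have hn : 0 < (n.factorial : ℝ) := by positivity
    have h4 : ENNReal.ofReal (n.factorial : ℝ) * ENNReal.ofReal (n.factorial : ℝ)⁻¹ = 1 := by
      rw [← ENNReal.ofReal_mul hn.le, mul_inv_cancel₀ hn.ne', ENNReal.ofReal_one]
    have hr := rising_pos hp (q + 1 + n)
    rw [selbergValue_succ, mul_assoc, ENNReal.ofReal_mul hn.le, ENNReal.ofReal_mul (by positivity),
      h1, ← mul_assoc, h4, one_mul]

lemma prod_Icc_one_eq_range (f : ℕ → ℝ) (n : ℕ) :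
    ∏ i ∈ Finset.Icc 1 n, f i = ∏ i ∈ Finset.range n, f (i + 1) := by
  rw [prod_Icc_one, Fin.prod_univ_eq_prod_range (fun i => f (i + 1))]

lemma prod_factorial_Icc (m : ℕ) :
    ∏ l ∈ Finset.Icc 1 (m - 1), (l.factorial : ℝ) = ∏ l ∈ Finset.range m, (l.factorial : ℝ) := by
  cases m with
  | zero => simp
  | succ m => rw [Nat.add_sub_cancel, prod_Icc_one_eq_range, Finset.prod_range_succ']; simp

lemma Ktilde_eq (d n : ℕ) {a a₁ : ℝ} (ha : 0 < a) (ha₁ : 0 < a + a₁) :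
    Ktilde (d + 1 + n) n a a₁
      = (∏ l ∈ Finset.range d, (l.factorial : ℝ))
        / ((∏ l ∈ Finset.range (d + 1 + n), (l.factorial : ℝ)) *
          ∏ l ∈ Finset.range n, (l.factorial : ℝ))
        * rising (a + a₁) (d + 1 + n) * ∏ k ∈ Finset.range n, rising (2 * a + k) (d + 1 + n) := by
  have e1 : d + 1 + n - n - 2 = d - 1 := by omega
  rw [Ktilde, e1, prod_factorial_Icc, prod_factorial_Icc, prod_factorial_Icc, gamma_add_div ha₁,
    prod_gamma_div ha, prod_Icc_one_eq_range (fun i => a + a₁ + ((i - 1 : ℕ) : ℝ)), rising]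
  congr 1
  rw [Finset.prod_comm, prod_Icc_one_eq_range]
  refine Finset.prod_congr rfl fun k _ => ?_
  rw [prod_Icc_one_eq_range, rising]
  refine Finset.prod_congr rfl fun i _ => ?_
  have e : i + 1 + (k + 1) - 2 = k + i := by omega
  rw [e]
  push_cast
  ring

lemma Ktilde_pos (d n : ℕ) {a a₁ : ℝ} (ha : 0 < a) (ha₁ : 0 < a + a₁) :
    0 < Ktilde (d + 1 + n) n a a₁ := by
  rw [Ktilde_eq d n ha ha₁]
  have h1 := rising_pos ha₁ (d + 1 + n)
  have h2 : 0 < ∏ k ∈ Finset.range n, rising (2 * a + k) (d + 1 + n) :=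
    Finset.prod_pos fun k _ => rising_pos (by positivity) _
  have h3 : ∀ m : ℕ, 0 < ∏ l ∈ Finset.range m, (l.factorial : ℝ) := fun m =>
    Finset.prod_pos fun l _ => by positivity
  have h4 := h3 d
  have h5 := h3 (d + 1 + n)
  have h6 := h3 n
  positivity

/-- The second factor is the mass of the unnormalised density: the constant from integrating out `x`
times the Selberg integral left in `y`. The factorials below `d`, `d!` and the `(d + 1 + k)!`
together make up those below `n₁`. -/
lemma Ktilde_mul_selbergValue (d n : ℕ) {a a₁ : ℝ} (ha : 0 < a) (ha₁ : 0 < a + a₁) :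
    Ktilde (d + 1 + n) n a a₁ *
      (d.factorial / rising (a + a₁) (d + 1 + n) * selbergValue n (2 * a) (d + 1)) = 1 := by
  have h1 := (rising_pos ha₁ (d + 1 + n)).ne'
  have h2 : ∏ k ∈ Finset.range n, rising (2 * a + k) (d + 1 + n) ≠ 0 :=
    (Finset.prod_pos fun k _ => rising_pos (by positivity) _).ne'
  have h3 : ∀ m : ℕ, ∏ l ∈ Finset.range m, (l.factorial : ℝ) ≠ 0 := fun m =>
    (Finset.prod_pos fun l _ => by positivity).ne'
  have h4 : selbergValue n (2 * a) (d + 1) = (∏ l ∈ Finset.range n, (l.factorial : ℝ)) *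
      (∏ k ∈ Finset.range n, ((d + 1 + k).factorial : ℝ)) /
        ∏ k ∈ Finset.range n, rising (2 * a + k) (d + 1 + n) := by
    rw [selbergValue, Finset.prod_div_distrib, Finset.prod_mul_distrib,
      Finset.prod_range_reflect (fun l => (l.factorial : ℝ))]
  have h5 : ∏ l ∈ Finset.range (d + 1 + n), (l.factorial : ℝ)
      = (∏ l ∈ Finset.range d, (l.factorial : ℝ)) * d.factorial *
        ∏ k ∈ Finset.range n, ((d + 1 + k).factorial : ℝ) := by
    rw [Finset.prod_range_add, Finset.prod_range_succ]
  have h6 : ∏ k ∈ Finset.range n, ((d + 1 + k).factorial : ℝ) ≠ 0 :=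
    (Finset.prod_pos fun l _ => by positivity).ne'
  have h7 : (d.factorial : ℝ) ≠ 0 := by positivity
  have h8 := h3 d
  have h9 := h3 n
  rw [Ktilde_eq d n ha ha₁, h4, h5]
  generalize ∏ k ∈ Finset.range n, ((d + 1 + k).factorial : ℝ) = A at *
  generalize ∏ l ∈ Finset.range n, (l.factorial : ℝ) = B at *
  generalize ∏ l ∈ Finset.range d, (l.factorial : ℝ) = C at *
  generalize ∏ k ∈ Finset.range n, rising (2 * a + k) (d + 1 + n) = D at *
  field_simp

/-- Regrouped by variable, every `x_j` has exponential rate `a + a₁`, the last one included, and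
every `y_j` has rate `a - a₁`, which may be negative. -/
lemma jacobiDensity_eq (d n : ℕ) (a a₁ : ℝ) (x : Fin (n + 1) → ℝ) (y : Fin n → ℝ) :
    jacobiDensity (d + 1 + n) n a a₁ x y
      = Ktilde (d + 1 + n) n a a₁ *
        ((expVd x * wtProd (a + a₁) d x) * (expVd y * wtProd (a - a₁) 0 y)) := by
  have e1 : d + 1 + n - (n + 1) = d := by omega
  have h1 : wtProd (a + a₁) d x = (∏ i, (1 - Real.exp (-x i)) ^ d) *
      (Real.exp (∑ j : Fin n, -(a + a₁) * x j.castSucc) * Real.exp (-(a + a₁) * x (Fin.last n))) := by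
    rw [wtProd]
    simp only [wt1]
    rw [Finset.prod_mul_distrib, ← Real.exp_sum, Fin.sum_univ_castSucc, Real.exp_add]
    ring
  have h2 : wtProd (a - a₁) 0 y = Real.exp (∑ j : Fin n, -(a - a₁) * y j) := by
    rw [wtProd, Real.exp_sum]
    simp only [wt1, pow_zero, mul_one]
  have h3 : Real.exp (-a * ∑ j : Fin n, (x j.castSucc + y j)) *
      Real.exp (-a₁ * ∑ j : Fin n, (x j.castSucc - y j))
      = Real.exp (∑ j : Fin n, -(a + a₁) * x j.castSucc) *
        Real.exp (∑ j : Fin n, -(a - a₁) * y j) := by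
    rw [← Real.exp_add, ← Real.exp_add, Finset.mul_sum, Finset.mul_sum, ← Finset.sum_add_distrib,
      ← Finset.sum_add_distrib]
    congr 1
    refine Finset.sum_congr rfl fun j _ => ?_
    ring
  rw [jacobiDensity, e1, mul_assoc _ (Real.exp _) (Real.exp (-a₁ * _)), h3, h1, h2]
  simp only [expVd, vd]
  ring

theorem jacobiDensity_nonneg {n₁ n₂ : ℕ} (hn : n₂ < n₁) {a a₁ : ℝ} (ha : 0 < a)
    (ha₁ : 0 < a + a₁) {w : (Fin (n₂ + 1) → ℝ) × (Fin n₂ → ℝ)} (hw : w ∈ region n₂) :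
    0 ≤ jacobiDensity n₁ n₂ a a₁ w.1 w.2 := by
  obtain ⟨d, rfl⟩ : ∃ d, n₁ = d + 1 + n₂ := ⟨n₁ - n₂ - 1, by omega⟩
  obtain ⟨h1, h2⟩ := region_ordered hw
  rw [jacobiDensity_eq]
  exact mul_nonneg (Ktilde_pos d n₂ ha ha₁).le (mul_nonneg
    (mul_nonneg (expVd_nonneg h1.1) (wtProd_nonneg _ _ h1.2))
    (mul_nonneg (expVd_nonneg h2.1) (wtProd_nonneg _ _ h2.2)))

theorem lintegral_jacobiDensity {n₁ n₂ : ℕ} (hn : n₂ < n₁) {a a₁ : ℝ} (ha : 0 < a)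
    (ha₁ : 0 < a + a₁) :
    ∫⁻ w in region n₂, ENNReal.ofReal (jacobiDensity n₁ n₂ a a₁ w.1 w.2) = 1 := by
  obtain ⟨d, rfl⟩ : ∃ d, n₁ = d + 1 + n₂ := ⟨n₁ - n₂ - 1, by omega⟩
  have hK := (Ktilde_pos d n₂ ha ha₁).le
  have hG : Measurable fun y : Fin n₂ → ℝ => expVd y * wtProd (a - a₁) 0 y :=
    ((continuous_expVd _).mul (continuous_wtProd _ _ 0)).measurable
  have h1 : ∫⁻ w in region n₂, ENNReal.ofReal (jacobiDensity (d + 1 + n₂) n₂ a a₁ w.1 w.2)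
      = ENNReal.ofReal (Ktilde (d + 1 + n₂) n₂ a a₁) * ∫⁻ w in region n₂,
        ENNReal.ofReal (expVd w.1 * wtProd (a + a₁) d w.1) *
          ENNReal.ofReal (expVd w.2 * wtProd (a - a₁) 0 w.2) := by
    rw [← lintegral_const_mul' _ _ ENNReal.ofReal_ne_top]
    refine setLIntegral_congr_fun (isOpen_region n₂).measurableSet fun w hw => ?_
    obtain ⟨hx, -⟩ := region_ordered hw
    rw [jacobiDensity_eq, ENNReal.ofReal_mul hK,
      ENNReal.ofReal_mul (mul_nonneg (expVd_nonneg hx.1) (wtProd_nonneg _ _ hx.2))]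
  -- Integrating out `x` leaves rate `a + a₁` on `y`; with the rate `a - a₁` already there the total
  -- is `2 a > 0`.
  have h2 : ∀ y : Fin n₂ → ℝ, expVd y * wtProd (a + a₁) (d + 1) y *
      (expVd y * wtProd (a - a₁) 0 y) = expVd y * wtProd (2 * a) (d + 1) y * expVd y := fun y => by
    have e : 2 * a = (a + a₁) + (a - a₁) := by ring
    rw [e, ← add_zero (d + 1), ← wtProd_mul (a + a₁) (a - a₁) (d + 1) 0, add_zero]
    ring
  have hr := rising_pos ha₁ (d + 1 + n₂)
  rw [h1, lintegral_interlacing ha₁ d _ hG]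
  simp only [h2]
  rw [lintegral_expVd_sq n₂ (by linarith), ← ENNReal.ofReal_mul (by positivity),
    ← ENNReal.ofReal_mul hK, Ktilde_mul_selbergValue d n₂ ha ha₁, ENNReal.ofReal_one]

end RSKJacobi

namespace RSKJacobi

/-! ### The density in the variables in `(0, 1)` -/

lemma sum_odd_split {n : ℕ} (f : Fin (2 * n + 1) → ℝ) :
    ∑ k, f k = f 0 + ∑ l : Fin n, (f ⟨2 * l + 1, by omega⟩ + f ⟨2 * l + 2, by omega⟩) := by
  induction n with
  | zero => simp
  | succ n ih =>
    have h := ih fun k => f ⟨k, by omega⟩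
    have h1 : ∑ k, f k = (∑ k : Fin (2 * n + 1), f ⟨k, by omega⟩) + f ⟨2 * n + 1, by omega⟩
        + f ⟨2 * n + 2, by omega⟩ := by
      exact (Fin.sum_univ_castSucc (n := 2 * n + 2) f).trans
        (congrArg (· + _) (Fin.sum_univ_castSucc (n := 2 * n + 1) _))
    rw [h1, h, Fin.sum_univ_castSucc]
    simp only [Fin.val_castSucc, Fin.val_last]
    rw [add_assoc, add_assoc]
    rfl

/-- Reversal exchanges the two members of each pair, so the reordered product acquires no sign. -/
lemma prod_pairs_rev {m : ℕ} (v : Fin m → ℝ) :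
    ∏ i : Fin m, ∏ j ∈ Finset.Ioi i, (v j.rev - v i.rev) = ∏ i, ∏ j ∈ Finset.Ioi i, (v i - v j) := by
  have h : ∀ f : Fin m → Fin m → ℝ, ∏ i, ∏ j ∈ Finset.Ioi i, f i j
      = ∏ i, ∏ j, if i < j then f i j else 1 := fun f => by
    refine Finset.prod_congr rfl fun i _ => ?_
    rw [← Finset.prod_filter]
    refine Finset.prod_congr ?_ fun _ _ => rfl
    ext j
    simp
  rw [h, h, Finset.prod_comm, ← Equiv.prod_comp Fin.revPerm]
  refine Finset.prod_congr rfl fun i _ => ?_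
  rw [← Equiv.prod_comp Fin.revPerm]
  refine Finset.prod_congr rfl fun j _ => ?_
  simp only [Fin.revPerm_apply, Fin.rev_lt_rev, Fin.rev_rev]

section

variable {n : ℕ} {X : Fin (2 * n + 1) → ℝ}

theorem mem_region_of_strictAnti (hX : StrictAnti X) (h1 : X 0 < 1)
    (h0 : 0 < X (Fin.last (2 * n))) : (xOfOdd n X, yOfOdd n X) ∈ region n := by
  have hpos : ∀ k, 0 < X k := fun k => h0.trans_le (hX.antitone (Fin.le_last k))
  refine ⟨fun j => ⟨?_, ?_⟩, ?_⟩
  · refine neg_lt_neg (Real.log_lt_log (hpos _) (hX ?_))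
    rw [Fin.lt_def]
    simp only [Fin.val_castSucc]
    omega
  · refine neg_lt_neg (Real.log_lt_log (hpos _) (hX ?_))
    rw [Fin.lt_def]
    simp only [Fin.val_succ]
    omega
  · refine neg_pos.2 (Real.log_neg (hpos _) ?_)
    convert! h1
    simp

lemma exp_neg_xOfOdd (hpos : ∀ k, 0 < X k) (j : Fin (n + 1)) :
    Real.exp (-xOfOdd n X j) = X ⟨2 * j.rev, by omega⟩ := by
  rw [xOfOdd, neg_neg, Real.exp_log (hpos _)]
  congr 1
  rw [Fin.ext_iff]
  simp only [Fin.val_rev]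
  omega

lemma exp_neg_yOfOdd (hpos : ∀ k, 0 < X k) (j : Fin n) :
    Real.exp (-yOfOdd n X j) = X ⟨2 * j.rev + 1, by omega⟩ := by
  rw [yOfOdd, neg_neg, Real.exp_log (hpos _)]
  congr 1
  rw [Fin.ext_iff]
  simp only [Fin.val_rev]
  omega

lemma sum_xOfOdd : ∑ j : Fin n, xOfOdd n X j.castSucc
    = -∑ l : Fin n, Real.log (X ⟨2 * l + 2, by omega⟩) := by
  rw [← Equiv.sum_comp Fin.revPerm, ← Finset.sum_neg_distrib]
  refine Finset.sum_congr rfl fun j _ => ?_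
  rw [xOfOdd]
  congr 3
  rw [Fin.ext_iff]
  simp only [Fin.val_castSucc, Fin.revPerm_apply, Fin.val_rev]
  omega

lemma sum_yOfOdd : ∑ j : Fin n, yOfOdd n X j
    = -∑ l : Fin n, Real.log (X ⟨2 * l + 1, by omega⟩) := by
  rw [← Equiv.sum_comp Fin.revPerm, ← Finset.sum_neg_distrib]
  refine Finset.sum_congr rfl fun j _ => ?_
  rw [yOfOdd]
  congr 3
  rw [Fin.ext_iff]
  simp only [Fin.revPerm_apply, Fin.val_rev]
  omega

lemma xOfOdd_last : xOfOdd n X (Fin.last n) = -Real.log (X 0) := by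
  rw [xOfOdd]
  congr 3
  rw [Fin.ext_iff]
  simp

/-- With `n₁ = n₂ + 1` the factors `1 - exp (-x_i)` have exponent zero. The Vandermonde products are
polynomial in `X`, and everything else is the exponential of a linear form in the `log X_j`; the
Jacobian lowers `(a + 1) / 2` to `(a - 1) / 2`. -/
theorem jacobiDensity_odd (hpos : ∀ k, 0 < X k) (a A : ℝ) :
    jacobiDensity (n + 1) n ((a + 1) / 2) (-A / 2) (xOfOdd n X) (yOfOdd n X) * ∏ j, (X j)⁻¹
      = Ktilde (n + 1) n ((a + 1) / 2) (-A / 2) * oddWeight n a A X := by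
  have hV1 : ∏ i, ∏ j ∈ Finset.Ioi i,
        (Real.exp (-xOfOdd n X j) - Real.exp (-xOfOdd n X i))
      = ∏ j : Fin (n + 1), ∏ k ∈ Finset.Ioi j,
        (X ⟨2 * j, by omega⟩ - X ⟨2 * k, by omega⟩) := by
    simp only [exp_neg_xOfOdd hpos]
    exact prod_pairs_rev fun j : Fin (n + 1) => X ⟨2 * j, by omega⟩
  have hV2 : ∏ i, ∏ j ∈ Finset.Ioi i,
        (Real.exp (-yOfOdd n X j) - Real.exp (-yOfOdd n X i))
      = ∏ j : Fin n, ∏ k ∈ Finset.Ioi j,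
        (X ⟨2 * j + 1, by omega⟩ - X ⟨2 * k + 1, by omega⟩) := by
    simp only [exp_neg_yOfOdd hpos]
    exact prod_pairs_rev fun j : Fin n => X ⟨2 * j + 1, by omega⟩
  have hlog := sum_odd_split fun k => Real.log (X k)
  rw [Finset.sum_add_distrib] at hlog
  have hinv : ∏ j, (X j)⁻¹ = Real.exp (-∑ j, Real.log (X j)) := by
    rw [← Finset.sum_neg_distrib, Real.exp_sum]
    refine Finset.prod_congr rfl fun j _ => ?_
    rw [Real.exp_neg, Real.exp_log (hpos j)]
  have hpow : ∏ j, X j ^ ((a - 1) / 2) = Real.exp ((a - 1) / 2 * ∑ j, Real.log (X j)) := by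
    rw [Finset.mul_sum, Real.exp_sum]
    refine Finset.prod_congr rfl fun j _ => ?_
    rw [Real.rpow_def_of_pos (hpos j), mul_comm]
  have hquot : ∏ l : Fin n, (X ⟨2 * l + 2, by omega⟩ / X ⟨2 * l + 1, by omega⟩) ^ (-A / 2)
      = Real.exp (-A / 2 * (∑ l : Fin n, Real.log (X ⟨2 * l + 2, by omega⟩)
        - ∑ l : Fin n, Real.log (X ⟨2 * l + 1, by omega⟩))) := by
    rw [← Finset.sum_sub_distrib, Finset.mul_sum, Real.exp_sum]
    refine Finset.prod_congr rfl fun j _ => ?_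
    rw [Real.rpow_def_of_pos (div_pos (hpos _) (hpos _)), Real.log_div (hpos _).ne' (hpos _).ne',
      mul_comm]
  rw [jacobiDensity, oddWeight, hV1, hV2, hinv, hpow, hquot, Nat.sub_self,
    Real.rpow_def_of_pos (hpos 0), Finset.sum_add_distrib, Finset.sum_sub_distrib, sum_xOfOdd,
    sum_yOfOdd, xOfOdd_last, hlog]
  simp only [pow_zero, Finset.prod_const_one, mul_one]
  generalize (∑ l : Fin n, Real.log (X ⟨2 * l + 2, by omega⟩)) = S
  generalize (∑ l : Fin n, Real.log (X ⟨2 * l + 1, by omega⟩)) = T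
  generalize Real.log (X 0) = l
  generalize (∏ j : Fin (n + 1), ∏ k ∈ Finset.Ioi j,
        (X ⟨2 * j, by omega⟩ - X ⟨2 * k, by omega⟩)) = V
  generalize (∏ j : Fin n, ∏ k ∈ Finset.Ioi j,
        (X ⟨2 * j + 1, by omega⟩ - X ⟨2 * k + 1, by omega⟩)) = W
  -- `l` is `log X_1`, `S` sums the logarithms of the other odd-numbered coordinates and `T` those
  -- of the even-numbered ones.
  have h : Real.exp (-((a + 1) / 2) * (-S + -T)) * Real.exp (-(-A / 2) * (-S - -T)) *
      Real.exp (-((a + 1) / 2 + -A / 2) * -l) * Real.exp (-(l + (T + S)))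
      = Real.exp ((a - 1) / 2 * (l + (T + S))) * Real.exp (l * (-A / 2)) *
        Real.exp (-A / 2 * (S - T)) := by
    simp only [← Real.exp_add]
    congr 1
    ring
  linear_combination Ktilde (n + 1) n ((a + 1) / 2) (-A / 2) * V * W * h

end

end RSKJacobi

theorem mainTheorem8 (n₁ n₂ : ℕ) (hn : n₂ < n₁) :
    -- the joint probability
    (∀ (Ω : Type*) [MeasurableSpace Ω] (P : Measure Ω) [IsProbabilityMeasure P]
        (z α t : ℝ) (_ : 0 < z) (_ : 0 < α) (_ : 0 < t) (_ : t ≠ 1)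
        (_ : ∀ (i : Fin n₁) (j : Fin (n₂ + 1)), RSKJacobi.siteParam z α t i j < 1)
        (X : Fin n₁ → Fin (n₂ + 1) → Ω → ℕ) (_ : RSKJacobi.HasSiteLaw P X z α t)
        (μ κ : YoungDiagram),
      (RSKJacobi.jointProb P X μ κ ≠ 0 ↔
        μ.colLen 0 ≤ n₂ + 1 ∧ κ.colLen 0 ≤ n₂ ∧
          RSKJacobi.Interlaced (RSKJacobi.shiftMu n₂ μ) (RSKJacobi.shiftKappa n₂ κ)) ∧
      (μ.colLen 0 ≤ n₂ + 1 → κ.colLen 0 ≤ n₂ →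
        RSKJacobi.Interlaced (RSKJacobi.shiftMu n₂ μ) (RSKJacobi.shiftKappa n₂ κ) →
        RSKJacobi.jointProb P X μ κ =
          RSKJacobi.probFormula n₁ n₂ α z t
            (RSKJacobi.shiftMu n₂ μ) (RSKJacobi.shiftKappa n₂ κ))) ∧
    -- the Jacobi limit
    (∀ a a₁ : ℝ, 0 < a → 0 < a + a₁ →
      (∀ (x : Fin (n₂ + 1) → ℝ) (y : Fin n₂ → ℝ), (x, y) ∈ RSKJacobi.region n₂ →
        ∀ (h : ℝ → Fin (n₂ + 1) → ℕ) (r : ℝ → Fin n₂ → ℕ),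
          (∀ j, Tendsto (fun L => (h L j : ℝ) / L) atTop (𝓝 (x j))) →
          (∀ j, Tendsto (fun L => (r L j : ℝ) / L) atTop (𝓝 (y j))) →
          Tendsto (fun L : ℝ => L ^ (2 * n₂ + 1) *
              RSKJacobi.probFormula n₁ n₂ (Real.exp (-a₁ / L)) (Real.exp (-a / L))
                (Real.exp (-1 / L)) (h L) (r L))
            atTop (𝓝 (RSKJacobi.jacobiDensity n₁ n₂ a a₁ x y))) ∧
      -- the limit is a probability density on the region
      (∀ p ∈ RSKJacobi.region n₂, 0 ≤ RSKJacobi.jacobiDensity n₁ n₂ a a₁ p.1 p.2) ∧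
      ∫⁻ p in RSKJacobi.region n₂,
        ENNReal.ofReal (RSKJacobi.jacobiDensity n₁ n₂ a a₁ p.1 p.2) = 1) ∧
    -- for `n₁ = n₂ + 1`, the density in the variables `X = exp (-x), exp (-y)` (with Jacobian
    -- `∏ 1 / X_j`) for an odd number of coordinates
    (n₁ = n₂ + 1 → ∀ a A : ℝ, -1 < a → A < a + 1 →
      ∀ X : Fin (2 * n₂ + 1) → ℝ, StrictAnti X → X 0 < 1 → 0 < X (Fin.last (2 * n₂)) →
        (RSKJacobi.xOfOdd n₂ X, RSKJacobi.yOfOdd n₂ X) ∈ RSKJacobi.region n₂ ∧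
        RSKJacobi.jacobiDensity n₁ n₂ ((a + 1) / 2) (-A / 2)
            (RSKJacobi.xOfOdd n₂ X) (RSKJacobi.yOfOdd n₂ X) * ∏ j, (X j)⁻¹ =
          RSKJacobi.Ktilde n₁ n₂ ((a + 1) / 2) (-A / 2) * RSKJacobi.oddWeight n₂ a A X) := by
  refine ⟨fun Ω _ P _ z α t hz hα ht ht1 hq X hX μ κ =>
    RSKJacobi.jointProb_eq hn hz hα ht ht1 hq hX μ κ, fun a a₁ ha ha₁ =>
    ⟨fun x y _ h r hh hr => RSKJacobi.tendsto_probFormula hn ha ha₁ hh hr,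
      fun p hp => RSKJacobi.jacobiDensity_nonneg hn ha ha₁ hp,
      RSKJacobi.lintegral_jacobiDensity hn ha ha₁⟩, ?_⟩
  rintro rfl a A - - X hX h1 h0
  exact ⟨RSKJacobi.mem_region_of_strictAnti hX h1 h0,
    RSKJacobi.jacobiDensity_odd (fun k => h0.trans_le (hX.antitone (Fin.le_last k))) a A⟩
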